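/- Let $H$ be a complex Hilbert space and let $T\in B(H)$ be power bounded, i.e. $\sup_{n\ge 0}\|T^n\|<\infty$. The following assertions are equivalent. (i) $T$ is a Ritt operator which admits a bounded $H^\infty(B_\gamma)$ functional calculus for some $\gamma\in(0,\frac{\pi}{2})$. (ii) There is a constant $C\ge 0$ such that $\|x\|_{T,1}\le C\|x\|$ and $\|y\|_{T^*,1}\le C\|y\|$ for all $x,y\in H$, where for $S\in B(H)$ $$\|x\|_{S,1}=\Bigl(\sum_{k=1}^\infty k\,\|S^{k-1}(I-S)x\|^2\Bigr)^{1/2}\in[0,\infty].$$ (iii) $T$ is a Ritt operator and $T$ is similar to a contraction, i.e. there is an invertible $V\in B(H)$ such that $\|V^{-1}TV\|\le 1$. Here $T$ is called a Ritt operator if the sets $\{T^n : n\ge 0\}$ and $\{n(T^n-T^{n-1}) : n\ge 1\}$ are bounded. For $\gamma\in(0,\frac{\pi}{2})$, $B_\gamma$ denotes the interior of the convex hull of $1$ and the disc $D(0,\sin\gamma)$. The operator $T$ is a Ritt operator of type $\alpha\in(0,\frac{\pi}{2})$ if $\sigma(T)\subset\overline{B_\alpha}$ and, for every $\beta\in(\alpha,\frac{\pi}{2})$,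 the set $\{(\lambda-1)(\lambda-T)^{-1} : \lambda\in\mathbb{C}\setminus\overline{B_\beta}\}$ is bounded. Let $H^\infty_0(B_\gamma)$ be the space of bounded holomorphic functions $\varphi\colon B_\gamma\to\mathbb{C}$ for which there are $s,c>0$ with $|\varphi(\lambda)|\le c|1-\lambda|^s$ on $B_\gamma$. The operator $T$ admits a bounded $H^\infty(B_\gamma)$ functional calculus if it is a Ritt operator of some type $\alpha\in(0,\gamma)$ and there is a constant $K>0$ such that $$\|\varphi(T)\|\le K\sup_{\lambda\in B_\gamma}|\varphi(\lambda)|,\qquad \varphi\in H^\infty_0(B_\gamma),$$ where $\varphi(T)=\frac{1}{2\pi i}\int_{\partial B_\beta}\varphi(\lambda)(\lambda-T)^{-1}\,d\lambda$ for any $\beta\in(\alpha,\gamma)$, the boundary being oriented counterclockwise (this integral converges absolutely and does not depend on $\beta$). -/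

import Mathlib

noncomputable section

namespace Ritt

section Domain

/-- The Stolz domain `B_γ`: the interior of the convex hull of `1` and the open disc
`D(0, sin γ)`. -/
def stolz (γ : ℝ) : Set ℂ :=
  interior (convexHull ℝ (insert (1 : ℂ) (Metric.ball (0 : ℂ) (Real.sin γ))))

/-- The space `H^∞_0(B_γ)`: bounded holomorphic functions on `B_γ` with
`|φ z| ≤ c |1 - z| ^ s` on `B_γ` for some `s, c > 0`. Functions are total on `ℂ`, but only the
values on `B_γ` matter. -/
def HInftyZero (γ : ℝ) : Set (ℂ → ℂ) :=
  {φ | DifferentiableOn ℂ φ (stolz γ) ∧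
    (∃ M : ℝ, ∀ z ∈ stolz γ, ‖φ z‖ ≤ M) ∧
    ∃ s c : ℝ, 0 < s ∧ 0 < c ∧ ∀ z ∈ stolz γ, ‖φ z‖ ≤ c * ‖1 - z‖ ^ s}

/-- The supremum norm of a (bounded) function on `B_γ`. -/
def supNorm (γ : ℝ) (φ : ℂ → ℂ) : ℝ :=
  sSup ((fun z => ‖φ z‖) '' stolz γ)

variable {E : Type*} [NormedAddCommGroup E] [NormedSpace ℂ E]

/-- The integral of `f(z) dz` along the segment from `a` to `b`. -/
def segmentIntegral (f : ℂ → E) (a b : ℂ) : E :=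
  ∫ t in (0 : ℝ)..1, (b - a) • f (a + (t : ℂ) * (b - a))

/-- The integral of `f(z) dz` along the arc `θ ↦ r * exp (i θ)`, for `θ` from `θ₁` to `θ₂`. -/
def arcIntegral (f : ℂ → E) (r θ₁ θ₂ : ℝ) : E :=
  ∫ θ in θ₁..θ₂,
    ((r : ℂ) * Complex.I * Complex.exp (θ * Complex.I)) • f ((r : ℂ) * Complex.exp (θ * Complex.I))

/-- The integral of `f(z) dz` along the boundary of `B_β` (for `0 < β < π/2`), oriented
counterclockwise. The tangents from `1` to the circle `|z| = sin β` touch it at the two points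
`sin β * exp (± i (π/2 - β))`. The boundary is made of the segment from `1` to the upper tangency
point, of the arc of the circle to the lower one (through `- sin β`), and of the segment from
there back to `1`. -/
def stolzBoundaryIntegral (f : ℂ → E) (β : ℝ) : E :=
  segmentIntegral f 1
      ((Real.sin β : ℂ) * Complex.exp (((Real.pi / 2 - β : ℝ) : ℂ) * Complex.I)) +
    arcIntegral f (Real.sin β) (Real.pi / 2 - β) (2 * Real.pi - (Real.pi / 2 - β)) +
    segmentIntegral f
      ((Real.sin β : ℂ) * Complex.exp (((-(Real.pi / 2 - β) : ℝ) : ℂ) * Complex.I)) 1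

end Domain

section Banach

variable {X : Type*} [NormedAddCommGroup X] [NormedSpace ℂ X]

/-- `T` is power bounded. -/
def IsPowerBounded (T : X →L[ℂ] X) : Prop :=
  ∃ C : ℝ, ∀ n : ℕ, ‖T ^ n‖ ≤ C

/-- `T` is a Ritt operator: the sets `{T ^ n : n ≥ 0}` and `{n (T ^ n - T ^ (n - 1)) : n ≥ 1}`
are bounded (the second one is indexed by `n + 1`, `n ≥ 0`). -/
def IsRitt (T : X →L[ℂ] X) : Prop :=
  IsPowerBounded T ∧ ∃ C : ℝ, ∀ n : ℕ, ((n : ℝ) + 1) * ‖T ^ (n + 1) - T ^ n‖ ≤ C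

/-- `T` is a Ritt operator of type `α`, `0 < α < π/2`: the spectrum of `T` is contained in the
closure of `B_α`, and `(z - 1) R(z, T)` is bounded outside the closure of `B_β` for
every `β ∈ (α, π/2)`. Here `resolvent T z` is the inverse of `z - T`. -/
def IsRittOfType (T : X →L[ℂ] X) (α : ℝ) : Prop :=
  (0 < α ∧ α < Real.pi / 2) ∧
  spectrum ℂ T ⊆ closure (stolz α) ∧
  ∀ β : ℝ, α < β → β < Real.pi / 2 →
    ∃ C : ℝ, ∀ z : ℂ, z ∉ closure (stolz β) → ‖(z - 1) • resolvent T z‖ ≤ C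

/-- The operator `φ(T) = (2πi)⁻¹ ∫_{∂B_β} φ(z) R(z, T) dz`. -/
def funCalc (T : X →L[ℂ] X) (β : ℝ) (φ : ℂ → ℂ) : X →L[ℂ] X :=
  (2 * (Real.pi : ℂ) * Complex.I)⁻¹ •
    stolzBoundaryIntegral (fun z => φ z • resolvent T z) β

/-- `T` admits a bounded `H^∞(B_γ)` functional calculus: `T` is of some type `α < γ`, and
`‖φ(T)‖ ≤ K ‖φ‖_{∞, B_γ}` for all `φ ∈ H^∞_0(B_γ)`, where `φ(T)` is given by the Cauchy integral
over `∂B_β`, for any `β ∈ (α, γ)` (its value does not depend on `β`). -/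
def HasBoundedHInftyCalculus (T : X →L[ℂ] X) (γ : ℝ) : Prop :=
  ∃ α : ℝ, α < γ ∧ IsRittOfType T α ∧
    ∃ K : ℝ, 0 < K ∧ ∀ φ ∈ HInftyZero γ, ∀ β : ℝ, α < β → β < γ →
      ‖funCalc T β φ‖ ≤ K * supNorm γ φ

end Banach

section Hilbert

variable {H : Type*} [NormedAddCommGroup H] [InnerProductSpace ℂ H]

open scoped ENNReal NNReal

/-- The square function `‖x‖_{T,1} = (∑_{k ≥ 1} k ‖T^{k-1} (I - T) x‖²)^{1/2} ∈ [0, ∞]` on a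
Hilbert space (the sum is indexed by `k + 1`, `k ≥ 0`). -/
def squareFunction (T : H →L[ℂ] H) (x : H) : ℝ≥0∞ :=
  (∑' k : ℕ, ((k : ℝ≥0∞) + 1) * ‖(T ^ k) (x - T x)‖ₑ ^ 2) ^ (1 / 2 : ℝ)

/-- The uniform estimate `‖x‖_{T,1} ≲ ‖x‖`. -/
def SquareFunctionEstimate (T : H →L[ℂ] H) : Prop :=
  ∃ C : ℝ≥0, ∀ x : H, squareFunction T x ≤ (C : ℝ≥0∞) * ‖x‖ₑ

/-- `T` is similar to a contraction: `‖V⁻¹ T V‖ ≤ 1` for some invertible `V ∈ B(H)`. -/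
def IsSimilarToContraction (T : H →L[ℂ] H) : Prop :=
  ∃ V : (H →L[ℂ] H)ˣ, ‖(↑V⁻¹ : H →L[ℂ] H) * T * (V : H →L[ℂ] H)‖ ≤ 1

end Hilbert

end Ritt

end

/-!
# Ritt operators, square functions, and similarity to contractions

The square function condition on `T` and `T*` is the pivot; the functional calculus and the
similarity to a contraction are each shown to be equivalent to it.

* **Square functions give similarity to a contraction.** The forms
  `‖T ^ N x‖ ^ 2 + ∑_{k ≤ N} (k + 1) ‖T ^ k (I - T) x‖ ^ 2` are bounded by `‖x‖ ^ 2`, and also from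
  below, because of the identity `I = S ^ N + N S ^ N (I - S) + ∑_{k < N} (k + 1) S ^ k (I - S) ^ 2`
  with `S = T ^ 2`, in which half of the factors are moved to `T*`
  (`norm_le_of_squareBound_adjoint`). A weak limit of these forms is an equivalent Hilbertian norm
  for which `T` is contractive, since replacing `x` by `T x` shifts the sum
  (`isSimilarToContraction_of_squareBound`).
* **Ritt contractions have square functions.** For a contraction, `A = I - T` is accretive, so that
  `A (s + A)⁻¹ x` has square-summable increments as `s` runs through the powers of `1 / 2`
  (`norm_sq_increment_le`). Since `‖T ^ n A ^ 2‖` decays like `n ^ (-2)` for a Ritt operator, the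
  operator `2 ^ j T ^ (2 ^ j) A` is almost orthogonal to these increments, and Schur's test
  concludes (`sum_dyadic_le_of_contraction`). By monotonicity, the square function is equivalent to
  its restriction to dyadic exponents (`squareBound_of_dyadic`).
* **The functional calculus gives square functions.** The functions `∑ ± 2 ^ j z ^ (2 ^ j) (1 - z)`
  are bounded on a Stolz domain, uniformly in the number of terms and the signs, because there
  `|1 - z|` is comparable to `1 - |z|`. So are the operators `∑ ± 2 ^ j T ^ (2 ^ j) (I - T)`
  (`exists_norm_sum_signs_le`), and a suitable choice of the signs, which may depend on the vector,
  yields the estimate on dyadic exponents, both for `T` and for `T*`.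
* **Square functions give the functional calculus.** The integral that defines `φ(T)` gives
  `(k + 1) ‖φ(T) T ^ k (I - T)‖ ≤ K ‖φ‖_∞`, as the factor `1 - z` cancels the singularity of the
  resolvent (`norm_funCalc_mul_pow_mul_one_sub_le`). In the identity
  `2 I = ∑ (k + 1) (k + 2) S ^ k (I - S) ^ 3 + …` with `S = T ^ 3`, one factor `T ^ k (I - T)` is
  absorbed by `φ(T)`, and the other two by the square functions of `T` and `T*`
  (`norm_le_of_squareBound_of_norm_mul_le`).

The last two items need the resolvent estimates for a Ritt operator
(`exists_type_of_isRitt`) and the multiplicativity of the functional calculus (`map_funCalc`,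
`funCalc_polynomial`), which rest on Cauchy's theorem for the boundary of a Stolz domain and on the
integral of the resolvents of `r T`, `r < 1`.
-/

noncomputable section

namespace Ritt

open Filter Topology MeasureTheory
open scoped ENNReal NNReal InnerProductSpace

/-! ### Square function estimates in real form -/

section SquareFunction

variable {H : Type*} [NormedAddCommGroup H] [InnerProductSpace ℂ H]

/-- The estimate `‖x‖_{T,1} ≤ C ‖x‖`, written with finite sums of real numbers. -/
def SquareBound (T : H →L[ℂ] H) (C : ℝ) : Prop :=
  ∀ (x : H) (n : ℕ),
    ∑ k ∈ Finset.range n, ((k : ℝ) + 1) * ‖(T ^ k * (1 - T)) x‖ ^ 2 ≤ C ^ 2 * ‖x‖ ^ 2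

theorem squareFunction_le_iff (T : H →L[ℂ] H) (C : ℝ≥0) (x : H) :
    squareFunction T x ≤ (C : ℝ≥0∞) * ‖x‖ₑ ↔ ∀ n : ℕ,
      ∑ k ∈ Finset.range n, ((k : ℝ) + 1) * ‖(T ^ k * (1 - T)) x‖ ^ 2 ≤ (C : ℝ) ^ 2 * ‖x‖ ^ 2 := by
  have hterm : ∀ k : ℕ, ((k : ℝ≥0∞) + 1) * ‖(T ^ k) (x - T x)‖ₑ ^ 2 =
      ENNReal.ofReal (((k : ℝ) + 1) * ‖(T ^ k * (1 - T)) x‖ ^ 2) := by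
    intro k
    rw [ENNReal.ofReal_mul (by positivity), ENNReal.ofReal_pow (norm_nonneg _), ofReal_norm,
      ENNReal.ofReal_add (by positivity) zero_le_one, ENNReal.ofReal_natCast, ENNReal.ofReal_one]
    rfl
  have hR : ((C : ℝ≥0∞) * ‖x‖ₑ) ^ (2 : ℝ) = ENNReal.ofReal ((C : ℝ) ^ 2 * ‖x‖ ^ 2) := by
    rw [← mul_pow, ENNReal.ofReal_pow (by positivity), ENNReal.ofReal_mul (by positivity),
      ofReal_norm, ENNReal.ofReal_coe_nnreal]
    norm_cast
  have hpart : ∀ n : ℕ, ∑ k ∈ Finset.range n, ((k : ℝ≥0∞) + 1) * ‖(T ^ k) (x - T x)‖ₑ ^ 2 =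
      ENNReal.ofReal (∑ k ∈ Finset.range n, ((k : ℝ) + 1) * ‖(T ^ k * (1 - T)) x‖ ^ 2) := by
    intro n
    rw [ENNReal.ofReal_sum_of_nonneg (fun _ _ => by positivity)]
    exact Finset.sum_congr rfl fun k _ => hterm k
  have h1 : squareFunction T x ≤ (C : ℝ≥0∞) * ‖x‖ₑ ↔
      ∑' k : ℕ, ((k : ℝ≥0∞) + 1) * ‖(T ^ k) (x - T x)‖ₑ ^ 2 ≤ ((C : ℝ≥0∞) * ‖x‖ₑ) ^ (2 : ℝ) := by
    unfold squareFunction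
    rw [one_div, ENNReal.rpow_inv_le_iff (by norm_num : (0 : ℝ) < 2)]
  rw [h1, hR]
  constructor
  · intro h n
    have := (ENNReal.sum_le_tsum (Finset.range n)).trans h
    rw [hpart n] at this
    exact (ENNReal.ofReal_le_ofReal_iff (by positivity)).1 this
  · intro h
    refine ENNReal.tsum_le_of_sum_range_le fun n => ?_
    rw [hpart n]
    exact ENNReal.ofReal_le_ofReal (h n)

theorem squareFunctionEstimate_iff (T : H →L[ℂ] H) :
    SquareFunctionEstimate T ↔ ∃ C : ℝ, 0 ≤ C ∧ SquareBound T C := by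
  constructor
  · rintro ⟨C, hC⟩
    exact ⟨C, C.2, fun x => (squareFunction_le_iff T C x).1 (hC x)⟩
  · rintro ⟨C, hC0, hC⟩
    exact ⟨⟨C, hC0⟩, fun x => (squareFunction_le_iff T ⟨C, hC0⟩ x).2 (hC x)⟩

/-- The terms `k ‖T ^ k (I - T) x‖` are controlled by the square function, since `‖T ^ n (I - T) x‖`
is almost decreasing in `n`. -/
theorem mul_norm_le_of_sum_le {T : H →L[ℂ] H} {M : ℝ} (hM : ∀ n : ℕ, ‖T ^ n‖ ≤ M) (x : H) {B : ℝ}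
    {N : ℕ} (hB0 : 0 ≤ B)
    (hB : ∑ k ∈ Finset.range (N + 1), ((k : ℝ) + 1) * ‖(T ^ k * (1 - T)) x‖ ^ 2 ≤ B ^ 2) :
    ((N : ℝ) + 1) * ‖(T ^ N * (1 - T)) x‖ ≤ 2 * M * B := by
  have hM0 : 0 ≤ M := (norm_nonneg _).trans (hM 0)
  set y := ‖(T ^ N * (1 - T)) x‖ with hy
  have hk : ∀ k ∈ Finset.range (N + 1),
      ((k : ℝ) + 1) * y ^ 2 ≤ M ^ 2 * (((k : ℝ) + 1) * ‖(T ^ k * (1 - T)) x‖ ^ 2) := by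
    intro k hk
    have hkN : k ≤ N := Nat.lt_succ_iff.1 (Finset.mem_range.1 hk)
    have h1 : y ≤ M * ‖(T ^ k * (1 - T)) x‖ := by
      have : (T ^ N * (1 - T)) x = (T ^ (N - k)) ((T ^ k * (1 - T)) x) := by
        rw [← mul_apply_eq_comp, ← mul_assoc, ← pow_add, Nat.sub_add_cancel hkN]
      rw [hy, this]
      exact (ContinuousLinearMap.le_opNorm _ _).trans
        (mul_le_mul_of_nonneg_right (hM _) (norm_nonneg _))
    have h2 : y ^ 2 ≤ (M * ‖(T ^ k * (1 - T)) x‖) ^ 2 := by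
      gcongr
    calc ((k : ℝ) + 1) * y ^ 2 ≤ ((k : ℝ) + 1) * (M * ‖(T ^ k * (1 - T)) x‖) ^ 2 := by gcongr
      _ = _ := by ring
  have hsum := Finset.sum_le_sum hk
  rw [← Finset.sum_mul, ← Finset.mul_sum] at hsum
  have hg : ∀ n : ℕ, ∑ k ∈ Finset.range (n + 1), ((k : ℝ) + 1) = ((n : ℝ) + 1) * (n + 2) / 2 := by
    intro n
    induction n with
    | zero => norm_num
    | succ n ih => rw [Finset.sum_range_succ, ih]; push_cast; ring
  rw [hg] at hsum
  have h3 : (((N : ℝ) + 1) * y) ^ 2 ≤ (2 * M * B) ^ 2 := by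
    have h4 : M ^ 2 * ∑ k ∈ Finset.range (N + 1), ((k : ℝ) + 1) * ‖(T ^ k * (1 - T)) x‖ ^ 2 ≤
      M ^ 2 * B ^ 2 := by gcongr
    have h5 : (N : ℝ) + 1 ≤ N + 2 := by linarith
    have h6 : 0 ≤ ((N : ℝ) + 1) * y ^ 2 := by positivity
    nlinarith [mul_nonneg (sq_nonneg M) (sq_nonneg B)]
  exact (abs_le_of_sq_le_sq' h3 (by positivity)).2

theorem pow_mul_one_sub_eq (T : H →L[ℂ] H) (n : ℕ) : T ^ n * (1 - T) = -(T ^ (n + 1) - T ^ n) := by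
  rw [mul_sub, mul_one, pow_succ]; abel

theorem isRitt_iff (T : H →L[ℂ] H) : IsRitt T ↔
    (∃ M : ℝ, ∀ n : ℕ, ‖T ^ n‖ ≤ M) ∧ ∃ C : ℝ, ∀ n : ℕ, ((n : ℝ) + 1) * ‖T ^ n * (1 - T)‖ ≤ C := by
  simp only [IsRitt, IsPowerBounded, pow_mul_one_sub_eq, norm_neg]

/-- A power bounded operator with a square function estimate is a Ritt operator. -/
theorem isRitt_of_squareBound {T : H →L[ℂ] H} (hT : IsPowerBounded T) {C : ℝ} (hC0 : 0 ≤ C)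
    (hC : SquareBound T C) : IsRitt T := by
  rw [isRitt_iff]
  refine ⟨hT, ?_⟩
  obtain ⟨M, hM⟩ := hT
  have hM0 : 0 ≤ M := (norm_nonneg _).trans (hM 0)
  refine ⟨2 * M * C, fun n => ?_⟩
  have : ‖((n : ℂ) + 1) • (T ^ n * (1 - T))‖ ≤ 2 * M * C := by
    refine ContinuousLinearMap.opNorm_le_bound _ (by positivity) fun x => ?_
    have h := mul_norm_le_of_sum_le hM x (B := C * ‖x‖) (N := n) (by positivity)
      (by rw [mul_pow]; exact hC x (n + 1))
    rw [smul_apply, norm_smul]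
    have hn : ‖(n : ℂ) + 1‖ = (n : ℝ) + 1 := by
      rw [← Nat.cast_succ, Complex.norm_natCast]; push_cast; rfl
    rw [hn]
    linarith
  rw [norm_smul] at this
  have hn : ‖(n : ℂ) + 1‖ = (n : ℝ) + 1 := by
    rw [← Nat.cast_succ, Complex.norm_natCast]; push_cast; rfl
  rwa [hn] at this

end SquareFunction

/-! ### Similarity to a contraction -/

section Similarity

variable {H : Type*} [NormedAddCommGroup H] [InnerProductSpace ℂ H] [CompleteSpace H]

theorem exists_tendsto_ultrafilter (U : Ultrafilter ℕ) {f : ℕ → ℂ} {B : ℝ} (hf : ∀ n, ‖f n‖ ≤ B) :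
    ∃ l, Tendsto f U (𝓝 l) := by
  have hc := isCompact_closedBall (0 : ℂ) B
  obtain ⟨l, -, hl⟩ := hc.ultrafilter_le_nhds (U.map f)
    (by
      rw [le_principal_iff]
      exact Filter.mem_map.2 (Filter.univ_mem' fun n => by simpa using hf n))
  exact ⟨l, hl⟩

/-- A bounded sequence of operators has a limit along an ultrafilter in the weak operator
topology. -/
theorem exists_weak_limit (U : Ultrafilter ℕ) {S : ℕ → H →L[ℂ] H} {B : ℝ} (hS : ∀ n, ‖S n‖ ≤ B) :
    ∃ L : H →L[ℂ] H, ∀ x y : H, Tendsto (fun n => ⟪S n x, y⟫_ℂ) U (𝓝 ⟪L x, y⟫_ℂ) := by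
  have hb : ∀ x y n, ‖⟪S n x, y⟫_ℂ‖ ≤ B * ‖x‖ * ‖y‖ := by
    intro x y n
    refine (norm_inner_le_norm _ _).trans ?_
    gcongr
    exact (ContinuousLinearMap.le_opNorm _ _).trans (by gcongr; exact hS n)
  choose l hl using fun x y => exists_tendsto_ultrafilter U (hb x y)
  let B₀ : H →ₗ⋆[ℂ] H →ₗ[ℂ] ℂ := LinearMap.mk₂'ₛₗ (starRingEnd ℂ) (RingHom.id ℂ) l
    (fun x x' y => tendsto_nhds_unique (hl _ _) (by
      simpa only [map_add, inner_add_left] using (hl x y).add (hl x' y)))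
    (fun c x y => tendsto_nhds_unique (hl _ _) (by
      simpa only [map_smul, inner_smul_left, smul_eq_mul] using (hl x y).const_mul _))
    (fun x y y' => tendsto_nhds_unique (hl _ _) (by
      simpa only [inner_add_right] using (hl x y).add (hl x y')))
    (fun c x y => tendsto_nhds_unique (hl _ _) (by
      simpa only [inner_smul_right, smul_eq_mul, RingHom.id_apply] using (hl x y).const_mul _))
  have hB : ∀ x y, ‖B₀ x y‖ ≤ B * ‖x‖ * ‖y‖ := fun x y =>
    le_of_tendsto (hl x y).norm (Eventually.of_forall (hb x y))
  refine ⟨InnerProductSpace.continuousLinearMapOfBilin (B₀.mkContinuous₂ B hB), fun x y => ?_⟩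
  rw [InnerProductSpace.continuousLinearMapOfBilin_apply]
  exact hl x y

theorem isUnit_of_re_inner_ge {S : H →L[ℂ] H} {c : ℝ} (hc : 0 < c)
    (h : ∀ x, c * ‖x‖ ^ 2 ≤ (⟪S x, x⟫_ℂ).re) : IsUnit S := by
  refine ContinuousLinearMap.isUnit_of_forall_le_norm_inner_map S (c := ⟨c, hc.le⟩) hc fun x => ?_
  calc ‖x‖ ^ 2 * c = c * ‖x‖ ^ 2 := mul_comm _ _
    _ ≤ _ := h x
    _ ≤ _ := Complex.re_le_norm _

/-- If `T` is contractive for the equivalent Hilbertian norm `⟪S x, x⟫ ^ (1/2)`, then `T` is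
similar to a contraction. -/
theorem isSimilarToContraction_of_form {T S : H →L[ℂ] H} {c : ℝ} (hc : 0 < c)
    (hS : S.IsPositive) (hlow : ∀ x, c * ‖x‖ ^ 2 ≤ (⟪S x, x⟫_ℂ).re)
    (hT : ∀ x, (⟪S (T x), T x⟫_ℂ).re ≤ (⟪S x, x⟫_ℂ).re) : IsSimilarToContraction T := by
  have hS0 : (0 : H →L[ℂ] H) ≤ S := (ContinuousLinearMap.nonneg_iff_isPositive S).2 hS
  set W := CFC.sqrt S with hW
  have hWW : W * W = S := CFC.sqrt_mul_sqrt_self S hS0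
  have hW0 : (0 : H →L[ℂ] H) ≤ W := CFC.sqrt_nonneg S
  have hWsa : ContinuousLinearMap.adjoint W = W :=
    ((ContinuousLinearMap.nonneg_iff_isPositive W).1 hW0).isSelfAdjoint.adjoint_eq
  have hnorm : ∀ x, ‖W x‖ ^ 2 = (⟪S x, x⟫_ℂ).re := by
    intro x
    rw [← hWW, mul_apply_eq_comp]
    conv_rhs => rw [← hWsa]
    rw [ContinuousLinearMap.adjoint_inner_left, hWsa]
    exact (inner_self_eq_norm_sq (𝕜 := ℂ) (W x)).symm
  have hSu : IsUnit S := isUnit_of_re_inner_ge hc hlow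
  have hWu : IsUnit W := by
    have : IsUnit (W * W) := by rwa [hWW]
    exact (Commute.isUnit_mul_iff (Commute.refl W)).1 this |>.1
  obtain ⟨u, hu⟩ := hWu
  refine ⟨u⁻¹, ?_⟩
  rw [inv_inv, hu]
  refine ContinuousLinearMap.opNorm_le_bound _ zero_le_one fun x => ?_
  rw [one_mul]
  set z := (↑u⁻¹ : H →L[ℂ] H) x with hz
  have hx : W z = x := by
    rw [hz, ← mul_apply_eq_comp, ← hu, Units.mul_inv]; rfl
  have h1 : ‖W (T z)‖ ^ 2 ≤ ‖W z‖ ^ 2 := by rw [hnorm, hnorm]; exact hT z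
  rw [hx] at h1
  exact (abs_le_of_sq_le_sq' h1 (norm_nonneg _)).2

theorem weighted_cauchy_schwarz {ι : Type*} (s : Finset ι) {w a b : ι → ℝ} (hw : ∀ i ∈ s, 0 ≤ w i)
    {A B : ℝ} (hA0 : 0 ≤ A) (hB0 : 0 ≤ B) (hA : ∑ i ∈ s, w i * a i ^ 2 ≤ A ^ 2)
    (hB : ∑ i ∈ s, w i * b i ^ 2 ≤ B ^ 2) : ∑ i ∈ s, w i * (a i * b i) ≤ A * B := by
  have h := Finset.sum_mul_sq_le_sq_mul_sq s (fun i => √(w i) * a i) (fun i => √(w i) * b i)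
  have e1 : ∀ f g : ι → ℝ, ∑ i ∈ s, (√(w i) * f i) * (√(w i) * g i) = ∑ i ∈ s, w i * (f i * g i) :=
    fun f g => Finset.sum_congr rfl fun i hi => by
      rw [mul_mul_mul_comm, Real.mul_self_sqrt (hw i hi)]
  simp only [pow_two] at h hA hB
  simp only [e1] at h
  have h2 : (∑ i ∈ s, w i * (a i * b i)) ^ 2 ≤ (A * B) ^ 2 := by
    rw [pow_two]
    refine h.trans ?_
    calc _ ≤ (A * A) * (B * B) := by
          refine mul_le_mul hA hB ?_ (by positivity)
          exact Finset.sum_nonneg fun i hi => mul_nonneg (hw i hi) (mul_self_nonneg _)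
      _ = _ := by ring
  exact (abs_le_of_sq_le_sq' h2 (by positivity)).2

open Polynomial in
theorem sum_mul_pow_mul_one_sub_sq {R : Type*} [Ring R] (s : R) (n : ℕ) :
    ∑ k ∈ Finset.range n, ((k : R) + 1) * s ^ k * (1 - s) ^ 2 =
      1 - s ^ n - n * s ^ n * (1 - s) := by
  have h : ∑ k ∈ Finset.range n, ((k : ℤ[X]) + 1) * X ^ k * (1 - X) ^ 2 =
      1 - X ^ n - (n : ℤ[X]) * X ^ n * (1 - X) := by
    induction n with
    | zero => simp
    | succ n ih => rw [Finset.sum_range_succ, ih]; push_cast; ring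
  simpa using congrArg (aeval s) h

theorem adjoint_pow_mul_one_sub (T : H →L[ℂ] H) (k : ℕ) :
    ContinuousLinearMap.adjoint (T ^ k * (1 - T)) =
      ContinuousLinearMap.adjoint T ^ k * (1 - ContinuousLinearMap.adjoint T) := by
  simp only [← ContinuousLinearMap.star_eq_adjoint, star_mul, star_pow, star_sub, star_one]
  exact ((Commute.one_left _).sub_left (Commute.refl _)).pow_right k

open ContinuousLinearMap Polynomial in
/-- The square function of `T` together with `‖T ^ N x‖` controls `‖x‖`. This follows from the
identity `I = S ^ N + N S ^ N (I - S) + ∑ k S ^ (k - 1) (I - S) ^ 2` with `S = T ^ 2`, by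
distributing the factors `T ^ (k - 1) (I - T)` on both sides of the inner product. -/
theorem norm_le_of_squareBound_adjoint {T : H →L[ℂ] H} {M D : ℝ} (hM : ∀ n : ℕ, ‖T ^ n‖ ≤ M)
    (hD0 : 0 ≤ D) (hD : SquareBound (adjoint T) D) (x : H) {N : ℕ} {B : ℝ}
    (hB0 : 0 ≤ B)
    (hB : ‖(T ^ N) x‖ ^ 2 +
      ∑ k ∈ Finset.range (N + 1), ((k : ℝ) + 1) * ‖(T ^ k * (1 - T)) x‖ ^ 2 ≤ B ^ 2) :
    ‖x‖ ≤ (M + 4 * M ^ 2 + 4 * M * D) * B := by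
  have hM0 : 0 ≤ M := (norm_nonneg _).trans (hM 0)
  have hs0 : ∀ n, 0 ≤ ∑ k ∈ Finset.range n, ((k : ℝ) + 1) * ‖(T ^ k * (1 - T)) x‖ ^ 2 :=
    fun n => Finset.sum_nonneg fun _ _ => by positivity
  have hTN : ‖(T ^ N) x‖ ≤ B :=
    (abs_le_of_sq_le_sq' (by linarith [hs0 (N + 1)]) hB0).2
  have hsum1 : ∑ k ∈ Finset.range (N + 1), ((k : ℝ) + 1) * ‖(T ^ k * (1 - T)) x‖ ^ 2 ≤ B ^ 2 := by
    nlinarith [sq_nonneg ‖(T ^ N) x‖]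
  have hsum0 : ∑ k ∈ Finset.range N, ((k : ℝ) + 1) * ‖(T ^ k * (1 - T)) x‖ ^ 2 ≤ B ^ 2 := by
    rw [Finset.sum_range_succ] at hsum1
    have : 0 ≤ ((N : ℝ) + 1) * ‖(T ^ N * (1 - T)) x‖ ^ 2 := by positivity
    linarith
  have hmid := mul_norm_le_of_sum_le hM x hB0 hsum1
  have hid : x = (T ^ N) ((T ^ N) x) + (N : ℂ) • (T ^ N * (1 + T)) ((T ^ N * (1 - T)) x) +
      ∑ k ∈ Finset.range N, ((k : ℂ) + 1) •
        (T ^ k * (1 - T)) (((1 + T) ^ 2 : H →L[ℂ] H) ((T ^ k * (1 - T)) x)) := by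
    have h := sum_mul_pow_mul_one_sub_sq (T ^ 2) N
    have h1 : (T ^ 2) ^ N = T ^ N * T ^ N := by rw [← pow_mul, ← pow_add, two_mul]
    have h2 : (N : H →L[ℂ] H) * (T ^ 2) ^ N * (1 - T ^ 2) =
        (N : ℂ) • ((T ^ N * (1 + T)) * (T ^ N * (1 - T))) := by
      rw [Nat.cast_smul_eq_nsmul, nsmul_eq_mul]
      simpa using congrArg (aeval T) (by ring : ((N : ℂ[X]) * (X ^ 2) ^ N * (1 - X ^ 2) =
        (N : ℂ[X]) * ((X ^ N * (1 + X)) * (X ^ N * (1 - X)))))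
    have h3 : ∀ k : ℕ, ((k : H →L[ℂ] H) + 1) * (T ^ 2) ^ k * (1 - T ^ 2) ^ 2 =
        ((k : ℂ) + 1) • ((T ^ k * (1 - T)) * ((1 + T) ^ 2 * (T ^ k * (1 - T)))) := by
      intro k
      rw [add_smul, one_smul, Nat.cast_smul_eq_nsmul, nsmul_eq_mul]
      simpa using congrArg (aeval T) (by ring : (((k : ℂ[X]) + 1) * (X ^ 2) ^ k * (1 - X ^ 2) ^ 2 =
        (k : ℂ[X]) * ((X ^ k * (1 - X)) * ((1 + X) ^ 2 * (X ^ k * (1 - X)))) +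
          (X ^ k * (1 - X)) * ((1 + X) ^ 2 * (X ^ k * (1 - X)))))
    simp only [h3] at h
    rw [h2, h1] at h
    have h4 : (1 : H →L[ℂ] H) = T ^ N * T ^ N + (N : ℂ) • ((T ^ N * (1 + T)) * (T ^ N * (1 - T))) +
        ∑ k ∈ Finset.range N,
          ((k : ℂ) + 1) • ((T ^ k * (1 - T)) * ((1 + T) ^ 2 * (T ^ k * (1 - T)))) := by
      rw [h]; abel
    have h5 := congrArg (fun L : H →L[ℂ] H => L x) h4
    simpa only [add_apply, smul_apply, sum_apply, mul_apply_eq_comp, one_apply_eq_self] using h5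
  have hM2 : ‖(1 + T) ^ 2‖ ≤ 4 * M := by
    have : (1 + T) ^ 2 = T ^ 0 + T ^ 1 + T ^ 1 + T ^ 2 := by noncomm_ring
    rw [this]
    have h1 := norm_add_le (T ^ 0 + T ^ 1 + T ^ 1) (T ^ 2)
    have h2 := norm_add_le (T ^ 0 + T ^ 1) (T ^ 1)
    have h3 := norm_add_le (T ^ 0) (T ^ 1)
    linarith [hM 0, hM 1, hM 2]
  have hM1 : ‖T ^ N * (1 + T)‖ ≤ 2 * M := by
    rw [mul_add, mul_one, ← pow_succ]
    linarith [norm_add_le (T ^ N) (T ^ (N + 1)), hM N, hM (N + 1)]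
  have ht1 : (⟪x, (T ^ N) ((T ^ N) x)⟫_ℂ).re ≤ M * B * ‖x‖ := by
    refine (Complex.re_le_norm _).trans ((norm_inner_le_norm _ _).trans ?_)
    rw [mul_comm]
    gcongr
    exact (le_opNorm _ _).trans (by gcongr; exact hM N)
  have ht2 : (⟪x, (N : ℂ) • (T ^ N * (1 + T)) ((T ^ N * (1 - T)) x)⟫_ℂ).re ≤ 4 * M ^ 2 * B * ‖x‖ := by
    refine (Complex.re_le_norm _).trans ((norm_inner_le_norm _ _).trans ?_)
    rw [mul_comm, norm_smul, Complex.norm_natCast]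
    refine mul_le_mul_of_nonneg_right ?_ (norm_nonneg x)
    calc (N : ℝ) * ‖(T ^ N * (1 + T)) ((T ^ N * (1 - T)) x)‖
        ≤ N * ((2 * M) * ‖(T ^ N * (1 - T)) x‖) := by
          gcongr; exact (le_opNorm _ _).trans (by gcongr)
      _ ≤ (2 * M) * (((N : ℝ) + 1) * ‖(T ^ N * (1 - T)) x‖) := by
          have : 0 ≤ 2 * M * ‖(T ^ N * (1 - T)) x‖ := by positivity
          linarith
      _ ≤ (2 * M) * (2 * M * B) := by gcongr
      _ = _ := by ring
  have ht3 : (⟪x, ∑ k ∈ Finset.range N,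
      ((k : ℂ) + 1) • (T ^ k * (1 - T)) (((1 + T) ^ 2 : H →L[ℂ] H) ((T ^ k * (1 - T)) x))⟫_ℂ).re ≤
        4 * M * D * B * ‖x‖ := by
    refine (Complex.re_le_norm _).trans ?_
    rw [inner_sum]
    refine (norm_sum_le _ _).trans ?_
    have hterm : ∀ k ∈ Finset.range N,
        ‖⟪x, ((k : ℂ) + 1) • (T ^ k * (1 - T)) (((1 + T) ^ 2 : H →L[ℂ] H) ((T ^ k * (1 - T)) x))⟫_ℂ‖ ≤
        4 * M * (((k : ℝ) + 1) *
          (‖(T ^ k * (1 - T)) x‖ * ‖(adjoint T ^ k * (1 - adjoint T)) x‖)) := by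
      intro k _
      have hadj := adjoint_pow_mul_one_sub T k
      rw [inner_smul_right, ← adjoint_inner_left, hadj, norm_mul]
      have hk : ‖(k : ℂ) + 1‖ = (k : ℝ) + 1 := by
        rw [← Nat.cast_succ, Complex.norm_natCast]; push_cast; rfl
      rw [hk]
      have h1 := norm_inner_le_norm (𝕜 := ℂ) ((adjoint T ^ k * (1 - adjoint T)) x)
        (((1 + T) ^ 2 : H →L[ℂ] H) ((T ^ k * (1 - T)) x))
      have h2 : ‖((1 + T) ^ 2 : H →L[ℂ] H) ((T ^ k * (1 - T)) x)‖ ≤ 4 * M * ‖(T ^ k * (1 - T)) x‖ :=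
        (le_opNorm _ _).trans (by gcongr)
      calc _ ≤ ((k : ℝ) + 1) * (‖(adjoint T ^ k * (1 - adjoint T)) x‖ *
            (4 * M * ‖(T ^ k * (1 - T)) x‖)) := by
            gcongr; exact h1.trans (by gcongr)
        _ = _ := by ring
    refine (Finset.sum_le_sum hterm).trans ?_
    rw [← Finset.mul_sum]
    have := weighted_cauchy_schwarz (Finset.range N) (w := fun k : ℕ => (k : ℝ) + 1)
      (fun i _ => by positivity) hB0 (by positivity : 0 ≤ D * ‖x‖) hsum0
      (by rw [mul_pow]; exact hD x N)
    calc _ ≤ 4 * M * (B * (D * ‖x‖)) := by gcongr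
      _ = _ := by ring
  have hx : ‖x‖ ^ 2 ≤ (M + 4 * M ^ 2 + 4 * M * D) * B * ‖x‖ := by
    have h0 : ‖x‖ ^ 2 = (⟪x, x⟫_ℂ).re := (inner_self_eq_norm_sq (𝕜 := ℂ) x).symm
    have h1 : (⟪x, x⟫_ℂ).re = (⟪x, (T ^ N) ((T ^ N) x) +
      (N : ℂ) • (T ^ N * (1 + T)) ((T ^ N * (1 - T)) x) +
      ∑ k ∈ Finset.range N,
        ((k : ℂ) + 1) • (T ^ k * (1 - T)) (((1 + T) ^ 2 : H →L[ℂ] H) ((T ^ k * (1 - T)) x))⟫_ℂ).re := by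
      rw [← hid]
    rw [inner_add_right, inner_add_right, Complex.add_re, Complex.add_re] at h1
    linarith
  rcases eq_or_lt_of_le (norm_nonneg x) with h | h
  · rw [← h]; positivity
  · rw [pow_two] at hx
    exact le_of_mul_le_mul_right hx h

open ContinuousLinearMap in
/-- If `T` and its adjoint have square function estimates, then `T` is similar to a contraction.
The weak limit of `‖T ^ N x‖ ^ 2 + ∑_{k ≤ N} (k + 1) ‖T ^ k (I - T) x‖ ^ 2` along an ultrafilter is
the square of an equivalent Hilbertian norm, and `T` is contractive for it. -/
theorem isSimilarToContraction_of_squareBound {T : H →L[ℂ] H} (hT : IsPowerBounded T) {C D : ℝ}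
    (hC0 : 0 ≤ C) (hD0 : 0 ≤ D) (hC : SquareBound T C) (hD : SquareBound (adjoint T) D) :
    IsSimilarToContraction T := by
  obtain ⟨-, R, hR⟩ := (isRitt_iff T).1 (isRitt_of_squareBound hT hC0 hC)
  obtain ⟨M, hM⟩ := hT
  have hM0 : 0 ≤ M := (norm_nonneg _).trans (hM 0)
  -- The quadratic forms, and the positive operators that represent them.
  let q : ℕ → H → ℝ := fun N x => ‖(T ^ N) x‖ ^ 2 +
    ∑ k ∈ Finset.range (N + 1), ((k : ℝ) + 1) * ‖(T ^ k * (1 - T)) x‖ ^ 2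
  let S : ℕ → H →L[ℂ] H := fun N => adjoint (T ^ N) * T ^ N +
    ∑ k ∈ Finset.range (N + 1), ((k : ℂ) + 1) • (adjoint (T ^ k * (1 - T)) * (T ^ k * (1 - T)))
  have hadj : ∀ (L : H →L[ℂ] H) (x : H), ⟪(adjoint L * L) x, x⟫_ℂ = ((‖L x‖ ^ 2 : ℝ) : ℂ) := by
    intro L x
    rw [mul_apply_eq_comp, adjoint_inner_left, inner_self_eq_norm_sq_to_K]
    norm_cast
  have hSq : ∀ N x, ⟪S N x, x⟫_ℂ = ((q N x : ℝ) : ℂ) := by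
    intro N x
    simp only [S, q, add_apply, sum_apply, smul_apply, inner_add_left, sum_inner, inner_smul_left, hadj]
    push_cast
    simp
  have hq_le : ∀ N x, q N x ≤ (M ^ 2 + C ^ 2) * ‖x‖ ^ 2 := by
    intro N x
    have h1 : ‖(T ^ N) x‖ ≤ M * ‖x‖ := (le_opNorm _ _).trans (by gcongr; exact hM N)
    have h2 : ‖(T ^ N) x‖ ^ 2 ≤ (M * ‖x‖) ^ 2 := by gcongr
    have h3 := hC x (N + 1)
    simp only [q]
    nlinarith
  have hSpos : ∀ N, (S N).IsPositive := by
    intro N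
    rw [isPositive_iff_complex]
    intro x
    rw [hSq]
    refine ⟨by simp, ?_⟩
    simp only [RCLike.re_to_complex, Complex.ofReal_re, q]
    positivity
  have hSnorm : ∀ N, ‖S N‖ ≤ M ^ 2 + C ^ 2 := by
    intro N
    have hS0 : (0 : H →L[ℂ] H) ≤ S N := (nonneg_iff_isPositive _).2 (hSpos N)
    rw [CStarAlgebra.norm_le_iff_le_algebraMap (S N) (by positivity) hS0, ContinuousLinearMap.le_def,
      isPositive_iff_complex]
    intro x
    have h1 : ⟪(algebraMap ℝ (H →L[ℂ] H) (M ^ 2 + C ^ 2) - S N) x, x⟫_ℂ =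
        (((M ^ 2 + C ^ 2) * ‖x‖ ^ 2 - q N x : ℝ) : ℂ) := by
      rw [Algebra.algebraMap_eq_smul_one, sub_apply, inner_sub_left, hSq, smul_apply,
        one_apply_eq_self, ← Complex.coe_smul, inner_smul_left, inner_self_eq_norm_sq_to_K]
      push_cast
      simp
    rw [h1]
    refine ⟨by rw [RCLike.re_to_complex, Complex.ofReal_re], ?_⟩
    simp only [RCLike.re_to_complex, Complex.ofReal_re]
    linarith [hq_le N x]
  let U : Ultrafilter ℕ := hyperfilter ℕ
  obtain ⟨L, hL⟩ := exists_weak_limit U hSnorm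
  have hLq : ∀ x, Tendsto (fun N => q N x) U (𝓝 (⟪L x, x⟫_ℂ).re) := by
    intro x
    have := (Complex.continuous_re.tendsto _).comp (hL x x)
    refine this.congr fun N => ?_
    simp [hSq]
  have hLpos : L.IsPositive := by
    rw [isPositive_iff_complex]
    intro x
    have h1 : Tendsto (fun N => ((q N x : ℝ) : ℂ)) U (𝓝 ((⟪L x, x⟫_ℂ).re : ℂ)) :=
      (Complex.continuous_ofReal.tendsto _).comp (hLq x)
    refine ⟨tendsto_nhds_unique h1 ((hL x x).congr fun N => hSq N x), ?_⟩
    exact ge_of_tendsto (hLq x) (Eventually.of_forall fun N => by simp only [q]; positivity)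
  set K := M + 4 * M ^ 2 + 4 * M * D + 1 with hK
  have hK0 : 0 < K := by positivity
  refine isSimilarToContraction_of_form (c := (K ^ 2)⁻¹) (by positivity) hLpos (fun x => ?_)
    (fun x => ?_)
  · refine ge_of_tendsto (hLq x) (Eventually.of_forall fun N => ?_)
    have hqN : 0 ≤ q N x := by simp only [q]; positivity
    have h1 := norm_le_of_squareBound_adjoint hM hD0 hD x (N := N) (Real.sqrt_nonneg (q N x))
      (by rw [Real.sq_sqrt hqN])
    have h2 : ‖x‖ ≤ K * √(q N x) := h1.trans (by gcongr; linarith)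
    rw [inv_mul_le_iff₀ (by positivity)]
    calc ‖x‖ ^ 2 ≤ (K * √(q N x)) ^ 2 := by gcongr
      _ = _ := by rw [mul_pow, Real.sq_sqrt hqN]
  · -- `T ^ (N + 1) x - T ^ N x` tends to `0`, so that the term `‖T ^ N x‖ ^ 2` is harmless.
    have hδ : ∀ N, q N (T x) ≤ q N x + (2 * M * ‖x‖) * ((R * ‖x‖) * (1 / ((N : ℝ) + 1))) +
        (R * ‖x‖) ^ 2 * (1 / ((N : ℝ) + 1)) := by
      intro N
      have hRx : ∀ n : ℕ, ‖(T ^ n * (1 - T)) x‖ ≤ R * ‖x‖ * (1 / ((n : ℝ) + 1)) := by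
        intro n
        have h1 : ‖T ^ n * (1 - T)‖ ≤ R / ((n : ℝ) + 1) := by
          rw [le_div_iff₀ (by positivity), mul_comm]; exact hR n
        calc _ ≤ R / ((n : ℝ) + 1) * ‖x‖ := (le_opNorm _ _).trans (by gcongr)
          _ = _ := by ring
      have hfirst : ‖(T ^ N) (T x)‖ ^ 2 ≤
          ‖(T ^ N) x‖ ^ 2 + (2 * M * ‖x‖) * ((R * ‖x‖) * (1 / ((N : ℝ) + 1))) := by
        have e : (T ^ N) (T x) = (T ^ (N + 1)) x := by rw [pow_succ]; rfl
        have u1 : ‖(T ^ (N + 1)) x‖ ≤ M * ‖x‖ := (le_opNorm _ _).trans (by gcongr; exact hM _)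
        have u2 : ‖(T ^ N) x‖ ≤ M * ‖x‖ := (le_opNorm _ _).trans (by gcongr; exact hM _)
        have u3 : ‖(T ^ (N + 1)) x‖ - ‖(T ^ N) x‖ ≤ ‖(T ^ N * (1 - T)) x‖ := by
          refine (norm_sub_norm_le _ _).trans (le_of_eq ?_)
          rw [pow_mul_one_sub_eq, neg_apply, norm_neg, sub_apply]
        rw [e]
        have u4 := u3.trans (hRx N)
        have u5 : 0 ≤ R * ‖x‖ * (1 / ((N : ℝ) + 1)) := (norm_nonneg _).trans (hRx N)
        nlinarith [norm_nonneg ((T ^ (N + 1)) x), norm_nonneg ((T ^ N) x)]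
      have hsecond : ∑ k ∈ Finset.range (N + 1), ((k : ℝ) + 1) * ‖(T ^ k * (1 - T)) (T x)‖ ^ 2 ≤
          ∑ k ∈ Finset.range (N + 1), ((k : ℝ) + 1) * ‖(T ^ k * (1 - T)) x‖ ^ 2 +
            (R * ‖x‖) ^ 2 * (1 / ((N : ℝ) + 1)) := by
        have e : ∀ k : ℕ, (T ^ k * (1 - T)) (T x) = (T ^ (k + 1) * (1 - T)) x := by
          intro k
          rw [← mul_apply_eq_comp, mul_assoc, sub_mul, one_mul, ← mul_one_sub, ← mul_assoc, pow_succ]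
        simp only [e]
        have h1 : ∑ k ∈ Finset.range (N + 1), ((k : ℝ) + 1) * ‖(T ^ (k + 1) * (1 - T)) x‖ ^ 2 =
            ∑ k ∈ Finset.range (N + 2), (k : ℝ) * ‖(T ^ k * (1 - T)) x‖ ^ 2 := by
          rw [Finset.sum_range_succ' _ (N + 1)]
          simp
        rw [h1, Finset.sum_range_succ _ (N + 1)]
        refine add_le_add (Finset.sum_le_sum fun k _ => by gcongr; linarith) ?_
        have h2 := hRx (N + 1)
        have h3 : ‖(T ^ (N + 1) * (1 - T)) x‖ ^ 2 ≤ (R * ‖x‖ * (1 / (((N + 1 : ℕ) : ℝ) + 1))) ^ 2 := by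
          gcongr
        have h4 : ((N + 1 : ℕ) : ℝ) * (1 / (((N + 1 : ℕ) : ℝ) + 1)) ^ 2 ≤ 1 / ((N : ℝ) + 1) := by
          push_cast
          rw [div_pow, one_pow, mul_one_div, div_le_div_iff₀ (by positivity) (by positivity)]
          have : (0 : ℝ) ≤ N := N.cast_nonneg
          nlinarith
        calc ((N + 1 : ℕ) : ℝ) * ‖(T ^ (N + 1) * (1 - T)) x‖ ^ 2
            ≤ ((N + 1 : ℕ) : ℝ) * (R * ‖x‖ * (1 / (((N + 1 : ℕ) : ℝ) + 1))) ^ 2 := by gcongr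
          _ = (R * ‖x‖) ^ 2 * (((N + 1 : ℕ) : ℝ) * (1 / (((N + 1 : ℕ) : ℝ) + 1)) ^ 2) := by ring
          _ ≤ _ := by gcongr
      simp only [q]
      linarith
    have hlim : Tendsto (fun N : ℕ => q N x + (2 * M * ‖x‖) * ((R * ‖x‖) * (1 / ((N : ℝ) + 1))) +
        (R * ‖x‖) ^ 2 * (1 / ((N : ℝ) + 1))) U (𝓝 (⟪L x, x⟫_ℂ).re) := by
      have h0 : Tendsto (fun N : ℕ => 1 / ((N : ℝ) + 1)) U (𝓝 0) :=
        tendsto_one_div_add_atTop_nhds_zero_nat.mono_left (by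
          rw [← Nat.cofinite_eq_atTop]; exact hyperfilter_le_cofinite)
      simpa using ((hLq x).add ((h0.const_mul _).const_mul _)).add (h0.const_mul _)
    exact le_of_tendsto_of_tendsto' (hLq (T x)) hlim hδ

end Similarity

/-! ### Reduction of the square function to dyadic blocks -/

section Dyadic

variable {H : Type*} [NormedAddCommGroup H] [InnerProductSpace ℂ H]

/-- By power boundedness, each block `2 ^ j ≤ k < 2 ^ (j + 1)` of the square function is controlled
by its first term. -/
theorem squareBound_of_dyadic {T : H →L[ℂ] H} {M D : ℝ} (hM : ∀ n : ℕ, ‖T ^ n‖ ≤ M) (hD0 : 0 ≤ D)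
    (hD : ∀ (x : H) (J : ℕ), ∑ j ∈ Finset.range J,
      ((2 : ℝ) ^ j * ‖(T ^ (2 ^ j : ℕ) * (1 - T) : H →L[ℂ] H) x‖) ^ 2 ≤ D ^ 2 * ‖x‖ ^ 2) :
    SquareBound T (2 * M + 2 * M * D) := by
  have hM0 : 0 ≤ M := (norm_nonneg _).trans (hM 0)
  intro x n
  set a : ℕ → ℝ := fun k => ‖(T ^ k * (1 - T)) x‖ with ha
  have hmono : ∀ m i : ℕ, a (m + i) ≤ M * a m := by
    intro m i
    have : (T ^ (m + i) * (1 - T)) x = (T ^ i) ((T ^ m * (1 - T)) x) := by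
      rw [← mul_apply_eq_comp, ← mul_assoc, ← pow_add, add_comm]
    simp only [ha]
    rw [this]
    exact (ContinuousLinearMap.le_opNorm _ _).trans (by gcongr; exact hM i)
  have hblock : ∀ J : ℕ, ∑ k ∈ Finset.range (2 ^ J), ((k : ℝ) + 1) * a k ^ 2 ≤
      a 0 ^ 2 + 2 * M ^ 2 * ∑ j ∈ Finset.range J, ((2 : ℝ) ^ j * a (2 ^ j)) ^ 2 := by
    intro J
    induction J with
    | zero => simp
    | succ J ih =>
      rw [pow_succ, mul_two, Finset.sum_range_add, Finset.sum_range_succ _ J, mul_add, ← add_assoc]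
      refine add_le_add ih ?_
      have hterm : ∀ i ∈ Finset.range (2 ^ J), (((2 ^ J + i : ℕ) : ℝ) + 1) * a (2 ^ J + i) ^ 2 ≤
          2 * 2 ^ J * (M * a (2 ^ J)) ^ 2 := by
        intro i hi
        have hi' : i + 1 ≤ 2 ^ J := Finset.mem_range.1 hi
        have h1 : ((i : ℝ) + 1) ≤ 2 ^ J := by exact_mod_cast hi'
        have h2 : a (2 ^ J + i) ^ 2 ≤ (M * a (2 ^ J)) ^ 2 := by
          gcongr
          · exact hmono _ _
        push_cast
        refine mul_le_mul (by linarith) h2 (by positivity) (by positivity)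
      refine (Finset.sum_le_card_nsmul _ _ _ hterm).trans (le_of_eq ?_)
      simp only [Finset.card_range, nsmul_eq_mul]
      push_cast
      ring
  have h0 : a 0 ≤ 2 * M * ‖x‖ := by
    have h1 : ‖T ^ 0 * (1 - T)‖ ≤ 2 * M := by
      have := norm_sub_le (T ^ 0) (T ^ 1)
      rw [mul_sub, pow_zero, one_mul, one_mul]
      rw [pow_zero, pow_one] at this
      have h2 := hM 0
      have h3 := hM 1
      rw [pow_zero] at h2
      rw [pow_one] at h3
      linarith
    exact (ContinuousLinearMap.le_opNorm _ _).trans (by gcongr)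
  calc ∑ k ∈ Finset.range n, ((k : ℝ) + 1) * a k ^ 2
      ≤ ∑ k ∈ Finset.range (2 ^ n), ((k : ℝ) + 1) * a k ^ 2 :=
        Finset.sum_le_sum_of_subset_of_nonneg
          (Finset.range_mono n.lt_two_pow_self.le) fun _ _ _ => by positivity
    _ ≤ a 0 ^ 2 + 2 * M ^ 2 * ∑ j ∈ Finset.range n, ((2 : ℝ) ^ j * a (2 ^ j)) ^ 2 := hblock n
    _ ≤ (2 * M * ‖x‖) ^ 2 + 2 * M ^ 2 * (D ^ 2 * ‖x‖ ^ 2) := by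
        refine add_le_add (pow_le_pow_left₀ (norm_nonneg _) h0 2) ?_
        exact mul_le_mul_of_nonneg_left (hD x n) (by positivity)
    _ ≤ (2 * M + 2 * M * D) ^ 2 * ‖x‖ ^ 2 := by
        rw [mul_pow]
        have : 0 ≤ M ^ 2 * D * ‖x‖ ^ 2 := by positivity
        have : 0 ≤ M ^ 2 * D ^ 2 * ‖x‖ ^ 2 := by positivity
        nlinarith

/-- For a Ritt operator, `‖T ^ n (I - T) ^ 2‖` decays like `n ^ (-2)`. -/
theorem norm_pow_mul_one_sub_sq_le {T : H →L[ℂ] H} {R : ℝ}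
    (hR : ∀ n : ℕ, ((n : ℝ) + 1) * ‖T ^ n * (1 - T)‖ ≤ R) (n : ℕ) :
    ((n : ℝ) + 1) ^ 2 * ‖T ^ n * (1 - T) * (1 - T)‖ ≤ 4 * R ^ 2 := by
  obtain ⟨a, b, hab, hd⟩ : ∃ a b : ℕ, a + b = n ∧ (a = b ∨ a = b + 1) := by
    rcases Nat.even_or_odd' n with ⟨k, h | h⟩
    · exact ⟨k, k, by omega, Or.inl rfl⟩
    · exact ⟨k + 1, k, by omega, Or.inr rfl⟩
  have hfac : T ^ n * (1 - T) * (1 - T) = (T ^ a * (1 - T)) * (T ^ b * (1 - T)) := by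
    have hc : (1 - T) * T ^ b = T ^ b * (1 - T) :=
      ((Commute.one_left _).sub_left (Commute.refl _)).pow_right b
    rw [← hab, pow_add, mul_assoc (T ^ a) (1 - T), ← mul_assoc (1 - T) (T ^ b), hc]
    simp only [mul_assoc]
  have h1 : ((n : ℝ) + 1) ^ 2 ≤ 4 * (((a : ℝ) + 1) * ((b : ℝ) + 1)) := by
    have e : (n : ℝ) = a + b := by exact_mod_cast hab.symm
    rw [e]
    rcases hd with h | h
    · have : (a : ℝ) = b := by exact_mod_cast h
      rw [this]
      nlinarith [(Nat.cast_nonneg b : (0 : ℝ) ≤ b)]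
    · have : (a : ℝ) = b + 1 := by exact_mod_cast h
      rw [this]
      nlinarith [(Nat.cast_nonneg b : (0 : ℝ) ≤ b)]
  rw [hfac]
  calc _ ≤ (4 * (((a : ℝ) + 1) * ((b : ℝ) + 1))) * (‖T ^ a * (1 - T)‖ * ‖T ^ b * (1 - T)‖) := by
        gcongr
        exact norm_mul_le _ _
    _ = 4 * ((((a : ℝ) + 1) * ‖T ^ a * (1 - T)‖) * (((b : ℝ) + 1) * ‖T ^ b * (1 - T)‖)) := by ring
    _ ≤ 4 * (R * R) := by
        gcongr
        · exact (by positivity : (0 : ℝ) ≤ ((a : ℝ) + 1) * ‖T ^ a * (1 - T)‖).trans (hR a)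
        · exact hR a
        · exact hR b
    _ = _ := by ring

end Dyadic

/-! ### Schur's test for a geometric kernel -/

section Schur

/-- The kernel `2 ^ (-|i - j|)` on `ℕ × ℕ`. -/
def geomKernel (i j : ℕ) : ℝ := (1 / 2) ^ (i - j + (j - i))

theorem geomKernel_nonneg (i j : ℕ) : 0 ≤ geomKernel i j := by unfold geomKernel; positivity

theorem geomKernel_comm (i j : ℕ) : geomKernel i j = geomKernel j i := by
  unfold geomKernel; rw [add_comm]

theorem sum_half_pow_le (n : ℕ) : ∑ i ∈ Finset.range n, (1 / 2 : ℝ) ^ i ≤ 2 := by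
  have := geom_sum_eq (by norm_num : (1 / 2 : ℝ) ≠ 1) n
  rw [this]
  have : (0 : ℝ) ≤ (1 / 2) ^ n := by positivity
  linarith [show ((1 / 2 : ℝ) ^ n - 1) / (1 / 2 - 1) = 2 - 2 * (1 / 2) ^ n by ring]

theorem sum_geomKernel_le (n j : ℕ) : ∑ i ∈ Finset.range n, geomKernel i j ≤ 3 := by
  have h : ∀ j n : ℕ, ∑ i ∈ Finset.range n, geomKernel i j ≤ 3 - (1 / 2) ^ j := by
    intro j
    induction j with
    | zero => intro n; simpa [geomKernel] using (sum_half_pow_le n).trans (by norm_num)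
    | succ j ih =>
      intro n
      cases n with
      | zero =>
        have : (1 / 2 : ℝ) ^ (j + 1) ≤ 1 := pow_le_one₀ (by norm_num) (by norm_num)
        rw [Finset.range_zero, Finset.sum_empty]
        linarith
      | succ n =>
        rw [Finset.sum_range_succ']
        have h1 := ih n
        have h2 : ∀ i, geomKernel (i + 1) (j + 1) = geomKernel i j := by
          intro i; simp [geomKernel]
        have h3 : geomKernel 0 (j + 1) = (1 / 2) ^ (j + 1) := by simp [geomKernel]
        simp only [h2, h3]
        have h4 : (1 / 2 : ℝ) ^ (j + 1) = (1 / 2) ^ j / 2 := by ring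
        rw [h4]
        linarith
  exact (h j n).trans (by linarith [show (0 : ℝ) ≤ (1 / 2) ^ j by positivity])

theorem sum_sq_sum_geomKernel_le (J n : ℕ) (d : ℕ → ℝ) :
    ∑ j ∈ Finset.range J, (∑ i ∈ Finset.range n, geomKernel i j * d i) ^ 2 ≤
      9 * ∑ i ∈ Finset.range n, d i ^ 2 := by
  have h1 : ∀ j ∈ Finset.range J, (∑ i ∈ Finset.range n, geomKernel i j * d i) ^ 2 ≤
      3 * ∑ i ∈ Finset.range n, geomKernel i j * d i ^ 2 := by
    intro j _
    have h := Finset.sum_mul_sq_le_sq_mul_sq (Finset.range n) (fun i => √(geomKernel i j))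
      (fun i => √(geomKernel i j) * d i)
    have e1 : ∀ i, √(geomKernel i j) * (√(geomKernel i j) * d i) = geomKernel i j * d i := fun i => by
      rw [← mul_assoc, Real.mul_self_sqrt (geomKernel_nonneg i j)]
    have e2 : ∀ i, √(geomKernel i j) ^ 2 = geomKernel i j := fun i =>
      Real.sq_sqrt (geomKernel_nonneg i j)
    simp only [e1, mul_pow, e2] at h
    refine h.trans ?_
    gcongr
    · exact Finset.sum_nonneg fun i _ => mul_nonneg (geomKernel_nonneg i j) (sq_nonneg _)
    · exact sum_geomKernel_le n j
  refine (Finset.sum_le_sum h1).trans ?_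
  rw [← Finset.mul_sum, Finset.sum_comm]
  have h2 : ∀ i ∈ Finset.range n, ∑ j ∈ Finset.range J, geomKernel i j * d i ^ 2 ≤ 3 * d i ^ 2 := by
    intro i _
    rw [← Finset.sum_mul]
    gcongr
    simp only [geomKernel_comm i]
    exact sum_geomKernel_le J i
  have h3 := Finset.sum_le_sum h2
  rw [← Finset.mul_sum] at h3
  linarith

end Schur

/-! ### Square functions for Ritt contractions -/

section Contraction

variable {H : Type*} [NormedAddCommGroup H] [InnerProductSpace ℂ H]

open ContinuousLinearMap

theorem norm_sq_shift {A : H →L[ℂ] H} (hA : ∀ x, 0 ≤ (⟪A x, x⟫_ℂ).re) {s : ℝ}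
    (hs : 0 < s) (y : H) : (s * ‖y‖) ^ 2 + ‖A y‖ ^ 2 ≤ ‖s • y + A y‖ ^ 2 := by
  rw [@norm_add_sq ℂ, norm_smul, Real.norm_of_nonneg hs.le, ← Complex.coe_smul, inner_smul_left,
    Complex.conj_ofReal]
  have h := hA y
  rw [← inner_conj_symm, Complex.conj_re] at h
  have : 0 ≤ RCLike.re ((s : ℂ) * ⟪y, A y⟫_ℂ) := by
    rw [RCLike.re_to_complex, Complex.re_ofReal_mul]; positivity
  linarith

variable [CompleteSpace H]

theorem isUnit_smul_one_add {A : H →L[ℂ] H} (hA : ∀ x, 0 ≤ (⟪A x, x⟫_ℂ).re) {s : ℝ} (hs : 0 < s) :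
    IsUnit ((s : ℂ) • (1 : H →L[ℂ] H) + A) := by
  refine isUnit_of_re_inner_ge hs fun x => ?_
  rw [add_apply, smul_apply, one_apply_eq_self, inner_add_left, inner_smul_left,
    inner_self_eq_norm_sq_to_K, Complex.conj_ofReal, Complex.add_re]
  have : ((s : ℂ) * ((‖x‖ : ℂ)) ^ 2).re = s * ‖x‖ ^ 2 := by norm_cast
  have h2 := hA x
  simp only [Complex.coe_algebraMap]
  linarith

/-- The inverse `(s + A)⁻¹`, which exists for accretive `A` and `s > 0` (`isUnit_smul_one_add`). -/
def shiftInv (A : H →L[ℂ] H) (s : ℝ) : H →L[ℂ] H := Ring.inverse ((s : ℂ) • 1 + A)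

theorem shiftInv_right {A : H →L[ℂ] H} (hA : ∀ x, 0 ≤ (⟪A x, x⟫_ℂ).re) {s : ℝ}
    (hs : 0 < s) : s • shiftInv A s + A * shiftInv A s = 1 := by
  have := Ring.mul_inverse_cancel _ (isUnit_smul_one_add hA hs)
  rw [add_mul, smul_mul_assoc, one_mul, Complex.coe_smul] at this
  exact this

theorem commute_shiftInv {A : H →L[ℂ] H} (hA : ∀ x, 0 ≤ (⟪A x, x⟫_ℂ).re) {s : ℝ}
    (hs : 0 < s) {B : H →L[ℂ] H} (hB : Commute A B) : Commute (shiftInv A s) B := by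
  obtain ⟨u, hu⟩ := isUnit_smul_one_add hA hs
  unfold shiftInv
  rw [← hu, Ring.inverse_unit]
  have : Commute (u : H →L[ℂ] H) B := by
    rw [hu]
    exact ((Commute.one_left B).smul_left _).add_left hB
  exact this.units_inv_left

theorem shift_shiftInv_apply {A : H →L[ℂ] H} (hA : ∀ x, 0 ≤ (⟪A x, x⟫_ℂ).re) {s : ℝ}
    (hs : 0 < s) (x : H) : s • shiftInv A s x + A (shiftInv A s x) = x := by
  have := congrArg (fun L : H →L[ℂ] H => L x) (shiftInv_right hA hs)
  simpa using this

theorem norm_mul_shiftInv_le {A : H →L[ℂ] H} (hA : ∀ x, 0 ≤ (⟪A x, x⟫_ℂ).re) {s : ℝ}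
    (hs : 0 < s) : ‖A * shiftInv A s‖ ≤ 1 := by
  refine opNorm_le_bound _ zero_le_one fun x => ?_
  have h := norm_sq_shift hA hs (shiftInv A s x)
  rw [shift_shiftInv_apply hA hs] at h
  rw [one_mul, mul_apply_eq_comp]
  exact (abs_le_of_sq_le_sq' (by nlinarith [sq_nonneg (s * ‖shiftInv A s x‖)]) (norm_nonneg _)).2

theorem norm_shiftInv_le {A : H →L[ℂ] H} (hA : ∀ x, 0 ≤ (⟪A x, x⟫_ℂ).re) {s : ℝ}
    (hs : 0 < s) : s * ‖shiftInv A s‖ ≤ 1 := by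
  have : ‖s • shiftInv A s‖ ≤ 1 := by
    refine opNorm_le_bound _ zero_le_one fun x => ?_
    have h := norm_sq_shift hA hs (shiftInv A s x)
    rw [shift_shiftInv_apply hA hs] at h
    rw [one_mul, smul_apply, norm_smul, Real.norm_of_nonneg hs.le]
    exact (abs_le_of_sq_le_sq' (by nlinarith [sq_nonneg ‖A (shiftInv A s x)‖]) (norm_nonneg _)).2
  rwa [norm_smul, Real.norm_of_nonneg hs.le] at this

/-- The energy inequality: for accretive `A`, the increments of `s ↦ A (s + A)⁻¹ x` are
square-summable as `s` decreases to `0`. -/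
theorem norm_sq_increment_le {A : H →L[ℂ] H} (hA : ∀ x, 0 ≤ (⟪A x, x⟫_ℂ).re) {s t : ℝ}
    (hs : 0 < s) (ht : 0 < t) (hst : s ≤ t) (x : H) :
    ‖(A * shiftInv A s) x - (A * shiftInv A t) x‖ ^ 2 ≤
      ‖(A * shiftInv A s) x‖ ^ 2 - ‖(A * shiftInv A t) x‖ ^ 2 := by
  have hAs : Commute (shiftInv A s) A := commute_shiftInv hA hs (Commute.refl A)
  have hAt : Commute (shiftInv A t) A := commute_shiftInv hA ht (Commute.refl A)
  have hst' : Commute (shiftInv A s) (shiftInv A t) := commute_shiftInv hA hs hAt.symm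
  set v := shiftInv A s (shiftInv A t x) with hv
  have e1 : (A * shiftInv A t) x = s • A v + A (A v) := by
    rw [mul_apply_eq_comp, ← shift_shiftInv_apply hA hs (shiftInv A t x), map_add, map_smul_of_tower]
  have e2 : (A * shiftInv A s) x = t • A v + A (A v) := by
    have hv2 : v = shiftInv A t (shiftInv A s x) := by
      rw [hv, ← mul_apply_eq_comp, hst'.eq, mul_apply_eq_comp]
    rw [mul_apply_eq_comp, ← shift_shiftInv_apply hA ht (shiftInv A s x), ← hv2, map_add,
      map_smul_of_tower]
  have h1 : 0 ≤ (⟪(A * shiftInv A s) x - (A * shiftInv A t) x, (A * shiftInv A t) x⟫_ℂ).re := by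
    have e3 : (A * shiftInv A s) x - (A * shiftInv A t) x = ((t - s : ℝ) : ℂ) • A v := by
      rw [e1, e2, Complex.coe_smul, sub_smul]; abel
    rw [e3, e1, inner_smul_left, inner_add_right, ← Complex.coe_smul, inner_smul_right,
      Complex.conj_ofReal, Complex.re_ofReal_mul, Complex.add_re, Complex.re_ofReal_mul]
    have h := hA (A v)
    rw [← inner_conj_symm, Complex.conj_re] at h
    have h2 : 0 ≤ (⟪A v, A v⟫_ℂ).re := inner_self_nonneg (𝕜 := ℂ)
    have h3 : 0 ≤ t - s := by linarith
    positivity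
  have h2 := @norm_add_sq ℂ H _ _ _ ((A * shiftInv A s) x - (A * shiftInv A t) x)
    ((A * shiftInv A t) x)
  rw [sub_add_cancel, RCLike.re_to_complex] at h2
  linarith

end Contraction

section RittContraction

variable {H : Type*} [NormedAddCommGroup H] [InnerProductSpace ℂ H]

open ContinuousLinearMap

/-- The polynomial `f(r) = 3 r ^ 2 - 2 r ^ 3` satisfies `f(0) = f'(0) = f'(1) = 0` and `f(1) = 1`.
Its increments have a factor that vanishes at `0` and at `1`. -/
theorem cubic_increment {R : Type*} [Ring R] {a b : R} (h : Commute a b) :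
    (3 • (a * a) - 2 • (a * a * a)) - (3 • (b * b) - 2 • (b * b * b)) =
      (2 • (a * (1 - a)) + 2 • (b * (1 - b)) + a * (1 - b) + b * (1 - a)) * (a - b) := by
  have h1 : b * a = a * b := h.eq.symm
  have h2 : ∀ c, b * (a * c) = a * (b * c) := fun c => by rw [← mul_assoc, h1, mul_assoc]
  simp only [add_mul, mul_sub, sub_mul, mul_one, mul_assoc, h1, h2, smul_sub,
    smul_mul_assoc]
  abel

variable {T : H →L[ℂ] H}

theorem re_inner_one_sub_nonneg (hT : ‖T‖ ≤ 1) (x : H) : 0 ≤ (⟪(1 - T) x, x⟫_ℂ).re := by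
  rw [sub_apply, one_apply_eq_self, inner_sub_left, Complex.sub_re]
  have h1 : (⟪x, x⟫_ℂ).re = ‖x‖ ^ 2 := inner_self_eq_norm_sq (𝕜 := ℂ) x
  have h2 : (⟪T x, x⟫_ℂ).re ≤ ‖T x‖ * ‖x‖ :=
    (Complex.re_le_norm _).trans (norm_inner_le_norm _ _)
  have h3 : ‖T x‖ ≤ 1 * ‖x‖ := (le_opNorm _ _).trans (by gcongr)
  nlinarith [norm_nonneg x]

theorem norm_pow_le_one (hT : ‖T‖ ≤ 1) (n : ℕ) : ‖T ^ n‖ ≤ 1 := by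
  refine opNorm_le_bound _ zero_le_one fun x => ?_
  induction n with
  | zero => simp
  | succ n ih =>
    rw [pow_succ', mul_apply_eq_comp]
    refine (le_opNorm _ _).trans ?_
    calc ‖T‖ * ‖(T ^ n) x‖ ≤ 1 * (1 * ‖x‖) := by gcongr
      _ = _ := by ring

variable [CompleteSpace H]

/-- The two ways to estimate `2 ^ j T ^ (2 ^ j) (I - T)` composed with
`A (s + A)⁻¹ t (t + A)⁻¹`, where `A = I - T`. -/
theorem norm_block_mul_le (hT : ‖T‖ ≤ 1) {R : ℝ}
    (hR : ∀ n : ℕ, ((n : ℝ) + 1) * ‖T ^ n * (1 - T)‖ ≤ R) {s t : ℝ} (hs : 0 < s) (ht : 0 < t)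
    (j : ℕ) :
    (2 : ℝ) ^ j * ‖T ^ (2 ^ j : ℕ) * (1 - T) *
      (((1 - T) * shiftInv (1 - T) s) * (1 - (1 - T) * shiftInv (1 - T) t))‖ ≤
        min (2 ^ j * t) (4 * R ^ 2 / (2 ^ j * s)) := by
  have hA := re_inner_one_sub_nonneg hT
  set A := 1 - T with hAdef
  have hAs : Commute (shiftInv A s) A := commute_shiftInv hA hs (Commute.refl A)
  have hAt : Commute (shiftInv A t) A := commute_shiftInv hA ht (Commute.refl A)
  have e0 : 1 - A * shiftInv A t = t • shiftInv A t := by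
    rw [← shiftInv_right hA ht]; abel
  have hGs : ‖A * shiftInv A s‖ ≤ 1 := norm_mul_shiftInv_le hA hs
  have hGt : ‖A * shiftInv A t‖ ≤ 1 := norm_mul_shiftInv_le hA ht
  have hpow := norm_pow_le_one hT (2 ^ j)
  rw [e0]
  refine le_min ?_ ?_
  · have e1 : T ^ (2 ^ j : ℕ) * A * ((A * shiftInv A s) * (t • shiftInv A t)) =
        t • (T ^ (2 ^ j : ℕ) * ((A * shiftInv A s) * (A * shiftInv A t))) := by
      rw [mul_smul_comm, mul_smul_comm]
      congr 1
      rw [mul_assoc (T ^ (2 ^ j : ℕ)) A, ← mul_assoc A (A * shiftInv A s),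
        ← ((Commute.refl A).mul_left hAs).eq, mul_assoc (A * shiftInv A s)]
    rw [e1, norm_smul, Real.norm_of_nonneg ht.le]
    gcongr
    have h1 : ‖T ^ (2 ^ j : ℕ) * ((A * shiftInv A s) * (A * shiftInv A t))‖ ≤ 1 * (1 * 1) :=
      norm_mul_le_of_le hpow (norm_mul_le_of_le hGs hGt)
    nlinarith
  · have e1 : T ^ (2 ^ j : ℕ) * A * ((A * shiftInv A s) * (t • shiftInv A t)) =
        (T ^ (2 ^ j : ℕ) * A * A) * (shiftInv A s * (t • shiftInv A t)) := by
      simp only [mul_assoc]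
    have h1 := norm_pow_mul_one_sub_sq_le hR (2 ^ j)
    rw [← hAdef] at h1
    have h2 : ‖shiftInv A s‖ ≤ 1 / s := by
      rw [le_div_iff₀ hs, mul_comm]; exact norm_shiftInv_le hA hs
    have h3 : ‖t • shiftInv A t‖ ≤ 1 := by
      rw [norm_smul, Real.norm_of_nonneg ht.le]; exact norm_shiftInv_le hA ht
    have h4 : (2 ^ j : ℝ) ^ 2 * ‖T ^ (2 ^ j : ℕ) * A * A‖ ≤ 4 * R ^ 2 := by
      refine le_trans ?_ h1
      push_cast
      gcongr
      linarith
    rw [e1]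
    have h5 : ‖(T ^ (2 ^ j : ℕ) * A * A) * (shiftInv A s * (t • shiftInv A t))‖ ≤
        ‖T ^ (2 ^ j : ℕ) * A * A‖ * ((1 / s) * 1) :=
      norm_mul_le_of_le le_rfl (norm_mul_le_of_le h2 h3)
    have h6 : 0 < (2 : ℝ) ^ j := by positivity
    rw [le_div_iff₀ (by positivity)]
    calc _ ≤ (2 : ℝ) ^ j * (‖T ^ (2 ^ j : ℕ) * A * A‖ * ((1 / s) * 1)) * (2 ^ j * s) := by gcongr
      _ = (2 ^ j : ℝ) ^ 2 * ‖T ^ (2 ^ j : ℕ) * A * A‖ := by field_simp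
      _ ≤ _ := h4

theorem min_le_geomKernel {R s t : ℝ} {i : ℕ} (j : ℕ) (hs : (1 / 2) ^ (i + 1) ≤ s)
    (ht : t ≤ (1 / 2) ^ i) :
    min (2 ^ j * t) (4 * R ^ 2 / (2 ^ j * s)) ≤ (1 + 8 * R ^ 2) * geomKernel i j := by
  have hs0 : 0 < s := lt_of_lt_of_le (by positivity) hs
  unfold geomKernel
  rcases le_total j i with h | h
  · refine (min_le_left _ _).trans ?_
    obtain ⟨k, rfl⟩ := Nat.exists_eq_add_of_le h
    have e : j + k - j + (j - (j + k)) = k := by omega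
    rw [e]
    calc (2 : ℝ) ^ j * t ≤ 2 ^ j * (1 / 2) ^ (j + k) := by gcongr
      _ = 1 * (1 / 2) ^ k := by rw [pow_add, ← mul_assoc, ← mul_pow]; norm_num
      _ ≤ _ := by gcongr; nlinarith [sq_nonneg R]
  · refine (min_le_right _ _).trans ?_
    obtain ⟨k, rfl⟩ := Nat.exists_eq_add_of_le h
    have e : i - (i + k) + (i + k - i) = k := by omega
    rw [e]
    have h1 : (2 : ℝ) ^ (i + k) * (1 / 2) ^ (i + 1) = 2 ^ k / 2 := by
      rw [one_div_pow, pow_add, pow_succ]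
      field_simp
    calc 4 * R ^ 2 / (2 ^ (i + k) * s) ≤ 4 * R ^ 2 / (2 ^ (i + k) * (1 / 2) ^ (i + 1)) := by gcongr
      _ = 8 * R ^ 2 * (1 / 2) ^ k := by rw [h1, one_div_pow]; field_simp; ring
      _ ≤ _ := by gcongr; linarith

/-- A Ritt contraction has a square function estimate on dyadic blocks. With `A = I - T` and
`f(r) = 3 r ^ 2 - 2 r ^ 3`, the vector `x` is decomposed along the increments of
`i ↦ f(A (2 ^ (-i) + A)⁻¹) x`, and the contributions are summed by Schur's test. -/
theorem sum_dyadic_le_of_contraction (hT : ‖T‖ ≤ 1) {R : ℝ}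
    (hR : ∀ n : ℕ, ((n : ℝ) + 1) * ‖T ^ n * (1 - T)‖ ≤ R) (x : H) (J : ℕ) :
    ∑ j ∈ Finset.range J, ((2 : ℝ) ^ j * ‖(T ^ (2 ^ j : ℕ) * (1 - T) : H →L[ℂ] H) x‖) ^ 2 ≤
      (100 * (1 + 8 * R ^ 2)) ^ 2 * ‖x‖ ^ 2 := by
  have hA := re_inner_one_sub_nonneg hT
  set A := 1 - T with hAdef
  have hs : ∀ i : ℕ, 0 < (1 / 2 : ℝ) ^ i := fun i => by positivity
  set r : ℕ → H →L[ℂ] H := fun i => A * shiftInv A ((1 / 2) ^ i) with hr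
  set K := 1 + 8 * R ^ 2 with hK
  have hK0 : 0 < K := by positivity
  have hr1 : ∀ i, ‖r i‖ ≤ 1 := fun i => norm_mul_shiftInv_le hA (hs i)
  have hcr : ∀ i k, Commute (r i) (r k) := by
    intro i k
    have hk : Commute A (shiftInv A ((1 / 2) ^ k)) :=
      (commute_shiftInv hA (hs k) (Commute.refl A)).symm
    have h1 : Commute A (r k) := (Commute.refl A).mul_right hk
    exact h1.mul_left (commute_shiftInv hA (hs i) h1)
  set f : (H →L[ℂ] H) → (H →L[ℂ] H) := fun a => 3 • (a * a) - 2 • (a * a * a) with hf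
  -- With `n ≥ 2 * J`, the scale `2 ^ (-n)` is small enough for the last term of the decomposition.
  set n := 2 * J with hn
  set b : ℕ → H →L[ℂ] H := fun i => 2 • (r (i + 1) * (1 - r (i + 1))) + 2 • (r i * (1 - r i)) +
    r (i + 1) * (1 - r i) + r i * (1 - r (i + 1)) with hb
  set d : ℕ → ℝ := fun i => ‖r (i + 1) x - r i x‖ with hd
  have hdsum : ∑ i ∈ Finset.range n, d i ^ 2 ≤ ‖x‖ ^ 2 := by
    have h1 : ∀ i ∈ Finset.range n, d i ^ 2 ≤ ‖r (i + 1) x‖ ^ 2 - ‖r i x‖ ^ 2 := fun i _ =>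
      norm_sq_increment_le hA (hs (i + 1)) (hs i)
        (pow_le_pow_of_le_one (by norm_num) (by norm_num) i.le_succ) x
    refine (Finset.sum_le_sum h1).trans ?_
    rw [Finset.sum_range_sub (fun i => ‖r i x‖ ^ 2)]
    have h2 : ‖r n x‖ ≤ 1 * ‖x‖ := (le_opNorm _ _).trans (by gcongr; exact hr1 n)
    have h3 : ‖r n x‖ ^ 2 ≤ (1 * ‖x‖) ^ 2 := by gcongr
    rw [one_mul] at h3
    linarith [sq_nonneg ‖r 0 x‖]
  have hdecomp : x = f (r 0) x + ∑ i ∈ Finset.range n, b i (r (i + 1) x - r i x) +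
      (1 - f (r n)) x := by
    have h1 : ∀ i, b i (r (i + 1) x - r i x) = f (r (i + 1)) x - f (r i) x := by
      intro i
      have := congrArg (fun L : H →L[ℂ] H => L x) (cubic_increment (hcr (i + 1) i))
      exact this.symm
    simp only [h1]
    rw [Finset.sum_range_sub (fun i => f (r i) x)]
    have h2 : (1 - f (r n)) x = x - f (r n) x := rfl
    rw [h2]
    abel
  set P : ℕ → H →L[ℂ] H := fun j => T ^ (2 ^ j : ℕ) * A with hP
  have hPb : ∀ i j, (2 : ℝ) ^ j * ‖P j * b i‖ ≤ 6 * (K * geomKernel i j) := by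
    intro i j
    have h1 : (1 / 2 : ℝ) ^ (i + 1) ≤ (1 / 2) ^ i :=
      pow_le_pow_of_le_one (by norm_num) (by norm_num) i.le_succ
    have q : ∀ s t : ℝ, (1 / 2) ^ (i + 1) ≤ s → 0 < t → t ≤ (1 / 2) ^ i →
        (2 : ℝ) ^ j * ‖P j * ((A * shiftInv A s) * (1 - A * shiftInv A t))‖ ≤ K * geomKernel i j :=
      fun s t hs1 ht0 ht =>
        (norm_block_mul_le hT hR (lt_of_lt_of_le (hs _) hs1) ht0 j).trans
          (min_le_geomKernel j hs1 ht)
    have q1 := q _ _ le_rfl (hs (i + 1)) h1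
    have q2 := q _ _ h1 (hs i) le_rfl
    have q3 := q _ _ le_rfl (hs i) le_rfl
    have q4 := q _ _ h1 (hs (i + 1)) h1
    have hsplit : ‖P j * b i‖ ≤ 2 * ‖P j * (r (i + 1) * (1 - r (i + 1)))‖ +
        2 * ‖P j * (r i * (1 - r i))‖ + ‖P j * (r (i + 1) * (1 - r i))‖ +
          ‖P j * (r i * (1 - r (i + 1)))‖ := by
      simp only [hb, mul_add, two_nsmul]
      refine (norm_add_le _ _).trans (add_le_add_left ?_ _)
      refine (norm_add_le _ _).trans (add_le_add_left ?_ _)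
      refine (norm_add_le _ _).trans ?_
      rw [two_mul, two_mul]
      exact add_le_add (norm_add_le _ _) (norm_add_le _ _)
    calc _ ≤ (2 : ℝ) ^ j * _ := mul_le_mul_of_nonneg_left hsplit (by positivity)
      _ ≤ _ := by
        simp only [hr]
        linarith
  have hfirst : ∀ j, (2 : ℝ) ^ j * ‖P j * f (r 0)‖ ≤ 20 * R ^ 2 * (1 / 2) ^ j := by
    intro j
    have e1 : P j * f (r 0) = (P j * A) * (shiftInv A ((1 / 2) ^ 0) *
        (3 • r 0 - 2 • (r 0 * r 0))) := by
      have : f (r 0) = r 0 * (3 • r 0 - 2 • (r 0 * r 0)) := by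
        simp only [hf, mul_sub, mul_smul_comm, mul_assoc]
      rw [this]
      simp only [hr, mul_assoc]
    have h1 := norm_pow_mul_one_sub_sq_le hR (2 ^ j)
    have h2 : (2 ^ j : ℝ) ^ 2 * ‖P j * A‖ ≤ 4 * R ^ 2 := by
      refine le_trans ?_ h1
      push_cast
      gcongr
      linarith
    have h3 : ‖shiftInv A ((1 / 2) ^ 0)‖ ≤ 1 := by
      simpa using norm_shiftInv_le hA (hs 0)
    have h4 : ‖3 • r 0 - 2 • (r 0 * r 0)‖ ≤ 5 := by
      have e : 3 • r 0 - 2 • (r 0 * r 0) = r 0 + r 0 + r 0 - (r 0 * r 0 + r 0 * r 0) := by abel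
      rw [e]
      have g1 : ‖r 0 * r 0‖ ≤ 1 * 1 := norm_mul_le_of_le (hr1 0) (hr1 0)
      have g2 := norm_sub_le (r 0 + r 0 + r 0) (r 0 * r 0 + r 0 * r 0)
      have g3 := norm_add_le (r 0 + r 0) (r 0)
      have g4 := norm_add_le (r 0) (r 0)
      have g5 := norm_add_le (r 0 * r 0) (r 0 * r 0)
      linarith [hr1 0]
    have h5 : ‖P j * f (r 0)‖ ≤ ‖P j * A‖ * (1 * 5) := by
      rw [e1]; exact norm_mul_le_of_le le_rfl (norm_mul_le_of_le h3 h4)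
    have h6 : (0 : ℝ) < 2 ^ j := by positivity
    have h7 : (1 / 2 : ℝ) ^ j = 1 / 2 ^ j := by rw [one_div_pow]
    rw [h7, mul_one_div, le_div_iff₀ h6]
    nlinarith
  have hlast : ∀ j ∈ Finset.range J, (2 : ℝ) ^ j * ‖P j * (1 - f (r n))‖ ≤ 3 * (1 / 2) ^ j := by
    intro j hj
    have hjJ : j < J := Finset.mem_range.1 hj
    have e0 : 1 - r n = ((1 / 2 : ℝ) ^ n) • shiftInv A ((1 / 2) ^ n) := by
      rw [← shiftInv_right hA (hs n)]; simp only [hr]; abel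
    have e1 : P j * (1 - f (r n)) = ((1 / 2 : ℝ) ^ n) • (T ^ (2 ^ j : ℕ) * (r n *
        ((1 - r n) * (1 + 2 • r n)))) := by
      have : 1 - f (r n) = (1 - r n) * ((1 - r n) * (1 + 2 • r n)) := by
        simp only [hf]; noncomm_ring
      rw [this]
      nth_rewrite 1 [e0]
      simp only [hP, smul_mul_assoc, mul_smul_comm, mul_assoc]
      simp only [hr, mul_assoc]
    have h1 : ‖1 - r n‖ ≤ 1 := by
      rw [e0, norm_smul, Real.norm_of_nonneg (hs n).le]; exact norm_shiftInv_le hA (hs n)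
    have h2 : ‖1 + 2 • r n‖ ≤ 3 := by
      have e : 1 + 2 • r n = 1 + (r n + r n) := by rw [two_nsmul]
      rw [e]
      have g0 : ‖(1 : H →L[ℂ] H)‖ ≤ 1 := norm_id_le
      linarith [norm_add_le 1 (r n + r n), norm_add_le (r n) (r n), hr1 n]
    have h3 : ‖T ^ (2 ^ j : ℕ) * (r n * ((1 - r n) * (1 + 2 • r n)))‖ ≤ 1 * (1 * (1 * 3)) :=
      norm_mul_le_of_le (norm_pow_le_one hT _) (norm_mul_le_of_le (hr1 n) (norm_mul_le_of_le h1 h2))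
    rw [e1, norm_smul, Real.norm_of_nonneg (hs n).le]
    have h4 : (1 / 2 : ℝ) ^ n ≤ (1 / 2) ^ (j + j) :=
      pow_le_pow_of_le_one (by norm_num) (by norm_num) (by omega)
    calc _ ≤ (2 : ℝ) ^ j * ((1 / 2) ^ (j + j) * (1 * (1 * (1 * 3)))) := by gcongr
      _ = _ := by
        rw [one_div_pow, one_div_pow, pow_add]
        field_simp
  have hmain : ∀ j ∈ Finset.range J, ((2 : ℝ) ^ j * ‖P j x‖) ^ 2 ≤
      2 * (20 * K * ‖x‖) ^ 2 * (1 / 2) ^ j +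
        72 * K ^ 2 * (∑ i ∈ Finset.range n, geomKernel i j * d i) ^ 2 := by
    intro j hj
    have h1 : P j x = (P j * f (r 0)) x + ∑ i ∈ Finset.range n, (P j * b i) (r (i + 1) x - r i x) +
        (P j * (1 - f (r n))) x := by
      conv_lhs => rw [hdecomp]
      simp only [map_add, map_sum, mul_apply_eq_comp]
    have h2 : (2 : ℝ) ^ j * ‖P j x‖ ≤ 20 * R ^ 2 * (1 / 2) ^ j * ‖x‖ +
        ∑ i ∈ Finset.range n, 6 * (K * geomKernel i j) * d i + 3 * (1 / 2) ^ j * ‖x‖ := by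
      rw [h1]
      have g1 := norm_add₃_le (a := (P j * f (r 0)) x)
        (b := ∑ i ∈ Finset.range n, (P j * b i) (r (i + 1) x - r i x))
        (c := (P j * (1 - f (r n))) x)
      have g2 := norm_sum_le (Finset.range n) (fun i => (P j * b i) (r (i + 1) x - r i x))
      have g3 : (2 : ℝ) ^ j * ‖(P j * f (r 0)) x‖ ≤ 20 * R ^ 2 * (1 / 2) ^ j * ‖x‖ := by
        calc _ ≤ (2 : ℝ) ^ j * (‖P j * f (r 0)‖ * ‖x‖) := by gcongr; exact le_opNorm _ _
          _ = ((2 : ℝ) ^ j * ‖P j * f (r 0)‖) * ‖x‖ := by ring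
          _ ≤ _ := mul_le_mul_of_nonneg_right (hfirst j) (norm_nonneg x)
      have g4 : (2 : ℝ) ^ j * ‖(P j * (1 - f (r n))) x‖ ≤ 3 * (1 / 2) ^ j * ‖x‖ := by
        calc _ ≤ (2 : ℝ) ^ j * (‖P j * (1 - f (r n))‖ * ‖x‖) := by gcongr; exact le_opNorm _ _
          _ = ((2 : ℝ) ^ j * ‖P j * (1 - f (r n))‖) * ‖x‖ := by ring
          _ ≤ _ := mul_le_mul_of_nonneg_right (hlast j hj) (norm_nonneg x)
      have g5 : (2 : ℝ) ^ j * ∑ i ∈ Finset.range n, ‖(P j * b i) (r (i + 1) x - r i x)‖ ≤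
          ∑ i ∈ Finset.range n, 6 * (K * geomKernel i j) * d i := by
        rw [Finset.mul_sum]
        refine Finset.sum_le_sum fun i _ => ?_
        calc _ ≤ (2 : ℝ) ^ j * (‖P j * b i‖ * d i) := by gcongr; exact le_opNorm _ _
          _ = ((2 : ℝ) ^ j * ‖P j * b i‖) * d i := by ring
          _ ≤ _ := mul_le_mul_of_nonneg_right (hPb i j) (norm_nonneg _)
      have h6 : (0 : ℝ) < 2 ^ j := by positivity
      calc _ ≤ (2 : ℝ) ^ j * (‖(P j * f (r 0)) x‖ +
            ∑ i ∈ Finset.range n, ‖(P j * b i) (r (i + 1) x - r i x)‖ +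
              ‖(P j * (1 - f (r n))) x‖) := by gcongr; linarith
        _ ≤ _ := by linarith
    set σ := ∑ i ∈ Finset.range n, geomKernel i j * d i with hσ
    have h3 : ∑ i ∈ Finset.range n, 6 * (K * geomKernel i j) * d i = 6 * K * σ := by
      rw [hσ, Finset.mul_sum]; exact Finset.sum_congr rfl fun i _ => by ring
    have h4 : (2 : ℝ) ^ j * ‖P j x‖ ≤ 20 * K * ‖x‖ * (1 / 2) ^ j + 6 * K * σ := by
      have : 0 ≤ R ^ 2 * (‖x‖ * (1 / 2 : ℝ) ^ j) := by positivity
      have : 0 ≤ ‖x‖ * (1 / 2 : ℝ) ^ j := by positivity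
      rw [h3] at h2
      rw [hK] at h2 ⊢
      nlinarith
    have h5 : ((1 / 2 : ℝ) ^ j) ^ 2 ≤ (1 / 2) ^ j := by
      rw [← pow_mul]
      exact pow_le_pow_of_le_one (by norm_num) (by norm_num) (by omega)
    calc ((2 : ℝ) ^ j * ‖P j x‖) ^ 2 ≤ (20 * K * ‖x‖ * (1 / 2) ^ j + 6 * K * σ) ^ 2 := by gcongr
      _ ≤ 2 * ((20 * K * ‖x‖ * (1 / 2) ^ j) ^ 2 + (6 * K * σ) ^ 2) := add_sq_le
      _ = 2 * (20 * K * ‖x‖) ^ 2 * ((1 / 2 : ℝ) ^ j) ^ 2 + 72 * K ^ 2 * σ ^ 2 := by ring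
      _ ≤ _ := by gcongr
  refine (Finset.sum_le_sum hmain).trans ?_
  rw [Finset.sum_add_distrib, ← Finset.mul_sum, ← Finset.mul_sum]
  have h1 := sum_half_pow_le J
  have h2 := sum_sq_sum_geomKernel_le J n d
  calc _ ≤ 2 * (20 * K * ‖x‖) ^ 2 * 2 + 72 * K ^ 2 * (9 * ‖x‖ ^ 2) := by
        gcongr
        exact h2.trans (by gcongr)
    _ ≤ _ := by
        have : 0 ≤ K ^ 2 * ‖x‖ ^ 2 := by positivity
        nlinarith

theorem squareFunctionEstimate_of_isSimilarToContraction (hT : IsRitt T)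
    (hsim : IsSimilarToContraction T) : SquareFunctionEstimate T := by
  obtain ⟨V, hV⟩ := hsim
  obtain ⟨⟨M, hM⟩, R, hR⟩ := (isRitt_iff T).1 hT
  have hM0 : 0 ≤ M := (norm_nonneg _).trans (hM 0)
  set S : H →L[ℂ] H := (↑V⁻¹ : H →L[ℂ] H) * T * (V : H →L[ℂ] H) with hS
  have hpow : ∀ n : ℕ, S ^ n = (↑V⁻¹ : H →L[ℂ] H) * T ^ n * (V : H →L[ℂ] H) :=
    fun n => Units.conj_pow' V T n
  have hconj : ∀ n : ℕ,
      S ^ n * (1 - S) = (↑V⁻¹ : H →L[ℂ] H) * (T ^ n * (1 - T)) * (V : H →L[ℂ] H) := by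
    intro n
    rw [mul_sub, mul_one, ← pow_succ, hpow, hpow, mul_sub, mul_one, ← pow_succ, mul_sub, sub_mul]
  have hconj' : ∀ n : ℕ,
      T ^ n * (1 - T) = (V : H →L[ℂ] H) * (S ^ n * (1 - S)) * (↑V⁻¹ : H →L[ℂ] H) := by
    intro n
    rw [hconj]
    simp only [← mul_assoc, Units.mul_inv, one_mul]
    rw [mul_assoc _ (V : H →L[ℂ] H), Units.mul_inv, mul_one]
  set v := ‖(V : H →L[ℂ] H)‖
  set w := ‖(↑V⁻¹ : H →L[ℂ] H)‖
  have hR' : ∀ n : ℕ, ((n : ℝ) + 1) * ‖S ^ n * (1 - S)‖ ≤ w * R * v := by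
    intro n
    rw [hconj]
    have h1 : ‖(↑V⁻¹ : H →L[ℂ] H) * (T ^ n * (1 - T)) * (V : H →L[ℂ] H)‖ ≤
        w * ‖T ^ n * (1 - T)‖ * v := norm_mul_le_of_le (norm_mul_le _ _) le_rfl
    calc _ ≤ ((n : ℝ) + 1) * (w * ‖T ^ n * (1 - T)‖ * v) := by gcongr
      _ = w * (((n : ℝ) + 1) * ‖T ^ n * (1 - T)‖) * v := by ring
      _ ≤ _ := by gcongr; exact hR n
  rw [squareFunctionEstimate_iff]
  set D := 100 * (1 + 8 * (w * R * v) ^ 2)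
  have hD0 : 0 ≤ D := by positivity
  refine ⟨_, ?_, squareBound_of_dyadic (D := v * D * w) hM (by positivity) fun x J => ?_⟩
  · positivity
  have h := sum_dyadic_le_of_contraction hV hR' ((↑V⁻¹ : H →L[ℂ] H) x) J
  have hx : ‖(↑V⁻¹ : H →L[ℂ] H) x‖ ≤ w * ‖x‖ := le_opNorm _ _
  calc _ ≤ ∑ j ∈ Finset.range J, v ^ 2 *
        ((2 : ℝ) ^ j * ‖(S ^ (2 ^ j : ℕ) * (1 - S) : H →L[ℂ] H) ((↑V⁻¹ : H →L[ℂ] H) x)‖) ^ 2 := by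
        refine Finset.sum_le_sum fun j _ => ?_
        rw [hconj', mul_assoc, mul_apply_eq_comp, mul_apply_eq_comp, ← mul_pow]
        refine pow_le_pow_left₀ (by positivity) ?_ 2
        rw [mul_left_comm v]
        gcongr
        exact le_opNorm _ _
    _ ≤ v ^ 2 * (D ^ 2 * (w * ‖x‖) ^ 2) := by
        rw [← Finset.mul_sum]
        gcongr
        exact h.trans (by gcongr)
    _ = _ := by ring

end RittContraction

section Adjoint

variable {H : Type*} [NormedAddCommGroup H] [InnerProductSpace ℂ H] [CompleteSpace H]

open ContinuousLinearMap

theorem isPowerBounded_adjoint {T : H →L[ℂ] H} (hT : IsPowerBounded T) :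
    IsPowerBounded (adjoint T) := by
  obtain ⟨M, hM⟩ := hT
  refine ⟨M, fun n => ?_⟩
  rw [← star_eq_adjoint, ← star_pow, norm_star]
  exact hM n

theorem isRitt_adjoint {T : H →L[ℂ] H} (hT : IsRitt T) : IsRitt (adjoint T) := by
  refine ⟨isPowerBounded_adjoint hT.1, ?_⟩
  obtain ⟨C, hC⟩ := hT.2
  refine ⟨C, fun n => ?_⟩
  rw [← star_eq_adjoint, ← star_pow, ← star_pow, ← star_sub, norm_star]
  exact hC n

theorem isSimilarToContraction_adjoint {T : H →L[ℂ] H} (hT : IsSimilarToContraction T) :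
    IsSimilarToContraction (adjoint T) := by
  obtain ⟨V, hV⟩ := hT
  refine ⟨(star V)⁻¹, ?_⟩
  rw [← norm_star] at hV
  simp only [star_mul] at hV
  rw [inv_inv, ← star_eq_adjoint, Units.coe_star, Units.coe_star_inv, mul_assoc]
  exact hV

end Adjoint

/-! ### Geometry of Stolz domains -/

section Geometry

theorem mem_stolz {γ τ : ℝ} {z : ℂ} (hτ0 : 0 < τ) (hτ1 : τ ≤ 1)
    (hz : ‖z - 1 + τ‖ < τ * Real.sin γ) : z ∈ stolz γ := by
  have hopen : IsOpen {w : ℂ | ‖w - 1 + τ‖ < τ * Real.sin γ} :=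
    isOpen_lt (by fun_prop) continuous_const
  refine interior_maximal ?_ hopen hz
  intro w hw
  have h1 : (1 : ℂ) ∈ convexHull ℝ (insert (1 : ℂ) (Metric.ball (0 : ℂ) (Real.sin γ))) :=
    subset_convexHull ℝ _ (Set.mem_insert _ _)
  have h2 : ((τ : ℂ)⁻¹ * (w - 1 + τ)) ∈
      convexHull ℝ (insert (1 : ℂ) (Metric.ball (0 : ℂ) (Real.sin γ))) := by
    refine subset_convexHull ℝ _ (Set.mem_insert_of_mem _ ?_)
    rw [mem_ball_zero_iff, norm_mul, norm_inv, Complex.norm_real, Real.norm_of_nonneg hτ0.le,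
      inv_mul_lt_iff₀ hτ0]
    exact hw
  have h3 := (convex_convexHull ℝ _) h1 h2 (by linarith : 0 ≤ 1 - τ) hτ0.le (by ring)
  have hτ : (τ : ℂ) ≠ 0 := by exact_mod_cast hτ0.ne'
  have h4 : (1 - τ) • (1 : ℂ) + τ • ((τ : ℂ)⁻¹ * (w - 1 + τ)) = w := by
    rw [Complex.real_smul, Complex.real_smul, mul_inv_cancel_left₀ hτ]
    push_cast
    ring
  rwa [h4] at h3

theorem exists_of_mem_closure_stolz {γ : ℝ} {z : ℂ} (hz : z ∈ closure (stolz γ)) :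
    ∃ τ : ℝ, 0 ≤ τ ∧ τ ≤ 1 ∧ ‖z - 1 + τ‖ ≤ τ * Real.sin γ := by
  set K : Set ℂ := (fun p : ℝ × ℂ => ((1 - p.1 : ℝ) : ℂ) + (p.1 : ℂ) * p.2) ''
    (Set.Icc (0 : ℝ) 1 ×ˢ Metric.closedBall (0 : ℂ) (Real.sin γ)) with hK
  by_cases hγ : 0 < Real.sin γ
  · have hKc : IsClosed K := by
      refine IsCompact.isClosed ((isCompact_Icc.prod (isCompact_closedBall _ _)).image ?_)
      fun_prop
    have hsub : convexHull ℝ (insert (1 : ℂ) (Metric.ball (0 : ℂ) (Real.sin γ))) ⊆ K := by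
      intro w hw
      rw [convexHull_insert ⟨0, by simpa using hγ⟩, mem_convexJoin] at hw
      obtain ⟨a, ha, b, hb, hw⟩ := hw
      rw [Set.mem_singleton_iff] at ha
      rw [(convex_ball (0 : ℂ) (Real.sin γ)).convexHull_eq] at hb
      obtain ⟨s, t, hs, ht, hst, rfl⟩ := hw
      refine ⟨(t, b), ⟨⟨ht, by linarith⟩, Metric.ball_subset_closedBall hb⟩, ?_⟩
      have : (1 : ℝ) - t = s := by linarith
      simp [ha, this]
    have hzK : z ∈ K := closure_minimal (interior_subset.trans hsub) hKc hz
    obtain ⟨⟨τ, w⟩, ⟨⟨h0, h1⟩, hw⟩, rfl⟩ := hzK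
    refine ⟨τ, h0, h1, ?_⟩
    have e : ((1 - τ : ℝ) : ℂ) + (τ : ℂ) * w - 1 + τ = τ * w := by push_cast; ring
    simp only at e ⊢
    rw [e, norm_mul, Complex.norm_real, Real.norm_of_nonneg h0]
    exact mul_le_mul_of_nonneg_left (by simpa using hw) h0
  · exfalso
    have : stolz γ = ∅ := by
      unfold stolz
      rw [Metric.ball_eq_empty.2 (not_lt.1 hγ)]
      simp
    simp [this] at hz

theorem isOpen_stolz (γ : ℝ) : IsOpen (stolz γ) := isOpen_interior

theorem convex_stolz (γ : ℝ) : Convex ℝ (stolz γ) := (convex_convexHull ℝ _).interior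

/-- In a Stolz domain, the distance to `1` is controlled by the distance to the unit circle. -/
theorem norm_add_mul_le_of_mem {γ ε : ℝ} (hε : 0 ≤ ε)
    (hγ : Real.sin γ + ε * (1 + Real.sin γ) ≤ 1) {z : ℂ} (hz : z ∈ closure (stolz γ)) :
    ‖z‖ + ε * ‖1 - z‖ ≤ 1 := by
  obtain ⟨τ, h0, h1, h⟩ := exists_of_mem_closure_stolz hz
  have e1 : ‖z‖ ≤ τ * Real.sin γ + (1 - τ) := by
    calc ‖z‖ = ‖(z - 1 + τ) + ((1 - τ : ℝ) : ℂ)‖ := by congr 1; push_cast; ring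
      _ ≤ ‖z - 1 + τ‖ + ‖((1 - τ : ℝ) : ℂ)‖ := norm_add_le _ _
      _ ≤ _ := by rw [Complex.norm_real, Real.norm_of_nonneg (by linarith)]; linarith
  have e2 : ‖1 - z‖ ≤ τ * Real.sin γ + τ := by
    calc ‖1 - z‖ = ‖(τ : ℂ) - (z - 1 + τ)‖ := by congr 1; ring
      _ ≤ ‖(τ : ℂ)‖ + ‖z - 1 + τ‖ := norm_sub_le _ _
      _ ≤ _ := by rw [Complex.norm_real, Real.norm_of_nonneg h0]; linarith
  nlinarith [mul_le_mul_of_nonneg_left e2 hε]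

theorem norm_lt_one_of_mem_stolz {γ : ℝ} {z : ℂ} (hz : z ∈ stolz γ) :
    ‖z‖ < 1 := by
  have hsub : stolz γ ⊆ Metric.closedBall (0 : ℂ) 1 := by
    refine interior_subset.trans (convexHull_min ?_ (convex_closedBall _ _))
    refine Set.insert_subset (by simp) ?_
    exact Metric.ball_subset_closedBall.trans (Metric.closedBall_subset_closedBall (Real.sin_le_one γ))
  have h := interior_maximal hsub (isOpen_stolz γ) hz
  rw [interior_closedBall _ one_ne_zero] at h
  simpa using h

theorem one_mem_closure_stolz {γ : ℝ} (hγ : 0 < Real.sin γ) : (1 : ℂ) ∈ closure (stolz γ) := by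
  have h : Tendsto (fun n : ℕ => (1 : ℂ) - ((1 / ((n : ℝ) + 1) : ℝ) : ℂ)) atTop
      (𝓝 (1 - ((0 : ℝ) : ℂ))) :=
    tendsto_const_nhds.sub ((Complex.continuous_ofReal.tendsto _).comp
      tendsto_one_div_add_atTop_nhds_zero_nat)
  rw [Complex.ofReal_zero, sub_zero] at h
  refine mem_closure_of_tendsto h (Eventually.of_forall fun n => ?_)
  have h0 : (0 : ℝ) < 1 / ((n : ℝ) + 1) := by positivity
  refine mem_stolz (τ := 1 / ((n : ℝ) + 1)) h0 ?_ ?_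
  · rw [div_le_one (by positivity)]; linarith [(Nat.cast_nonneg n : (0 : ℝ) ≤ n)]
  · rw [sub_sub_cancel_left, neg_add_cancel, norm_zero]; positivity

/-- A Stolz domain of angle close to `π / 2` contains the points whose distance to the unit circle
is at least a given multiple of their distance to `1`. -/
theorem mem_closure_stolz_of_norm_lt {γ ε : ℝ} (hε0 : 0 < ε) (hε1 : ε ≤ 1) (hγ : 0 < Real.sin γ)
    (hcos : |Real.cos γ| < ε) {z : ℂ} (hz : ‖z‖ + ε * ‖1 - z‖ < 1 ∨ z = 1) :
    z ∈ closure (stolz γ) := by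
  by_cases hz1 : z = 1
  · rw [hz1]; exact one_mem_closure_stolz hγ
  replace hz := hz.resolve_right hz1
  have hd0 : 0 < ‖1 - z‖ := norm_pos_iff.2 (sub_ne_zero.2 (Ne.symm hz1))
  set d := ‖1 - z‖ with hd
  -- `2 Re (1 - z) = 1 + d ^ 2 - ‖z‖ ^ 2`
  have hre : ‖z‖ ^ 2 = 1 - 2 * (1 - z.re) + d ^ 2 := by
    rw [hd, Complex.sq_norm, Complex.sq_norm, Complex.normSq_apply, Complex.normSq_apply]
    simp only [Complex.sub_re, Complex.one_re, Complex.sub_im, Complex.one_im]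
    ring
  have hsq : ‖z‖ ^ 2 ≤ (1 - ε * d) ^ 2 := by
    gcongr
    linarith
  have hcos2 : Real.cos γ ^ 2 < ε ^ 2 := sq_lt_sq.2 (by rwa [abs_of_pos hε0])
  have hsin2 := Real.sin_sq_add_cos_sq γ
  have key : ∀ τ : ℝ, 0 < τ → τ ≤ 1 → τ ^ 2 * Real.cos γ ^ 2 < 2 * τ * (1 - z.re) - d ^ 2 →
      z ∈ stolz γ := by
    intro τ h0 h1 h
    refine mem_stolz h0 h1 ?_
    refine lt_of_pow_lt_pow_left₀ 2 (by positivity) ?_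
    have e : ‖z - 1 + τ‖ ^ 2 = d ^ 2 - 2 * τ * (1 - z.re) + τ ^ 2 := by
      rw [hd, Complex.sq_norm, Complex.sq_norm, Complex.normSq_apply, Complex.normSq_apply]
      simp only [Complex.sub_re, Complex.one_re, Complex.sub_im, Complex.one_im, Complex.add_re,
        Complex.add_im, Complex.ofReal_re, Complex.ofReal_im]
      ring
    rw [e, mul_pow]
    nlinarith
  apply subset_closure
  have hεd : ε * d < 1 := by linarith [norm_nonneg z]
  rcases le_total d ε with h | h
  · refine key (d / ε) (by positivity) ((div_le_one hε0).2 h) ?_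
    have h1 : ε * d ≤ 1 - z.re := by
      have : ε ^ 2 * d ^ 2 ≤ 1 * d ^ 2 := by gcongr; exact pow_le_one₀ hε0.le hε1
      nlinarith
    have h2 : (d / ε) ^ 2 * Real.cos γ ^ 2 < d ^ 2 := by
      rw [div_pow, div_mul_eq_mul_div, div_lt_iff₀ (by positivity)]
      exact mul_lt_mul_of_pos_left hcos2 (by positivity)
    have h3 : 2 * d ^ 2 ≤ 2 * (d / ε) * (1 - z.re) := by
      calc 2 * d ^ 2 = 2 * (d / ε) * (ε * d) := by field_simp
        _ ≤ _ := by gcongr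
    linarith
  · refine key 1 one_pos le_rfl ?_
    have h1 : ε ^ 2 ≤ ε * d := by nlinarith
    nlinarith

/-- The boundary of the Stolz domain `B_β`. The closure of `B_β` is the union of the closed discs of
center `1 - τ` and radius `τ sin β`, `0 ≤ τ ≤ 1`; a boundary point belongs to one of them, and to the
interior of none. -/
def stolzBdry (β : ℝ) : Set ℂ :=
  {z | (∃ τ : ℝ, 0 ≤ τ ∧ τ ≤ 1 ∧ ‖z - 1 + τ‖ ≤ τ * Real.sin β) ∧
    ∀ τ : ℝ, 0 ≤ τ → τ ≤ 1 → τ * Real.sin β ≤ ‖z - 1 + τ‖}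

theorem mul_mem_stolz {β γ r : ℝ} (hs0 : 0 ≤ Real.sin β) (hs : Real.sin β < Real.sin γ)
    (hr0 : 0 ≤ r) (hr1 : r ≤ 1) {z : ℂ} (hz : z ∈ stolzBdry β) (h : r < 1 ∨ z ≠ 1) :
    (r : ℂ) * z ∈ stolz γ := by
  obtain ⟨τ, h0, h1, hle⟩ := hz.1
  have hpos : 0 < 1 - r + r * τ := by
    rcases h with h | h
    · nlinarith
    · have hτ : 0 < τ := by
        refine lt_of_le_of_ne h0 fun h' => h ?_
        rw [← h'] at hle
        simpa [sub_eq_zero] using hle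
      rcases hr1.lt_or_eq with h2 | h2
      · nlinarith
      · rw [h2]; linarith
  refine mem_stolz (τ := 1 - r + r * τ) hpos (by nlinarith) ?_
  have e : (r : ℂ) * z - 1 + ((1 - r + r * τ : ℝ) : ℂ) = r * (z - 1 + τ) := by push_cast; ring
  rw [e, norm_mul, Complex.norm_real, Real.norm_of_nonneg hr0]
  calc r * ‖z - 1 + τ‖ ≤ r * (τ * Real.sin β) := by gcongr
    _ ≤ (1 - r + r * τ) * Real.sin β := by nlinarith
    _ < _ := by gcongr

theorem mem_stolz_of_mem_stolzBdry {β γ : ℝ} (hs0 : 0 ≤ Real.sin β) (hs : Real.sin β < Real.sin γ)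
    {z : ℂ} (hz : z ∈ stolzBdry β) (h : z ≠ 1) : z ∈ stolz γ := by
  simpa using mul_mem_stolz hs0 hs zero_le_one le_rfl hz (Or.inr h)

theorem div_notMem_closure_stolz {α β r : ℝ} (hs0 : 0 < Real.sin α) (hs : Real.sin α < Real.sin β)
    (hr0 : 0 < r) (hr1 : r ≤ 1) {z : ℂ} (hz : z ∈ stolzBdry β) (h : r < 1 ∨ z ≠ 1) :
    z / r ∉ closure (stolz α) := by
  intro hcl
  obtain ⟨τ, h0, h1, hle⟩ := exists_of_mem_closure_stolz hcl
  have hrc : (r : ℂ) ≠ 0 := by exact_mod_cast hr0.ne'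
  have h2 := hz.2 (1 - r + r * τ) (by nlinarith) (by nlinarith)
  have e : z - 1 + ((1 - r + r * τ : ℝ) : ℂ) = r * (z / r - 1 + τ) := by
    push_cast; field_simp; ring
  rw [e, norm_mul, Complex.norm_real, Real.norm_of_nonneg hr0.le] at h2
  have h3 : r * ‖z / r - 1 + τ‖ ≤ r * (τ * Real.sin α) := by gcongr
  have hτ' : 0 ≤ r * τ := by positivity
  have h4 : 1 - r + r * τ ≤ 0 := by
    by_contra hpos
    push Not at hpos
    nlinarith
  have hr : r = 1 := by linarith
  have hτ : τ = 0 := by rw [hr] at h4; linarith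
  rcases h with h | h
  · linarith
  · apply h
    rw [hτ, hr] at hle
    simpa [sub_eq_zero] using hle

theorem mul_sin_le_norm_sub {β r : ℝ} (hr0 : 0 ≤ r) (hr1 : r ≤ 1) {z : ℂ} (hz : z ∈ stolzBdry β) :
    (1 - r) * Real.sin β ≤ ‖z - r‖ := by
  have := hz.2 (1 - r) (by linarith) (by linarith)
  have e : z - 1 + ((1 - r : ℝ) : ℂ) = z - r := by push_cast; ring
  rwa [e] at this

theorem segment_mem_stolzBdry {β σ t : ℝ} (hβ : 0 ≤ Real.sin β) (hσ : σ ^ 2 = 1)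
    (ht0 : 0 ≤ t) (ht1 : t ≤ 1) {z : ℂ}
    (hre : z.re = 1 - t * Real.cos β ^ 2) (him : z.im = σ * t * Real.cos β * Real.sin β) :
    z ∈ stolzBdry β := by
  have h : ∀ τ : ℝ, ‖z - 1 + τ‖ ^ 2 =
      (τ * Real.sin β) ^ 2 + Real.cos β ^ 2 * (τ - t) ^ 2 := by
    intro τ
    rw [Complex.sq_norm, Complex.normSq_apply]
    simp only [Complex.sub_re, Complex.one_re, Complex.sub_im, Complex.one_im, Complex.add_re,
        Complex.add_im, Complex.ofReal_re, Complex.ofReal_im, hre, him]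
    have e1 := Real.sin_sq_add_cos_sq β
    have e2 : Real.sin β ^ 2 = 1 - Real.cos β ^ 2 := by linarith
    have e3 : σ * t * Real.cos β * Real.sin β * (σ * t * Real.cos β * Real.sin β) =
        σ ^ 2 * t ^ 2 * Real.cos β ^ 2 * Real.sin β ^ 2 := by ring
    rw [sub_zero, add_zero, e3, mul_pow, e2, hσ]
    ring
  refine ⟨⟨t, ht0, ht1, ?_⟩, fun τ hτ0 _ => ?_⟩
  · refine (abs_le_of_sq_le_sq' ?_ (by positivity)).2
    rw [h t, sub_self]
    simp
  · refine (abs_le_of_sq_le_sq' ?_ (norm_nonneg _)).2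
    rw [h τ]
    nlinarith [mul_nonneg (sq_nonneg (Real.cos β)) (sq_nonneg (τ - t))]

theorem arc_mem_stolzBdry {β θ : ℝ} (hβ : 0 ≤ Real.sin β) (hθ : Real.cos θ ≤ Real.sin β) :
    (Real.sin β : ℂ) * Complex.exp (θ * Complex.I) ∈ stolzBdry β := by
  set z := (Real.sin β : ℂ) * Complex.exp (θ * Complex.I) with hz
  have hn : ‖z‖ = Real.sin β := by
    rw [hz, norm_mul, Complex.norm_exp_ofReal_mul_I, Complex.norm_real, Real.norm_of_nonneg hβ, mul_one]
  have hre : z.re = Real.sin β * Real.cos θ := by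
    rw [hz, Complex.re_ofReal_mul, Complex.exp_ofReal_mul_I_re]
  refine ⟨⟨1, zero_le_one, le_rfl, ?_⟩, fun τ hτ0 hτ1 => ?_⟩
  · simp [hn]
  · refine (abs_le_of_sq_le_sq' ?_ (norm_nonneg _)).2
    have e : ‖z - 1 + τ‖ ^ 2 = ‖z‖ ^ 2 - 2 * (1 - τ) * z.re + (1 - τ) ^ 2 := by
      rw [Complex.sq_norm, Complex.sq_norm, Complex.normSq_apply, Complex.normSq_apply]
      simp only [Complex.sub_re, Complex.one_re, Complex.sub_im, Complex.one_im, Complex.add_re,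
        Complex.add_im, Complex.ofReal_re, Complex.ofReal_im]
      ring
    rw [e, hn, hre]
    have h1 : Real.sin β * Real.cos θ ≤ Real.sin β ^ 2 := by nlinarith
    have h2 : Real.sin β ^ 2 ≤ 1 := by nlinarith [Real.sin_le_one β]
    nlinarith [mul_nonneg (by linarith : 0 ≤ 1 - τ) (sub_nonneg.2 h1),
      mul_nonneg (sq_nonneg (1 - τ)) (sub_nonneg.2 h2)]

end Geometry

/-! ### Resolvent estimates for Ritt operators -/

section Resolvent

variable {X : Type*} [NormedAddCommGroup X] [NormedSpace ℂ X]

theorem resolvent_mul_sub {T : X →L[ℂ] X} {z : ℂ} (hz : z ∈ resolventSet ℂ T) :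
    resolvent T z * (algebraMap ℂ (X →L[ℂ] X) z - T) = 1 :=
  Ring.inverse_mul_cancel _ hz

theorem sub_mul_resolvent {T : X →L[ℂ] X} {z : ℂ} (hz : z ∈ resolventSet ℂ T) :
    (algebraMap ℂ (X →L[ℂ] X) z - T) * resolvent T z = 1 :=
  Ring.mul_inverse_cancel _ hz

theorem mul_resolvent {T : X →L[ℂ] X} {z : ℂ} (hz : z ∈ resolventSet ℂ T) :
    T * resolvent T z = z • resolvent T z - 1 := by
  have := sub_mul_resolvent hz
  rw [sub_mul, ← Algebra.smul_def] at this
  rw [← this]; abel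

theorem resolvent_mul {T : X →L[ℂ] X} {z : ℂ} (hz : z ∈ resolventSet ℂ T) :
    resolvent T z * T = z • resolvent T z - 1 := by
  have := resolvent_mul_sub hz
  rw [mul_sub, ← Algebra.commutes, ← Algebra.smul_def] at this
  rw [← this]; abel

/-- The factorization `z ^ N (1 - z) - T ^ N (I - T) = (z - T) Q` yields the invertibility of
`z - T` and an estimate of its inverse as soon as `‖T ^ N (I - T)‖` is small compared to
`|z ^ N (1 - z)|`; for a Ritt operator this holds with `N` of order `1 / |1 - z|`, if `|z|` is close
to `1` or larger. -/
theorem resolvent_estimate [CompleteSpace X] {T : X →L[ℂ] X} {M C : ℝ} (hM : ∀ n : ℕ, ‖T ^ n‖ ≤ M)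
    (hC0 : 0 < C) (hC : ∀ n : ℕ, ((n : ℝ) + 1) * ‖T ^ n * (1 - T)‖ ≤ C) {z : ℂ} (hz1 : z ≠ 1)
    (hz : 1 ≤ ‖z‖ + 1 / (2 * (4 * C + 2)) * ‖1 - z‖) :
    z ∈ resolventSet ℂ T ∧ ‖(z - 1) • resolvent T z‖ ≤ 4 * ((4 * C + 3) * M) := by
  have hM0 : 0 ≤ M := (norm_nonneg _).trans (hM 0)
  have hd0 : 0 < ‖1 - z‖ := norm_pos_iff.2 (sub_ne_zero.2 (Ne.symm hz1))
  set d := ‖1 - z‖ with hd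
  set N := ⌈4 * C / d⌉₊ with hN
  have hN1 : 4 * C ≤ N * d := by
    rw [← div_le_iff₀ hd0]; exact Nat.le_ceil _
  have hN2 : N * d ≤ 4 * C + d := by
    have : (N : ℝ) < 4 * C / d + 1 := Nat.ceil_lt_add_one (by positivity)
    calc N * d ≤ (4 * C / d + 1) * d := by gcongr
      _ = _ := by field_simp
  have hN0 : 0 < N := Nat.ceil_pos.2 (by positivity)
  have hdle : d ≤ 1 + ‖z‖ := by
    calc d ≤ ‖(1 : ℂ)‖ + ‖z‖ := norm_sub_le _ _
      _ = _ := by rw [norm_one]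
  have hm : 1 / 2 ≤ ‖z‖ ^ N := by
    rcases le_total 1 ‖z‖ with h | h
    · linarith [one_le_pow₀ h (n := N)]
    · have h1 := one_add_mul_le_pow (a := ‖z‖ - 1) (by linarith [norm_nonneg z]) N
      rw [add_sub_cancel] at h1
      refine le_trans ?_ h1
      have h2 : (N : ℝ) * (1 - ‖z‖) ≤ N * (1 / (2 * (4 * C + 2)) * d) := by
        gcongr; linarith
      have h3 : (N : ℝ) * (1 / (2 * (4 * C + 2)) * d) = (N * d) / (2 * (4 * C + 2)) := by ring
      have h4 : (N * d) / (2 * (4 * C + 2)) ≤ 1 / 2 := by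
        rw [div_le_iff₀ (by positivity)]; linarith
      linarith
  set Z := algebraMap ℂ (X →L[ℂ] X) z with hZ
  have hZT : Commute Z T := Algebra.commutes z T
  set μ := z ^ N * (1 - z) with hμ
  set S := ∑ i ∈ Finset.range N, Z ^ i * T ^ (N - 1 - i) with hS
  set Q := (1 - Z) * S - T ^ N with hQ
  have hfac : algebraMap ℂ (X →L[ℂ] X) μ - T ^ N * (1 - T) = (Z - T) * Q := by
    have h1 : (Z - T) * S = Z ^ N - T ^ N := hZT.mul_geom_sum₂ N
    have h2 : (Z - T) * (1 - Z) = (1 - Z) * (Z - T) :=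
      ((Commute.one_right _).sub_right (((Commute.refl Z).sub_left hZT.symm))).eq
    have h4 : Z ^ N * Z = Z * Z ^ N := ((Commute.refl Z).pow_left N).eq
    have h5 : T ^ N * T = T * T ^ N := ((Commute.refl T).pow_left N).eq
    have h6 : (Z - T) * Q = (1 - Z) * (Z ^ N - T ^ N) - (Z - T) * T ^ N := by
      rw [hQ, mul_sub, ← mul_assoc, h2, mul_assoc, h1]
    rw [h6, hμ, map_mul, map_pow, map_sub, map_one, ← hZ]
    simp only [mul_sub, sub_mul, mul_one, one_mul, h4, h5]
    abel
  have hμn : ‖μ‖ = ‖z‖ ^ N * d := by rw [hμ, norm_mul, norm_pow]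
  have hsmall : ‖T ^ N * (1 - T)‖ ≤ ‖μ‖ / 2 := by
    have h1 := hC N
    have h2 : ((N : ℝ)) * ‖T ^ N * (1 - T)‖ ≤ C := by
      nlinarith [norm_nonneg (T ^ N * (1 - T))]
    have h3 : (0 : ℝ) < N := by exact_mod_cast hN0
    have h4 : (N : ℝ) * ‖T ^ N * (1 - T)‖ ≤ N * (d / 4) := by linarith
    have h5 := le_of_mul_le_mul_left h4 h3
    rw [hμn]
    nlinarith
  have hμ0 : 0 < ‖μ‖ := by rw [hμn]; positivity
  have hunit : IsUnit ((Z - T) * Q) := by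
    rw [← hfac]
    refine spectrum.mem_resolventSet_of_norm_lt_mul ?_
    have : ‖(1 : X →L[ℂ] X)‖ ≤ 1 := ContinuousLinearMap.norm_id_le
    calc _ ≤ ‖T ^ N * (1 - T)‖ * 1 := by gcongr
      _ < _ := by linarith
  have hcomm : Commute (Z - T) Q := by
    have a1 : Commute (Z - T) Z := (Commute.refl Z).sub_left hZT.symm
    have a2 : Commute (Z - T) T := hZT.sub_left (Commute.refl T)
    refine (((Commute.one_right _).sub_right a1).mul_right ?_).sub_right (a2.pow_right N)
    exact Commute.sum_right _ _ _ fun i _ => (a1.pow_right i).mul_right (a2.pow_right _)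
  have hres : z ∈ resolventSet ℂ T := (hcomm.isUnit_mul_iff.1 hunit).1
  refine ⟨hres, ?_⟩
  have hQn : ‖Q‖ ≤ 2 * (‖z‖ ^ N * ((4 * C + 3) * M)) := by
    have hZn : ∀ i, ‖Z ^ i * T ^ (N - 1 - i)‖ ≤ ‖z‖ ^ i * M := by
      intro i
      rw [hZ, ← map_pow, ← Algebra.smul_def, norm_smul, norm_pow]
      gcongr
      exact hM _
    have h1 : ‖Q‖ ≤ d * ∑ i ∈ Finset.range N, ‖z‖ ^ i * M + M := by
      have e : (1 - Z) * S = (1 - z) • S := by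
        rw [hZ, Algebra.smul_def, map_sub, map_one]
      rw [hQ, e]
      refine (norm_sub_le _ _).trans (add_le_add ?_ (hM N))
      rw [norm_smul]
      gcongr
      exact (norm_sum_le _ _).trans (Finset.sum_le_sum fun i _ => hZn i)
    rcases le_total ‖z‖ 1 with h | h
    · have h2 : ∑ i ∈ Finset.range N, ‖z‖ ^ i * M ≤ N * M := by
        refine (Finset.sum_le_card_nsmul _ _ M fun i _ => ?_).trans (by simp)
        exact mul_le_of_le_one_left hM0 (pow_le_one₀ (norm_nonneg _) h)
      calc ‖Q‖ ≤ d * (N * M) + M := by nlinarith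
        _ = (N * d + 1) * M := by ring
        _ ≤ (4 * C + 3) * M := mul_le_mul_of_nonneg_right (by linarith) hM0
        _ = 2 * (1 / 2 * ((4 * C + 3) * M)) := by ring
        _ ≤ _ := by gcongr
    · have h2 : ∑ i ∈ Finset.range N, ‖z‖ ^ i * M ≤ N * (‖z‖ ^ (N - 1) * M) := by
        refine (Finset.sum_le_card_nsmul _ _ (‖z‖ ^ (N - 1) * M) fun i hi => ?_).trans (by simp)
        have := Finset.mem_range.1 hi
        gcongr
        omega
      have h3 : ‖z‖ ^ N = ‖z‖ ^ (N - 1) * ‖z‖ := by rw [← pow_succ, Nat.sub_add_cancel hN0]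
      have h4 : 1 ≤ ‖z‖ ^ (N - 1) := one_le_pow₀ h
      have h5 : N * d ≤ (4 * C + 2) * ‖z‖ := by nlinarith
      have h6 : 1 ≤ ‖z‖ ^ N := one_le_pow₀ h
      calc ‖Q‖ ≤ d * (N * (‖z‖ ^ (N - 1) * M)) + M := by nlinarith
        _ = ‖z‖ ^ (N - 1) * (N * d) * M + M := by ring
        _ ≤ ‖z‖ ^ (N - 1) * ((4 * C + 2) * ‖z‖) * M + ‖z‖ ^ N * M := by
            gcongr
            exact le_mul_of_one_le_left hM0 h6
        _ = ‖z‖ ^ N * ((4 * C + 3) * M) := by rw [h3]; ring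
        _ ≤ _ := by
          have : 0 ≤ ‖z‖ ^ N * ((4 * C + 3) * M) := by positivity
          linarith
  -- From `μ R = Q + R T ^ N (I - T)`, where the last term is absorbed.
  have hR : μ • resolvent T z = Q + resolvent T z * (T ^ N * (1 - T)) := by
    have h1 : resolvent T z * ((Z - T) * Q) = Q := by
      rw [← mul_assoc, resolvent_mul_sub hres, one_mul]
    rw [← hfac, mul_sub, ← Algebra.commutes, ← Algebra.smul_def] at h1
    rw [← h1]; abel
  have h1 : ‖μ‖ * ‖resolvent T z‖ ≤ ‖Q‖ + ‖resolvent T z‖ * (‖μ‖ / 2) := by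
    rw [← norm_smul, hR]
    exact norm_add_le_of_le le_rfl (norm_mul_le_of_le le_rfl hsmall)
  rw [norm_smul, norm_sub_rev, ← hd]
  have h2 : ‖μ‖ * ‖resolvent T z‖ ≤ 4 * (‖z‖ ^ N * ((4 * C + 3) * M)) := by linarith
  rw [hμn] at h2
  have h3 : 0 < ‖z‖ ^ N := by linarith
  refine le_of_mul_le_mul_left (a := ‖z‖ ^ N) ?_ h3
  calc _ = ‖z‖ ^ N * d * ‖resolvent T z‖ := by ring
    _ ≤ _ := h2
    _ = _ := by ring

/-- A Ritt operator is of some type. The resolvent estimate even holds up to the boundary of the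
Stolz domain. -/
theorem exists_type_of_isRitt [CompleteSpace X] {T : X →L[ℂ] X} (hT : IsRitt T) :
    ∃ α C : ℝ, 0 < α ∧ α < Real.pi / 2 ∧ ∀ z : ℂ, z ∉ closure (stolz α) →
      z ∈ resolventSet ℂ T ∧ ‖(z - 1) • resolvent T z‖ ≤ C := by
  obtain ⟨⟨M, hM⟩, C, hC⟩ := hT
  have hC' : ∀ n : ℕ, ((n : ℝ) + 1) * ‖T ^ n * (1 - T)‖ ≤ max C 1 := by
    intro n
    have e : T ^ n * (1 - T) = -(T ^ (n + 1) - T ^ n) := by rw [mul_sub, mul_one, pow_succ]; abel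
    rw [e, norm_neg]
    exact (hC n).trans (le_max_left _ _)
  have hC1 : 1 ≤ max C 1 := le_max_right _ _
  set D := max C 1
  set ε := 1 / (2 * (4 * D + 2)) with hε
  have hε0 : 0 < ε := by positivity
  have hε1 : ε < 1 := by
    rw [hε, div_lt_one (by positivity)]; linarith
  refine ⟨Real.arccos (ε / 2), 4 * ((4 * D + 3) * M), ?_, ?_, fun z hz => ?_⟩
  · rw [Real.arccos_pos]; linarith
  · rw [Real.arccos_lt_pi_div_two]; positivity
  have hcos : Real.cos (Real.arccos (ε / 2)) = ε / 2 := Real.cos_arccos (by linarith) (by linarith)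
  have hsin : 0 < Real.sin (Real.arccos (ε / 2)) := by
    refine Real.sin_pos_of_pos_of_lt_pi (Real.arccos_pos.2 (by linarith)) ?_
    linarith [Real.arccos_lt_pi_div_two.2 (by positivity : 0 < ε / 2), Real.pi_pos]
  have h := mt (mem_closure_stolz_of_norm_lt hε0 hε1.le hsin
    (by rw [hcos, abs_of_pos (by positivity)]; linarith)) hz
  push Not at h
  exact resolvent_estimate hM (by linarith) hC' h.2 h.1

end Resolvent

/-! ### Integration along the boundary of a Stolz domain -/

section Contour

/-- The upper (`σ = 1`) and lower (`σ = -1`) tangency points of the boundary of `B_β`. -/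
def tangencyPt (β σ : ℝ) : ℂ :=
  (Real.sin β : ℂ) * Complex.exp (((σ * (Real.pi / 2 - β) : ℝ) : ℂ) * Complex.I)

/-- Parametrizations of the three pieces of the boundary of `B_β`. -/
def bdryPath (β : ℝ) : Fin 3 → ℝ → ℂ :=
  ![fun t => 1 + (t : ℂ) * (tangencyPt β 1 - 1),
    fun θ => (Real.sin β : ℂ) * Complex.exp (θ * Complex.I),
    fun t => tangencyPt β (-1) + (t : ℂ) * (1 - tangencyPt β (-1))]

/-- The derivatives of the parametrizations `bdryPath`. -/
def bdryVel (β : ℝ) : Fin 3 → ℝ → ℂ :=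
  ![fun _ => tangencyPt β 1 - 1,
    fun θ => (Real.sin β : ℂ) * Complex.I * Complex.exp (θ * Complex.I),
    fun _ => 1 - tangencyPt β (-1)]

/-- The initial parameters of the pieces of the boundary of `B_β`. -/
def bdryLo (β : ℝ) : Fin 3 → ℝ := ![0, Real.pi / 2 - β, 0]

/-- The final parameters of the pieces of the boundary of `B_β`. -/
def bdryHi (β : ℝ) : Fin 3 → ℝ := ![1, 2 * Real.pi - (Real.pi / 2 - β), 1]

variable {E : Type*} [NormedAddCommGroup E] [NormedSpace ℂ E]

theorem stolzBoundaryIntegral_eq_sum (f : ℂ → E) (β : ℝ) :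
    stolzBoundaryIntegral f β =
      ∑ i, ∫ t in bdryLo β i..bdryHi β i, bdryVel β i t • f (bdryPath β i t) := by
  simp only [Fin.sum_univ_three, bdryLo, bdryHi, bdryVel, bdryPath, stolzBoundaryIntegral,
    segmentIntegral, arcIntegral, tangencyPt, Matrix.cons_val_zero, Matrix.cons_val_one,
    Matrix.cons_val, one_mul, neg_one_mul]

theorem bdryLo_le_bdryHi {β : ℝ} (hβ0 : 0 < β) (i : Fin 3) :
    bdryLo β i ≤ bdryHi β i := by
  have := Real.pi_pos
  fin_cases i <;> (simp [bdryLo, bdryHi]; try linarith)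

theorem stolzBoundaryIntegral_eq_sum_Ioo (f : ℂ → E) {β : ℝ} (hβ0 : 0 < β) :
    stolzBoundaryIntegral f β =
      ∑ i, ∫ t in Set.Ioo (bdryLo β i) (bdryHi β i), bdryVel β i t • f (bdryPath β i t) := by
  rw [stolzBoundaryIntegral_eq_sum]
  refine Finset.sum_congr rfl fun i _ => ?_
  rw [intervalIntegral.integral_of_le (bdryLo_le_bdryHi hβ0 i), integral_Ioc_eq_integral_Ioo]

theorem hasDerivAt_bdryPath (β : ℝ) (i : Fin 3) (t : ℝ) :
    HasDerivAt (bdryPath β i) (bdryVel β i t) t := by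
  have h1 : HasDerivAt (fun t : ℝ => (t : ℂ)) 1 t := Complex.ofRealCLM.hasDerivAt
  fin_cases i
  · simpa [bdryPath, bdryVel] using (h1.mul_const (tangencyPt β 1 - 1)).const_add 1
  · have h2 := ((h1.mul_const Complex.I).cexp).const_mul (Real.sin β : ℂ)
    convert! h2 using 1
    simp only [bdryVel]
    simp
    ring
  · simpa [bdryPath, bdryVel] using
      (h1.mul_const (1 - tangencyPt β (-1))).const_add (tangencyPt β (-1))

theorem continuous_bdryPath (β : ℝ) (i : Fin 3) : Continuous (bdryPath β i) :=
  continuous_iff_continuousAt.2 fun t => (hasDerivAt_bdryPath β i t).continuousAt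

theorem continuous_bdryVel (β : ℝ) (i : Fin 3) : Continuous (bdryVel β i) := by
  fin_cases i
  · exact continuous_const
  · simp only [bdryVel]
    change Continuous fun θ : ℝ => (Real.sin β : ℂ) * Complex.I * Complex.exp (θ * Complex.I)
    fun_prop
  · exact continuous_const

theorem tangencyPt_re {β σ : ℝ} (hσ : σ = 1 ∨ σ = -1) : (tangencyPt β σ).re = Real.sin β ^ 2 := by
  rw [tangencyPt, Complex.re_ofReal_mul, Complex.exp_ofReal_mul_I_re]
  rcases hσ with rfl | rfl
  · rw [one_mul, Real.cos_pi_div_two_sub]; ring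
  · rw [neg_one_mul, Real.cos_neg, Real.cos_pi_div_two_sub]; ring

theorem tangencyPt_im {β σ : ℝ} (hσ : σ = 1 ∨ σ = -1) :
    (tangencyPt β σ).im = σ * Real.cos β * Real.sin β := by
  rw [tangencyPt, Complex.im_ofReal_mul, Complex.exp_ofReal_mul_I_im]
  rcases hσ with rfl | rfl
  · rw [one_mul, Real.sin_pi_div_two_sub]; ring
  · rw [neg_one_mul, Real.sin_neg, Real.sin_pi_div_two_sub]; ring

theorem norm_one_sub_tangencyPt {β σ : ℝ} (hσ : σ = 1 ∨ σ = -1) (hβ : 0 ≤ Real.cos β) :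
    ‖1 - tangencyPt β σ‖ = Real.cos β := by
  rw [← abs_of_nonneg hβ, ← abs_norm, ← sq_eq_sq_iff_abs_eq_abs, Complex.sq_norm,
    Complex.normSq_apply, Complex.sub_re, Complex.sub_im, tangencyPt_re hσ, tangencyPt_im hσ,
    Complex.one_re, Complex.one_im]
  have h := Real.sin_sq_add_cos_sq β
  have h2 : Real.sin β ^ 2 = 1 - Real.cos β ^ 2 := by linarith
  have hσ2 : σ ^ 2 = 1 := by rcases hσ with rfl | rfl <;> norm_num
  calc _ = (1 - Real.sin β ^ 2) ^ 2 + σ ^ 2 * Real.cos β ^ 2 * Real.sin β ^ 2 := by ring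
    _ = _ := by rw [hσ2, h2]; ring

theorem lineFromOne_mem_stolzBdry {β σ t : ℝ} (hσ : σ = 1 ∨ σ = -1) (hβ : 0 ≤ Real.sin β)
    (ht0 : 0 ≤ t) (ht1 : t ≤ 1) :
    (1 : ℂ) - t * (1 - tangencyPt β σ) ∈ stolzBdry β := by
  have hσ2 : σ ^ 2 = 1 := by rcases hσ with rfl | rfl <;> norm_num
  refine segment_mem_stolzBdry hβ hσ2 ht0 ht1 ?_ ?_
  · rw [Complex.sub_re, Complex.re_ofReal_mul, Complex.sub_re, tangencyPt_re hσ, Complex.one_re]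
    have h := Real.sin_sq_add_cos_sq β
    have h2 : Real.sin β ^ 2 = 1 - Real.cos β ^ 2 := by linarith
    rw [h2]; ring
  · rw [Complex.sub_im, Complex.im_ofReal_mul, Complex.sub_im, tangencyPt_im hσ, Complex.one_im]
    ring

theorem bdryPath_zero (β t : ℝ) : bdryPath β 0 t = 1 - t * (1 - tangencyPt β 1) := by
  simp only [bdryPath, Matrix.cons_val_zero]; ring

theorem bdryPath_two (β t : ℝ) :
    bdryPath β 2 t = 1 - ((1 - t : ℝ) : ℂ) * (1 - tangencyPt β (-1)) := by
  simp only [bdryPath, Matrix.cons_val]; push_cast; ring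

theorem cos_le_sin_of_mem_arc {β θ : ℝ} (hβ : β < Real.pi / 2)
    (h1 : Real.pi / 2 - β ≤ θ) (h2 : θ ≤ 2 * Real.pi - (Real.pi / 2 - β)) :
    Real.cos θ ≤ Real.sin β := by
  rw [← Real.cos_pi_div_two_sub]
  rcases le_total θ Real.pi with h | h
  · exact Real.cos_le_cos_of_nonneg_of_le_pi (by linarith) h h1
  · rw [← Real.cos_two_pi_sub θ]
    exact Real.cos_le_cos_of_nonneg_of_le_pi (by linarith) (by linarith) (by linarith)

theorem bdryPath_mem {β : ℝ} (hβ0 : 0 < β) (hβ : β < Real.pi / 2) (i : Fin 3) {t : ℝ}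
    (ht : t ∈ Set.Icc (bdryLo β i) (bdryHi β i)) : bdryPath β i t ∈ stolzBdry β := by
  have hs : 0 ≤ Real.sin β := (Real.sin_pos_of_pos_of_lt_pi hβ0 (by linarith)).le
  obtain ⟨h1, h2⟩ := ht
  fin_cases i
  · simp [bdryLo, bdryHi] at h1 h2
    change bdryPath β 0 t ∈ _
    rw [bdryPath_zero]
    exact lineFromOne_mem_stolzBdry (Or.inl rfl) hs h1 h2
  · exact arc_mem_stolzBdry hs (cos_le_sin_of_mem_arc hβ h1 h2)
  · simp [bdryLo, bdryHi] at h1 h2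
    change bdryPath β 2 t ∈ _
    rw [bdryPath_two]
    exact lineFromOne_mem_stolzBdry (Or.inr rfl) hs (by linarith) (by linarith)

theorem norm_one_sub_bdryPath_zero {β t : ℝ} (hβ : 0 ≤ Real.cos β) (ht : 0 ≤ t) :
    ‖1 - bdryPath β 0 t‖ = t * Real.cos β := by
  rw [bdryPath_zero, sub_sub_cancel, norm_mul, Complex.norm_real, Real.norm_of_nonneg ht,
    norm_one_sub_tangencyPt (Or.inl rfl) hβ]

theorem norm_one_sub_bdryPath_two {β t : ℝ} (hβ : 0 ≤ Real.cos β) (ht : t ≤ 1) :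
    ‖1 - bdryPath β 2 t‖ = (1 - t) * Real.cos β := by
  rw [bdryPath_two, sub_sub_cancel, norm_mul, Complex.norm_real, Real.norm_of_nonneg (by linarith),
    norm_one_sub_tangencyPt (Or.inr rfl) hβ]

theorem norm_bdryPath_one {β : ℝ} (hβ : 0 ≤ Real.sin β) (t : ℝ) :
    ‖bdryPath β 1 t‖ = Real.sin β := by
  change ‖(Real.sin β : ℂ) * Complex.exp (t * Complex.I)‖ = _
  rw [norm_mul, Complex.norm_exp_ofReal_mul_I, Complex.norm_real, Real.norm_of_nonneg hβ, mul_one]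

theorem sin_lt_one {β : ℝ} (hβ0 : 0 < β) (hβ : β < Real.pi / 2) : Real.sin β < 1 := by
  rw [← Real.sin_pi_div_two]
  exact Real.sin_lt_sin_of_lt_of_le_pi_div_two (by linarith [Real.pi_pos]) le_rfl hβ

theorem bdryPath_ne_one {β : ℝ} (hβ0 : 0 < β) (hβ : β < Real.pi / 2) (i : Fin 3) {t : ℝ}
    (ht : t ∈ Set.Ioo (bdryLo β i) (bdryHi β i)) : bdryPath β i t ≠ 1 := by
  have hs : 0 < Real.sin β := Real.sin_pos_of_pos_of_lt_pi hβ0 (by linarith)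
  have hc : 0 < Real.cos β := Real.cos_pos_of_mem_Ioo ⟨by linarith, hβ⟩
  obtain ⟨h1, h2⟩ := ht
  intro h
  fin_cases i
  · simp [bdryLo, bdryHi] at h1 h2
    have := norm_one_sub_bdryPath_zero hc.le h1.le
    change bdryPath β 0 t = 1 at h
    rw [h, sub_self, norm_zero] at this
    nlinarith
  · have := norm_bdryPath_one hs.le t
    change bdryPath β 1 t = 1 at h
    rw [h, norm_one] at this
    linarith [sin_lt_one hβ0 hβ]
  · simp [bdryLo, bdryHi] at h1 h2
    have := norm_one_sub_bdryPath_two hc.le h2.le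
    change bdryPath β 2 t = 1 at h
    rw [h, sub_self, norm_zero] at this
    nlinarith

theorem integrableOn_norm_one_sub_bdryPath {β q : ℝ} (hβ0 : 0 < β) (hβ : β < Real.pi / 2)
    (hq : -1 < q) (i : Fin 3) :
    IntegrableOn (fun t => ‖1 - bdryPath β i t‖ ^ q) (Set.Ioo (bdryLo β i) (bdryHi β i)) := by
  have hs : 0 < Real.sin β := Real.sin_pos_of_pos_of_lt_pi hβ0 (by linarith)
  have hc : 0 < Real.cos β := Real.cos_pos_of_mem_Ioo ⟨by linarith, hβ⟩
  have h0 : IntegrableOn (fun t : ℝ => t ^ q) (Set.Ioo 0 1) :=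
    (intervalIntegral.intervalIntegrable_rpow' hq).1.mono_set Set.Ioo_subset_Ioc_self
  have h0' : IntegrableOn (fun t : ℝ => (1 - t) ^ q) (Set.Ioo 0 1) := by
    have h := (intervalIntegral.intervalIntegrable_rpow' (a := 0) (b := 1) hq).comp_sub_left 1
    simp only [sub_zero, sub_self] at h
    exact h.symm.1.mono_set Set.Ioo_subset_Ioc_self
  fin_cases i
  · simp only [bdryLo, bdryHi]
    have h2 : IntegrableOn (fun t : ℝ => t ^ q * Real.cos β ^ q) (Set.Ioo 0 1) :=
      Integrable.mul_const h0 _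
    refine h2.congr_fun (fun t ht => ?_) measurableSet_Ioo
    have h1 : 0 < t := ht.1
    change _ = ‖1 - bdryPath β 0 t‖ ^ q
    rw [norm_one_sub_bdryPath_zero hc.le h1.le, Real.mul_rpow h1.le hc.le]
  · have hcont : Continuous (fun t => ‖1 - bdryPath β 1 t‖ ^ q) := by
      refine (continuous_const.sub (continuous_bdryPath β 1)).norm.rpow_const fun t => Or.inl ?_
      have h1 : bdryPath β 1 t ≠ 1 := by
        intro h
        have := norm_bdryPath_one hs.le t
        rw [h, norm_one] at this
        linarith [sin_lt_one hβ0 hβ]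
      exact (norm_pos_iff.2 (sub_ne_zero.2 h1.symm)).ne'
    exact (hcont.integrableOn_Icc).mono_set Set.Ioo_subset_Icc_self
  · simp only [bdryLo, bdryHi]
    have h2 : IntegrableOn (fun t : ℝ => (1 - t) ^ q * Real.cos β ^ q) (Set.Ioo 0 1) :=
      Integrable.mul_const h0' _
    refine h2.congr_fun (fun t ht => ?_) measurableSet_Ioo
    have h1 : t < 1 := ht.2
    change _ = ‖1 - bdryPath β 2 t‖ ^ q
    rw [norm_one_sub_bdryPath_two hc.le h1.le, Real.mul_rpow (by linarith) hc.le]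

theorem exists_norm_bdryVel_le (β : ℝ) : ∃ V : ℝ, 0 ≤ V ∧ ∀ i t, ‖bdryVel β i t‖ ≤ V := by
  refine ⟨‖tangencyPt β 1 - 1‖ + |Real.sin β| + ‖1 - tangencyPt β (-1)‖, by positivity,
    fun i t => ?_⟩
  fin_cases i
  · change ‖tangencyPt β 1 - 1‖ ≤ _
    linarith [abs_nonneg (Real.sin β), norm_nonneg (1 - tangencyPt β (-1))]
  · change ‖(Real.sin β : ℂ) * Complex.I * Complex.exp (t * Complex.I)‖ ≤ _
    rw [norm_mul, norm_mul, Complex.norm_exp_ofReal_mul_I, Complex.norm_real, Complex.norm_I,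
      mul_one, mul_one, Real.norm_eq_abs]
    linarith [norm_nonneg (tangencyPt β 1 - 1), norm_nonneg (1 - tangencyPt β (-1))]
  · change ‖1 - tangencyPt β (-1)‖ ≤ _
    linarith [abs_nonneg (Real.sin β), norm_nonneg (tangencyPt β 1 - 1)]

theorem aestronglyMeasurable_bdry {β : ℝ} (hβ0 : 0 < β) (hβ : β < Real.pi / 2) {f : ℂ → E}
    (hf : ContinuousOn f (stolzBdry β \ {1})) (i : Fin 3) :
    AEStronglyMeasurable (fun t => bdryVel β i t • f (bdryPath β i t))
      (volume.restrict (Set.Ioo (bdryLo β i) (bdryHi β i))) := by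
  refine ContinuousOn.aestronglyMeasurable ?_ measurableSet_Ioo
  refine (continuous_bdryVel β i).continuousOn.smul
    (hf.comp (continuous_bdryPath β i).continuousOn fun t ht => ?_)
  exact ⟨bdryPath_mem hβ0 hβ i (Set.Ioo_subset_Icc_self ht), bdryPath_ne_one hβ0 hβ i ht⟩

/-- The integrands of interest are only controlled by a power of `|1 - z|` at the vertex `1`, and
an exponent `q > -1` is what integrability requires. -/
theorem integrableOn_bdry {β q B : ℝ} (hβ0 : 0 < β) (hβ : β < Real.pi / 2) (hq : -1 < q) {f : ℂ → E}
    (hf : ContinuousOn f (stolzBdry β \ {1}))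
    (hB : ∀ z ∈ stolzBdry β \ {1}, ‖f z‖ ≤ B * ‖1 - z‖ ^ q) (i : Fin 3) :
    IntegrableOn (fun t => bdryVel β i t • f (bdryPath β i t))
      (Set.Ioo (bdryLo β i) (bdryHi β i)) := by
  obtain ⟨V, hV0, hV⟩ := exists_norm_bdryVel_le β
  refine Integrable.mono' (((integrableOn_norm_one_sub_bdryPath hβ0 hβ hq i).const_mul B).const_mul V)
    (aestronglyMeasurable_bdry hβ0 hβ hf i) ?_
  refine ae_restrict_of_forall_mem measurableSet_Ioo fun t ht => ?_
  rw [norm_smul]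
  have := hB _ ⟨bdryPath_mem hβ0 hβ i (Set.Ioo_subset_Icc_self ht), bdryPath_ne_one hβ0 hβ i ht⟩
  exact mul_le_mul (hV i t) this (norm_nonneg _) hV0

theorem tendsto_stolzBoundaryIntegral {ι : Type*} {l : Filter ι} [l.IsCountablyGenerated]
    {β q B : ℝ} (hβ0 : 0 < β) (hβ : β < Real.pi / 2) (hq : -1 < q) {F : ι → ℂ → E} {f : ℂ → E}
    (hF : ∀ᶠ n in l, ContinuousOn (F n) (stolzBdry β \ {1}))
    (hB : ∀ᶠ n in l, ∀ z ∈ stolzBdry β \ {1}, ‖F n z‖ ≤ B * ‖1 - z‖ ^ q)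
    (hlim : ∀ z ∈ stolzBdry β \ {1}, Tendsto (fun n => F n z) l (𝓝 (f z))) :
    Tendsto (fun n => stolzBoundaryIntegral (F n) β) l (𝓝 (stolzBoundaryIntegral f β)) := by
  simp only [stolzBoundaryIntegral_eq_sum_Ioo _ hβ0]
  obtain ⟨V, hV0, hV⟩ := exists_norm_bdryVel_le β
  have hmem : ∀ i, ∀ t ∈ Set.Ioo (bdryLo β i) (bdryHi β i), bdryPath β i t ∈ stolzBdry β \ {1} :=
    fun i t ht => ⟨bdryPath_mem hβ0 hβ i (Set.Ioo_subset_Icc_self ht), bdryPath_ne_one hβ0 hβ i ht⟩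
  refine tendsto_finsetSum _ fun i _ => ?_
  refine tendsto_integral_filter_of_dominated_convergence
    (fun t => V * (B * ‖1 - bdryPath β i t‖ ^ q)) ?_ ?_ ?_ ?_
  · filter_upwards [hF] with n hn
    exact aestronglyMeasurable_bdry hβ0 hβ hn i
  · filter_upwards [hB] with n hn
    refine ae_restrict_of_forall_mem measurableSet_Ioo fun t ht => ?_
    rw [norm_smul]
    exact mul_le_mul (hV i t) (hn _ (hmem i t ht)) (norm_nonneg _) hV0
  · exact ((integrableOn_norm_one_sub_bdryPath hβ0 hβ hq i).const_mul B).const_mul V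
  · refine ae_restrict_of_forall_mem measurableSet_Ioo fun t ht => ?_
    exact (hlim _ (hmem i t ht)).const_smul _

theorem stolzBoundaryIntegral_congr {β : ℝ} (hβ0 : 0 < β) (hβ : β < Real.pi / 2) {f g : ℂ → E}
    (h : ∀ z ∈ stolzBdry β \ {1}, f z = g z) :
    stolzBoundaryIntegral f β = stolzBoundaryIntegral g β := by
  simp only [stolzBoundaryIntegral_eq_sum_Ioo _ hβ0]
  refine Finset.sum_congr rfl fun i _ => setIntegral_congr_fun measurableSet_Ioo fun t ht => ?_
  rw [h _ ⟨bdryPath_mem hβ0 hβ i (Set.Ioo_subset_Icc_self ht), bdryPath_ne_one hβ0 hβ i ht⟩]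

theorem stolzBoundaryIntegral_add {β q B B' : ℝ} (hβ0 : 0 < β) (hβ : β < Real.pi / 2) (hq : -1 < q)
    {f g : ℂ → E} (hf : ContinuousOn f (stolzBdry β \ {1}))
    (hB : ∀ z ∈ stolzBdry β \ {1}, ‖f z‖ ≤ B * ‖1 - z‖ ^ q)
    (hg : ContinuousOn g (stolzBdry β \ {1}))
    (hB' : ∀ z ∈ stolzBdry β \ {1}, ‖g z‖ ≤ B' * ‖1 - z‖ ^ q) :
    stolzBoundaryIntegral (fun z => f z + g z) β =
      stolzBoundaryIntegral f β + stolzBoundaryIntegral g β := by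
  simp only [stolzBoundaryIntegral_eq_sum_Ioo _ hβ0, ← Finset.sum_add_distrib, smul_add]
  exact Finset.sum_congr rfl fun i _ => integral_add (integrableOn_bdry hβ0 hβ hq hf hB i)
    (integrableOn_bdry hβ0 hβ hq hg hB' i)

/-- Bounded operators commute with the integral along the boundary. -/
theorem map_stolzBoundaryIntegral {F : Type*} [NormedAddCommGroup F] [NormedSpace ℂ F]
    [CompleteSpace E] [CompleteSpace F] (L : E →L[ℂ] F) {β q B : ℝ} (hβ0 : 0 < β)
    (hβ : β < Real.pi / 2) (hq : -1 < q)
    {f : ℂ → E} (hf : ContinuousOn f (stolzBdry β \ {1}))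
    (hB : ∀ z ∈ stolzBdry β \ {1}, ‖f z‖ ≤ B * ‖1 - z‖ ^ q) :
    stolzBoundaryIntegral (fun z => L (f z)) β = L (stolzBoundaryIntegral f β) := by
  simp only [stolzBoundaryIntegral_eq_sum_Ioo _ hβ0, map_sum]
  refine Finset.sum_congr rfl fun i _ => ?_
  rw [← L.integral_comp_comm (integrableOn_bdry hβ0 hβ hq hf hB i)]
  exact setIntegral_congr_fun measurableSet_Ioo fun t _ => (L.map_smul _ _).symm

theorem stolzBoundaryIntegral_smul_const [CompleteSpace E] (f : ℂ → ℂ) (x : E) (β : ℝ) :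
    stolzBoundaryIntegral (fun z => f z • x) β = stolzBoundaryIntegral f β • x := by
  rw [stolzBoundaryIntegral_eq_sum, stolzBoundaryIntegral_eq_sum, Finset.sum_smul]
  refine Finset.sum_congr rfl fun i _ => ?_
  rw [← intervalIntegral.integral_smul_const]
  simp only [smul_assoc]

/-- The integral of a derivative along the closed boundary curve vanishes. -/
theorem stolzBoundaryIntegral_eq_zero_of_hasDerivAt [CompleteSpace E] {β : ℝ} (hβ0 : 0 < β)
    (hβ : β < Real.pi / 2) {F f : ℂ → E} (hF : ∀ z ∈ stolzBdry β, HasDerivAt F (f z) z)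
    (hf : ContinuousOn f (stolzBdry β)) : stolzBoundaryIntegral f β = 0 := by
  have hpiece : ∀ i, ∫ t in bdryLo β i..bdryHi β i, bdryVel β i t • f (bdryPath β i t) =
      F (bdryPath β i (bdryHi β i)) - F (bdryPath β i (bdryLo β i)) := by
    intro i
    have hle := bdryLo_le_bdryHi hβ0 i
    refine intervalIntegral.integral_eq_sub_of_hasDerivAt (f := F ∘ bdryPath β i) (fun t ht => ?_) ?_
    · rw [Set.uIcc_of_le hle] at ht
      exact (hF _ (bdryPath_mem hβ0 hβ i ht)).scomp t (hasDerivAt_bdryPath β i t)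
    · refine ContinuousOn.intervalIntegrable ?_
      rw [Set.uIcc_of_le hle]
      exact (continuous_bdryVel β i).continuousOn.smul
        (hf.comp (continuous_bdryPath β i).continuousOn fun t ht => bdryPath_mem hβ0 hβ i ht)
  have e1 : bdryPath β 0 (bdryLo β 0) = 1 := by simp [bdryPath, bdryLo]
  have e2 : bdryPath β 0 (bdryHi β 0) = tangencyPt β 1 := by simp [bdryPath, bdryHi]
  have e3 : bdryPath β 1 (bdryLo β 1) = tangencyPt β 1 := by
    simp [bdryPath, bdryLo, tangencyPt]
  have e4 : bdryPath β 1 (bdryHi β 1) = tangencyPt β (-1) := by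
    simp only [bdryPath, bdryHi, tangencyPt, Matrix.cons_val_one, Matrix.cons_val_zero]
    congr 1
    rw [Complex.exp_eq_exp_iff_exists_int]
    exact ⟨1, by push_cast; ring⟩
  have e5 : bdryPath β 2 (bdryLo β 2) = tangencyPt β (-1) := by simp [bdryPath, bdryLo]
  have e6 : bdryPath β 2 (bdryHi β 2) = 1 := by simp [bdryPath, bdryHi]
  rw [stolzBoundaryIntegral_eq_sum, Fin.sum_univ_three, hpiece, hpiece, hpiece, e1, e2, e3, e4, e5, e6]
  abel

theorem stolzBoundaryIntegral_const [CompleteSpace E] {β : ℝ} (hβ0 : 0 < β)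
    (hβ : β < Real.pi / 2) (x : E) : stolzBoundaryIntegral (fun _ => x) β = 0 :=
  stolzBoundaryIntegral_eq_zero_of_hasDerivAt (F := fun z : ℂ => z • x) hβ0 hβ
    (fun z _ => by simpa using (hasDerivAt_id z).smul_const x) continuousOn_const

/-- The winding number of the boundary of `B_β` around `0`. -/
theorem stolzBoundaryIntegral_inv {β : ℝ} (hβ0 : 0 < β) (hβ : β < Real.pi / 2) :
    stolzBoundaryIntegral (fun z : ℂ => z⁻¹) β = 2 * Real.pi * Complex.I := by
  have hs : 0 < Real.sin β := Real.sin_pos_of_pos_of_lt_pi hβ0 (by linarith)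
  have hpi := Real.pi_pos
  have hseg : ∀ i : Fin 3,
      (∀ t ∈ Set.Icc (bdryLo β i) (bdryHi β i), bdryPath β i t ∈ Complex.slitPlane) →
      ∫ t in bdryLo β i..bdryHi β i, bdryVel β i t • (bdryPath β i t)⁻¹ =
        Complex.log (bdryPath β i (bdryHi β i)) - Complex.log (bdryPath β i (bdryLo β i)) := by
    intro i hi
    have hle := bdryLo_le_bdryHi hβ0 i
    refine intervalIntegral.integral_eq_sub_of_hasDerivAt (f := Complex.log ∘ bdryPath β i)
      (fun t ht => ?_) ?_
    · rw [Set.uIcc_of_le hle] at ht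
      exact (Complex.hasDerivAt_log (hi t ht)).scomp t (hasDerivAt_bdryPath β i t)
    · refine ContinuousOn.intervalIntegrable ?_
      rw [Set.uIcc_of_le hle]
      exact (continuous_bdryVel β i).continuousOn.smul
        ((continuous_bdryPath β i).continuousOn.inv₀ fun t ht => Complex.slitPlane_ne_zero (hi t ht))
  have hslit : ∀ (σ t : ℝ), (σ = 1 ∨ σ = -1) → 0 ≤ t → t ≤ 1 →
      (1 : ℂ) - t * (1 - tangencyPt β σ) ∈ Complex.slitPlane := by
    intro σ t hσ h0 h1
    left
    rw [Complex.sub_re, Complex.re_ofReal_mul, Complex.sub_re, tangencyPt_re hσ, Complex.one_re]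
    have : Real.sin β ^ 2 ≤ 1 := by nlinarith [Real.sin_le_one β]
    nlinarith [pow_pos hs 2]
  have hlog : ∀ σ : ℝ, (σ = 1 ∨ σ = -1) → Complex.log (tangencyPt β σ) =
      Real.log (Real.sin β) + (σ * (Real.pi / 2 - β) : ℝ) * Complex.I := by
    intro σ hσ
    rw [tangencyPt, Complex.log_ofReal_mul hs (Complex.exp_ne_zero _), Complex.log_exp]
    · rw [Complex.mul_I_im, Complex.ofReal_re]; rcases hσ with rfl | rfl <;> linarith
    · rw [Complex.mul_I_im, Complex.ofReal_re]; rcases hσ with rfl | rfl <;> linarith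
  have harc : ∫ t in bdryLo β 1..bdryHi β 1, bdryVel β 1 t • (bdryPath β 1 t)⁻¹ =
      ((bdryHi β 1 - bdryLo β 1 : ℝ) : ℂ) * Complex.I := by
    have : ∀ t : ℝ, bdryVel β 1 t • (bdryPath β 1 t)⁻¹ = Complex.I := by
      intro t
      change ((Real.sin β : ℂ) * Complex.I * Complex.exp (t * Complex.I)) •
        ((Real.sin β : ℂ) * Complex.exp (t * Complex.I))⁻¹ = _
      have h1 : (Real.sin β : ℂ) ≠ 0 := by exact_mod_cast hs.ne'
      have h2 := Complex.exp_ne_zero (t * Complex.I)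
      rw [smul_eq_mul]
      field_simp
    simp only [this]
    rw [intervalIntegral.integral_const, Complex.real_smul]
  rw [stolzBoundaryIntegral_eq_sum, Fin.sum_univ_three, harc, hseg 0, hseg 2]
  · have e1 : bdryPath β 0 (bdryLo β 0) = 1 := by simp [bdryPath, bdryLo]
    have e2 : bdryPath β 0 (bdryHi β 0) = tangencyPt β 1 := by simp [bdryPath, bdryHi]
    have e5 : bdryPath β 2 (bdryLo β 2) = tangencyPt β (-1) := by simp [bdryPath, bdryLo]
    have e6 : bdryPath β 2 (bdryHi β 2) = 1 := by simp [bdryPath, bdryHi]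
    rw [e1, e2, e5, e6, hlog 1 (Or.inl rfl), hlog (-1) (Or.inr rfl), Complex.log_one]
    simp only [bdryLo, bdryHi, Matrix.cons_val_one, Matrix.cons_val_zero]
    push_cast
    ring
  · intro t ht
    simp [bdryLo, bdryHi] at ht
    rw [bdryPath_two]
    exact hslit _ _ (Or.inr rfl) (by linarith [ht.2]) (by linarith [ht.1])
  · intro t ht
    simp [bdryLo, bdryHi] at ht
    rw [bdryPath_zero]
    exact hslit _ _ (Or.inl rfl) ht.1 ht.2

/-- Cauchy's theorem for bounded holomorphic functions on a larger Stolz domain. -/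
theorem stolzBoundaryIntegral_eq_zero {β γ M : ℝ} (hβ0 : 0 < β) (hβ : β < Real.pi / 2)
    (hβγ : Real.sin β < Real.sin γ) {φ : ℂ → ℂ} (hφ : DifferentiableOn ℂ φ (stolz γ))
    (hM : ∀ z ∈ stolz γ, ‖φ z‖ ≤ M) : stolzBoundaryIntegral φ β = 0 := by
  have hs : 0 < Real.sin β := Real.sin_pos_of_pos_of_lt_pi hβ0 (by linarith)
  obtain ⟨G, hG⟩ := (convex_stolz γ).exists_forall_hasDerivWithinAt hφ
  have hG' : ∀ z ∈ stolz γ, HasDerivAt G (φ z) z := fun z hz =>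
    (hG z hz).hasDerivAt ((isOpen_stolz γ).mem_nhds hz)
  have hev : ∀ᶠ r : ℝ in 𝓝[<] 1, 0 < r ∧ r < 1 := by
    filter_upwards [Ioo_mem_nhdsLT (zero_lt_one' ℝ)] with r hr using hr
  have hzero : ∀ r : ℝ, 0 < r → r < 1 → stolzBoundaryIntegral (fun z => φ (r * z)) β = 0 := by
    intro r h0 h1
    have hmem : ∀ z ∈ stolzBdry β, (r : ℂ) * z ∈ stolz γ := fun z hz =>
      mul_mem_stolz hs.le hβγ h0.le h1.le hz (Or.inl h1)
    refine stolzBoundaryIntegral_eq_zero_of_hasDerivAt (F := fun z => (r : ℂ)⁻¹ * G (r * z)) hβ0 hβ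
      (fun z hz => ?_) ?_
    · have h2 := ((hG' _ (hmem z hz)).comp z ((hasDerivAt_id z).const_mul (r : ℂ))).const_mul (r : ℂ)⁻¹
      have hr : (r : ℂ) ≠ 0 := by exact_mod_cast h0.ne'
      have e : (r : ℂ)⁻¹ * (φ (r * z) * (r * 1)) = φ (r * z) := by
        field_simp
      rw [e] at h2
      exact h2
    · exact hφ.continuousOn.comp (by fun_prop) hmem
  have hlim : Tendsto (fun r : ℝ => stolzBoundaryIntegral (fun z => φ (r * z)) β) (𝓝[<] 1)
      (𝓝 (stolzBoundaryIntegral φ β)) := by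
    refine tendsto_stolzBoundaryIntegral (q := 0) (B := M) hβ0 hβ (by norm_num) ?_ ?_ fun z hz => ?_
    · filter_upwards [hev] with r hr
      exact hφ.continuousOn.comp (by fun_prop) fun z hz =>
        mul_mem_stolz hs.le hβγ hr.1.le hr.2.le hz.1 (Or.inl hr.2)
    · filter_upwards [hev] with r hr z hz
      rw [Real.rpow_zero, mul_one]
      exact hM _ (mul_mem_stolz hs.le hβγ hr.1.le hr.2.le hz.1 (Or.inl hr.2))
    · have h1 : Tendsto (fun r : ℝ => (r : ℂ) * z) (𝓝[<] 1) (𝓝 z) := by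
        have : Tendsto (fun r : ℝ => (r : ℂ) * z) (𝓝 1) (𝓝 (((1 : ℝ) : ℂ) * z)) :=
          (Continuous.tendsto (by fun_prop) 1)
        rw [Complex.ofReal_one, one_mul] at this
        exact this.mono_left nhdsWithin_le_nhds
      have hz' := mem_stolz_of_mem_stolzBdry hs.le hβγ hz.1 (by simpa using hz.2)
      exact ((hφ.continuousOn.continuousAt ((isOpen_stolz γ).mem_nhds hz')).tendsto).comp h1
  refine tendsto_nhds_unique hlim (tendsto_const_nhds.congr' ?_)
  filter_upwards [hev] with r hr
  exact (hzero r hr.1 hr.2).symm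

end Contour

/-! ### The functional calculus -/

section Calculus

variable {X : Type*} [NormedAddCommGroup X] [NormedSpace ℂ X]

/-- `T` has its spectrum in the closure of `B_α`, and `(z - 1) R(z, T)` is bounded by `C` on the
whole complement of this closure. -/
def HasStolzResolventBound (T : X →L[ℂ] X) (α C : ℝ) : Prop :=
  ∀ z : ℂ, z ∉ closure (stolz α) → z ∈ resolventSet ℂ T ∧ ‖(z - 1) • resolvent T z‖ ≤ C

theorem sin_lt_sin {α β : ℝ} (hα0 : 0 < α) (hαβ : α < β) (hβ : β < Real.pi / 2) :
    Real.sin α < Real.sin β :=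
  Real.sin_lt_sin_of_lt_of_le_pi_div_two (by linarith [Real.pi_pos]) hβ.le hαβ

theorem sin_pos {α : ℝ} (hα0 : 0 < α) (hα : α < Real.pi / 2) : 0 < Real.sin α :=
  Real.sin_pos_of_pos_of_lt_pi hα0 (by linarith [Real.pi_pos])

theorem norm_lt_one_of_mem_bdry {β : ℝ} (hβ0 : 0 < β) (hβ : β < Real.pi / 2) {z : ℂ}
    (hz : z ∈ stolzBdry β \ {1}) : ‖z‖ < 1 := by
  have h : z ∈ stolz ((β + Real.pi / 2) / 2) :=
    mem_stolz_of_mem_stolzBdry (sin_pos hβ0 hβ).le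
      (sin_lt_sin hβ0 (by linarith) (by linarith)) hz.1 (by simpa using hz.2)
  exact norm_lt_one_of_mem_stolz h

theorem norm_one_sub_le_two {β : ℝ} (hβ0 : 0 < β) (hβ : β < Real.pi / 2) {z : ℂ}
    (hz : z ∈ stolzBdry β \ {1}) : ‖1 - z‖ ≤ 2 := by
  have := norm_lt_one_of_mem_bdry hβ0 hβ hz
  have h2 := norm_sub_le (1 : ℂ) z
  rw [norm_one] at h2
  linarith

section Resolvent

variable {T : X →L[ℂ] X} {α β C : ℝ}

/-- The resolvent of `r T`, `0 ≤ r ≤ 1`, along the boundary of a Stolz domain. -/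
theorem resolvent_smul_bound (hT : HasStolzResolventBound T α C) (hα0 : 0 < α) (hαβ : α < β)
    (hβ : β < Real.pi / 2) {r : ℝ} (hr0 : 0 ≤ r) (hr1 : r ≤ 1) {z : ℂ} (hz : z ∈ stolzBdry β)
    (h : r < 1 ∨ z ≠ 1) : z ∈ resolventSet ℂ ((r : ℂ) • T) ∧
      ‖(z - r) • resolvent ((r : ℂ) • T) z‖ ≤ max C 1 := by
  have key : ∀ g : X →L[ℂ] X, (algebraMap ℂ (X →L[ℂ] X) z - (r : ℂ) • T) * g = 1 →
      g * (algebraMap ℂ (X →L[ℂ] X) z - (r : ℂ) • T) = 1 →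
      z ∈ resolventSet ℂ ((r : ℂ) • T) ∧ resolvent ((r : ℂ) • T) z = g := by
    intro g h1 h2
    have hu : z ∈ resolventSet ℂ ((r : ℂ) • T) := (⟨⟨_, g, h1, h2⟩, rfl⟩ : IsUnit _)
    refine ⟨hu, ?_⟩
    have h3 := resolvent_mul_sub hu
    calc resolvent ((r : ℂ) • T) z = resolvent ((r : ℂ) • T) z *
          ((algebraMap ℂ (X →L[ℂ] X) z - (r : ℂ) • T) * g) := by rw [h1, mul_one]
      _ = g := by rw [← mul_assoc, h3, one_mul]
  rcases hr0.eq_or_lt with h0 | h0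
  · have hz0 : z ≠ 0 := by
      intro h'
      have := hz.2 1 zero_le_one le_rfl
      rw [h'] at this
      have hs := sin_pos (hα0.trans hαβ) hβ
      simp at this
      linarith
    obtain ⟨h1, h2⟩ := key (z⁻¹ • 1)
      (by rw [← h0, Complex.ofReal_zero, zero_smul, sub_zero, ← Algebra.smul_def, smul_smul,
            mul_inv_cancel₀ hz0, one_smul])
      (by rw [← h0, Complex.ofReal_zero, zero_smul, sub_zero, ← Algebra.commutes,
            ← Algebra.smul_def, smul_smul, mul_inv_cancel₀ hz0, one_smul])
    refine ⟨h1, ?_⟩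
    rw [h2, ← h0, Complex.ofReal_zero, sub_zero, smul_smul, mul_inv_cancel₀ hz0, one_smul]
    exact ContinuousLinearMap.norm_id_le.trans (le_max_right _ _)
  · have hrc : (r : ℂ) ≠ 0 := by exact_mod_cast h0.ne'
    obtain ⟨hres, hb⟩ := hT _ (div_notMem_closure_stolz (sin_pos hα0 (hαβ.trans hβ))
      (sin_lt_sin hα0 hαβ hβ) h0 hr1 hz h)
    have e : algebraMap ℂ (X →L[ℂ] X) z - (r : ℂ) • T =
        (r : ℂ) • (algebraMap ℂ (X →L[ℂ] X) (z / r) - T) := by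
      rw [smul_sub, Algebra.algebraMap_eq_smul_one, Algebra.algebraMap_eq_smul_one, smul_smul,
        mul_div_cancel₀ _ hrc]
    obtain ⟨h1, h2⟩ := key ((r : ℂ)⁻¹ • resolvent T (z / r))
      (by rw [e, smul_mul_smul_comm, mul_inv_cancel₀ hrc, one_smul, sub_mul_resolvent hres])
      (by rw [e, smul_mul_smul_comm, inv_mul_cancel₀ hrc, one_smul, resolvent_mul_sub hres])
    refine ⟨h1, ?_⟩
    have e2 : (z - r) * (r : ℂ)⁻¹ = z / r - 1 := by field_simp
    rw [h2, smul_smul, e2]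
    exact hb.trans (le_max_left _ _)

theorem resolvent_bound (hT : HasStolzResolventBound T α C) (hα0 : 0 < α) (hαβ : α < β)
    (hβ : β < Real.pi / 2) {z : ℂ} (hz : z ∈ stolzBdry β \ {1}) :
    z ∈ resolventSet ℂ T ∧ ‖resolvent T z‖ ≤ C * ‖1 - z‖⁻¹ := by
  have hz1 : z ≠ 1 := by simpa using hz.2
  have hnot := div_notMem_closure_stolz (sin_pos hα0 (hαβ.trans hβ))
      (sin_lt_sin hα0 hαβ hβ) one_pos le_rfl hz.1 (Or.inr hz1)
  rw [Complex.ofReal_one, div_one] at hnot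
  obtain ⟨h1, h2⟩ := hT z hnot
  refine ⟨h1, ?_⟩
  have hpos : 0 < ‖1 - z‖ := norm_pos_iff.2 (sub_ne_zero.2 hz1.symm)
  rw [← div_eq_mul_inv, le_div_iff₀ hpos, mul_comm, norm_sub_rev, ← norm_smul]
  exact h2

variable [CompleteSpace X]

theorem continuousOn_resolvent {S : X →L[ℂ] X} {s : Set ℂ} (h : ∀ z ∈ s, z ∈ resolventSet ℂ S) :
    ContinuousOn (resolvent S) s := fun z hz =>
  (spectrum.hasDerivAt_resolvent_const_left (h z hz)).continuousAt.continuousWithinAt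

theorem norm_stolzBoundaryIntegral_le_of_norm_le {E : Type*} [NormedAddCommGroup E]
    [NormedSpace ℂ E] (hβ0 : 0 < β) (hβ : β < Real.pi / 2) :
    ∃ Λ : ℝ, 0 ≤ Λ ∧ ∀ (f : ℂ → E) (B : ℝ), 0 ≤ B → (∀ z ∈ stolzBdry β, ‖f z‖ ≤ B) →
      ‖stolzBoundaryIntegral f β‖ ≤ Λ * B := by
  obtain ⟨V, hV0, hV⟩ := exists_norm_bdryVel_le β
  refine ⟨∑ i, V * (bdryHi β i - bdryLo β i), Finset.sum_nonneg fun i _ =>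
    mul_nonneg hV0 (sub_nonneg.2 (bdryLo_le_bdryHi hβ0 i)), fun f B hB0 hB => ?_⟩
  rw [stolzBoundaryIntegral_eq_sum, Finset.sum_mul]
  refine norm_sum_le_of_le _ fun i _ => ?_
  have hle := bdryLo_le_bdryHi hβ0 i
  have h := intervalIntegral.norm_integral_le_of_norm_le_const (C := V * B) (a := bdryLo β i)
    (b := bdryHi β i) (f := fun t => bdryVel β i t • f (bdryPath β i t)) (fun t ht => by
      rw [Set.uIoc_of_le hle] at ht
      rw [norm_smul]
      exact mul_le_mul (hV i t) (hB _ (bdryPath_mem hβ0 hβ i (Set.Ioc_subset_Icc_self ht)))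
        (norm_nonneg _) hV0)
  rw [abs_of_nonneg (sub_nonneg.2 hle)] at h
  linarith

/-- A function on `[0, b]` whose increments are quadratically small is constant. -/
theorem eq_of_norm_sub_le_sq {E : Type*} [NormedAddCommGroup E] {f : ℝ → E} {b K : ℝ}
    (hb : 0 ≤ b) (h : ∀ x y : ℝ, 0 ≤ x → x ≤ y → y ≤ b → ‖f y - f x‖ ≤ K * (y - x) ^ 2) :
    f b = f 0 := by
  have hn : ∀ n : ℕ, ‖f b - f 0‖ ≤ K * b ^ 2 * (1 / ((n : ℝ) + 1)) := by
    intro n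
    have hn0 : (0 : ℝ) < (n : ℝ) + 1 := by positivity
    set x : ℕ → ℝ := fun i => i * (b / (n + 1)) with hx
    have h1 : ∀ i ∈ Finset.range (n + 1), ‖f (x (i + 1)) - f (x i)‖ ≤ K * (b / (n + 1)) ^ 2 := by
      intro i hi
      have hi' : ((i + 1 : ℕ) : ℝ) ≤ n + 1 := by exact_mod_cast Finset.mem_range.1 hi
      have h2 := h (x i) (x (i + 1)) (by positivity)
        (by simp only [hx]; push_cast; gcongr; linarith)
        (by
          calc x (i + 1) ≤ (n + 1) * (b / (n + 1)) := by simp only [hx]; gcongr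
            _ = b := by field_simp)
      refine h2.trans (le_of_eq ?_)
      simp only [hx]; push_cast; ring
    have h3 : f b - f 0 = ∑ i ∈ Finset.range (n + 1), (f (x (i + 1)) - f (x i)) := by
      rw [Finset.sum_range_sub (fun i => f (x i))]
      have e1 : x (n + 1) = b := by simp only [hx]; push_cast; field_simp
      have e2 : x 0 = 0 := by simp [hx]
      rw [e1, e2]
    rw [h3]
    refine (norm_sum_le_of_le _ h1).trans (le_of_eq ?_)
    simp only [Finset.sum_const, Finset.card_range, nsmul_eq_mul]
    push_cast
    field_simp
  have hlim : Tendsto (fun n : ℕ => K * b ^ 2 * (1 / ((n : ℝ) + 1))) atTop (𝓝 (K * b ^ 2 * 0)) :=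
    tendsto_one_div_add_atTop_nhds_zero_nat.const_mul _
  rw [mul_zero] at hlim
  have := ge_of_tendsto' hlim hn
  exact sub_eq_zero.1 (norm_le_zero_iff.1 this)

/-- The integral of the resolvent of `r T` does not depend on `r ∈ [0, 1)`, since its derivative
with respect to `r` is the integral of `- T ∂_z R(z, r T)`. Its value is obtained at `r = 0`. -/
theorem stolzBoundaryIntegral_resolvent_smul (hT : HasStolzResolventBound T α C) (hα0 : 0 < α)
    (hαβ : α < β) (hβ : β < Real.pi / 2) {b : ℝ} (hb0 : 0 ≤ b) (hb1 : b < 1) :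
    stolzBoundaryIntegral (resolvent ((b : ℂ) • T)) β = (2 * Real.pi * Complex.I : ℂ) • 1 := by
  have hβ0 := hα0.trans hαβ
  have hs := sin_pos hβ0 hβ
  set g : ℝ → ℂ → X →L[ℂ] X := fun r => resolvent ((r : ℂ) • T) with hg
  have hres : ∀ r, 0 ≤ r → r ≤ b → ∀ z ∈ stolzBdry β, z ∈ resolventSet ℂ ((r : ℂ) • T) :=
    fun r h0 h1 z hz => (resolvent_smul_bound hT hα0 hαβ hβ h0 (by linarith) hz
      (Or.inl (by linarith))).1
  set B := max C 1 / ((1 - b) * Real.sin β) with hB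
  have hB0 : 0 ≤ B := div_nonneg (zero_le_one.trans (le_max_right _ _))
    (mul_nonneg (by linarith) hs.le)
  have hgB : ∀ r, 0 ≤ r → r ≤ b → ∀ z ∈ stolzBdry β, ‖g r z‖ ≤ B := by
    intro r h0 h1 z hz
    have h2 := (resolvent_smul_bound hT hα0 hαβ hβ h0 (by linarith) hz (Or.inl (by linarith))).2
    rw [norm_smul] at h2
    have h3 := mul_sin_le_norm_sub h0 (by linarith) hz
    have h4 : 0 < (1 - b) * Real.sin β := mul_pos (by linarith) hs
    rw [hB, le_div_iff₀ h4, mul_comm]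
    refine le_trans ?_ h2
    gcongr
    refine le_trans ?_ h3
    gcongr
  have hgc : ∀ r, 0 ≤ r → r ≤ b → ContinuousOn (g r) (stolzBdry β) := fun r h0 h1 =>
    continuousOn_resolvent (hres r h0 h1)
  obtain ⟨Λ, hΛ0, hΛ⟩ := norm_stolzBoundaryIntegral_le_of_norm_le (E := X →L[ℂ] X) hβ0 hβ
  have hdiff : ∀ x y : ℝ, 0 ≤ x → x ≤ y → y ≤ b → ∀ z ∈ stolzBdry β,
      g y z = g x z + ((y - x : ℝ) : ℂ) • (T * (g x z * g x z)) +
        ((y - x : ℝ) : ℂ) • ((y - x : ℝ) : ℂ) • (T * (T * (g y z * g x z * g x z))) := by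
    intro x y hx hxy hy z hz
    have hzx := hres x hx (hxy.trans hy) z hz
    have hzy := hres y (hx.trans hxy) hy z hz
    have hcomm : ∀ r : ℝ, z ∈ resolventSet ℂ ((r : ℂ) • T) → g r z * T = T * g r z := by
      intro r hzr
      obtain ⟨u, hu⟩ := hzr
      simp only [hg, resolvent]
      rw [← hu, Ring.inverse_unit]
      refine (Commute.units_inv_left ?_).eq
      rw [hu]
      exact (show Commute (algebraMap ℂ (X →L[ℂ] X) z) T from Algebra.commutes z T).sub_left
        ((Commute.refl T).smul_left _)
    have h1 : g y z - g x z = ((y - x : ℝ) : ℂ) • (T * (g y z * g x z)) := by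
      have e1 := resolvent_mul_sub hzy
      have e2 := sub_mul_resolvent hzx
      have e3 : algebraMap ℂ (X →L[ℂ] X) z - (x : ℂ) • T -
          (algebraMap ℂ (X →L[ℂ] X) z - (y : ℂ) • T) = ((y - x : ℝ) : ℂ) • T := by
        push_cast; rw [sub_smul]; abel
      calc g y z - g x z = g y z * ((algebraMap ℂ (X →L[ℂ] X) z - (x : ℂ) • T) * g x z) -
            (g y z * (algebraMap ℂ (X →L[ℂ] X) z - (y : ℂ) • T)) * g x z := by
              simp only [hg]; rw [e1, e2, mul_one, one_mul]
        _ = g y z * ((algebraMap ℂ (X →L[ℂ] X) z - (x : ℂ) • T -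
            (algebraMap ℂ (X →L[ℂ] X) z - (y : ℂ) • T)) * g x z) := by
              rw [mul_assoc, ← mul_sub, ← sub_mul]
        _ = _ := by
          rw [e3, smul_mul_assoc, mul_smul_comm, ← mul_assoc, hcomm y hzy, mul_assoc]
    have h2 : g y z = g x z + ((y - x : ℝ) : ℂ) • (T * (g y z * g x z)) := by rw [← h1]; abel
    have h3 : g y z * g x z = g x z * g x z +
        ((y - x : ℝ) : ℂ) • (T * (g y z * g x z * g x z)) := by
      conv_lhs => rw [h2]
      rw [add_mul, smul_mul_assoc, mul_assoc T]
    conv_lhs => rw [h2, h3]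
    rw [mul_add, smul_add, ← add_assoc, mul_smul_comm]
  have hconst : stolzBoundaryIntegral (g b) β = stolzBoundaryIntegral (g 0) β := by
    refine eq_of_norm_sub_le_sq (f := fun r => stolzBoundaryIntegral (g r) β)
      (K := Λ * (‖T‖ * (‖T‖ * (B * B * B)))) hb0 fun x y hx hxy hy => ?_
    have hcx := hgc x hx (hxy.trans hy)
    have hcy := hgc y (hx.trans hxy) hy
    have hsub : stolzBdry β \ {1} ⊆ stolzBdry β := Set.sdiff_subset
    set f2 : ℂ → X →L[ℂ] X := fun z => ((y - x : ℝ) : ℂ) • (T * (g x z * g x z)) with hf2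
    set f3 : ℂ → X →L[ℂ] X := fun z =>
      ((y - x : ℝ) : ℂ) • ((y - x : ℝ) : ℂ) • (T * (T * (g y z * g x z * g x z))) with hf3
    have hyx : ‖((y - x : ℝ) : ℂ)‖ = y - x := by
      rw [Complex.norm_real, Real.norm_of_nonneg (by linarith)]
    have b2 : ∀ z ∈ stolzBdry β, ‖f2 z‖ ≤ (y - x) * (‖T‖ * (B * B)) := by
      intro z hz
      have hBx := hgB x hx (hxy.trans hy) z hz
      rw [hf2]
      simp only [norm_smul, hyx]
      have := norm_mul_le_of_le (le_refl ‖T‖) (norm_mul_le_of_le hBx hBx)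
      gcongr
    have b3 : ∀ z ∈ stolzBdry β, ‖f3 z‖ ≤ (y - x) * ((y - x) * (‖T‖ * (‖T‖ * (B * B * B)))) := by
      intro z hz
      have hBx := hgB x hx (hxy.trans hy) z hz
      have hBy := hgB y (hx.trans hxy) hy z hz
      rw [hf3]
      simp only [norm_smul, hyx]
      have := norm_mul_le_of_le (le_refl ‖T‖) (norm_mul_le_of_le (le_refl ‖T‖)
        (norm_mul_le_of_le (norm_mul_le_of_le hBy hBx) hBx))
      have h0 : 0 ≤ y - x := by linarith
      gcongr
    have c2 : ContinuousOn f2 (stolzBdry β) := by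
      simp only [hf2]; fun_prop
    have c3 : ContinuousOn f3 (stolzBdry β) := by
      simp only [hf3]; fun_prop
    have i2 : stolzBoundaryIntegral f2 β = 0 := by
      refine stolzBoundaryIntegral_eq_zero_of_hasDerivAt
        (F := fun z => ((y - x : ℝ) : ℂ) • (T * (-g x z))) hβ0 hβ (fun z hz => ?_) c2
      have h1 := spectrum.hasDerivAt_resolvent_const_left (hres x hx (hxy.trans hy) z hz)
      have h2 := ((h1.neg).const_mul T).const_smul ((y - x : ℝ) : ℂ)
      rw [neg_neg, pow_two] at h2
      exact h2
    have e : stolzBoundaryIntegral (g y) β = stolzBoundaryIntegral (g x) β +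
        stolzBoundaryIntegral f2 β + stolzBoundaryIntegral f3 β := by
      have hq : (-1 : ℝ) < 0 := by norm_num
      rw [← stolzBoundaryIntegral_add (q := 0) hβ0 hβ hq (hcx.mono hsub)
          (fun z hz => by rw [Real.rpow_zero, mul_one]; exact hgB x hx (hxy.trans hy) z (hsub hz))
          (c2.mono hsub)
          (fun z hz => by rw [Real.rpow_zero, mul_one]; exact b2 z (hsub hz)),
        ← stolzBoundaryIntegral_add (q := 0) (B := B + (y - x) * (‖T‖ * (B * B))) hβ0 hβ hq
          (show ContinuousOn (fun z => g x z + f2 z) _ from (hcx.add c2).mono hsub)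
          (fun z hz => by
            rw [Real.rpow_zero, mul_one]
            exact norm_add_le_of_le (hgB x hx (hxy.trans hy) z (hsub hz)) (b2 z (hsub hz)))
          (c3.mono hsub) (fun z hz => by rw [Real.rpow_zero, mul_one]; exact b3 z (hsub hz))]
      exact stolzBoundaryIntegral_congr hβ0 hβ fun z hz => hdiff x y hx hxy hy z (hsub hz)
    change ‖stolzBoundaryIntegral (g y) β - stolzBoundaryIntegral (g x) β‖ ≤ _
    rw [e, i2, add_zero, add_sub_cancel_left]
    refine (hΛ f3 _ ?_ b3).trans (le_of_eq (by ring))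
    have : 0 ≤ y - x := by linarith
    positivity
  have hinv := stolzBoundaryIntegral_smul_const (fun z : ℂ => z⁻¹) (1 : X →L[ℂ] X) β
  rw [stolzBoundaryIntegral_inv hβ0 hβ] at hinv
  refine Eq.trans ?_ hinv
  change stolzBoundaryIntegral (g b) β = _
  rw [hconst]
  refine stolzBoundaryIntegral_congr hβ0 hβ fun z hz => ?_
  have h1 := sub_mul_resolvent (hres 0 le_rfl hb0 z hz.1)
  rw [Complex.ofReal_zero, zero_smul, sub_zero, ← Algebra.smul_def] at h1
  have hz0 : z ≠ 0 := by
    intro h'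
    have := hz.1.2 1 zero_le_one le_rfl
    rw [h'] at this
    simp at this
    linarith
  simp only [hg, Complex.ofReal_zero, zero_smul]
  rw [← h1, smul_smul, inv_mul_cancel₀ hz0, one_smul]

/-- The functional calculus maps `z ↦ 1 - z` to `I - T`. -/
theorem funCalc_one_sub (hT : HasStolzResolventBound T α C) (hα0 : 0 < α)
    (hαβ : α < β) (hβ : β < Real.pi / 2) : funCalc T β (fun z => 1 - z) = 1 - T := by
  have hβ0 := hα0.trans hαβ
  have hs := sin_pos hβ0 hβ
  have hev : ∀ᶠ r : ℝ in 𝓝[<] 1, 0 < r ∧ r < 1 := by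
    filter_upwards [Ioo_mem_nhdsLT (zero_lt_one' ℝ)] with r hr using hr
  have hsub : stolzBdry β \ {1} ⊆ stolzBdry β := Set.sdiff_subset
  have hC1 : (0 : ℝ) ≤ max C 1 := zero_le_one.trans (le_max_right _ _)
  have hint : ∀ r : ℝ, 0 < r → r < 1 →
      stolzBoundaryIntegral (fun z => (1 - z) • resolvent ((r : ℂ) • T) z) β =
        (2 * Real.pi * Complex.I : ℂ) • (1 - (r : ℂ) • T) := by
    intro r h0 h1
    have hres : ∀ z ∈ stolzBdry β, z ∈ resolventSet ℂ ((r : ℂ) • T) := fun z hz =>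
      (resolvent_smul_bound hT hα0 hαβ hβ h0.le h1.le hz (Or.inl h1)).1
    set B := max C 1 / ((1 - r) * Real.sin β) with hB
    have hgB : ∀ z ∈ stolzBdry β, ‖resolvent ((r : ℂ) • T) z‖ ≤ B := by
      intro z hz
      have h2 := (resolvent_smul_bound hT hα0 hαβ hβ h0.le h1.le hz (Or.inl h1)).2
      rw [norm_smul] at h2
      have h3 := mul_sin_le_norm_sub h0.le h1.le hz
      have h4 : 0 < (1 - r) * Real.sin β := mul_pos (by linarith) hs
      rw [hB, le_div_iff₀ h4, mul_comm]
      refine le_trans ?_ h2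
      gcongr
    have hgc : ContinuousOn (resolvent ((r : ℂ) • T)) (stolzBdry β) := continuousOn_resolvent hres
    have hq : (-1 : ℝ) < 0 := by norm_num
    have e : stolzBoundaryIntegral (fun z => (1 - z) • resolvent ((r : ℂ) • T) z) β =
        stolzBoundaryIntegral (fun z => (1 - (r : ℂ) • T) * resolvent ((r : ℂ) • T) z + (-1)) β := by
      refine stolzBoundaryIntegral_congr hβ0 hβ fun z hz => ?_
      have h2 := mul_resolvent (hres z hz.1)
      rw [sub_mul, one_mul, h2, sub_smul, one_smul]
      abel
    rw [e, stolzBoundaryIntegral_add (q := 0) (B := ‖1 - (r : ℂ) • T‖ * B)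
      (B' := ‖(-1 : X →L[ℂ] X)‖) hβ0 hβ hq (by exact (continuousOn_const.mul hgc).mono hsub)
      (fun z hz => by
        rw [Real.rpow_zero, mul_one]
        exact norm_mul_le_of_le le_rfl (hgB z (hsub hz)))
      continuousOn_const (fun z _ => by rw [Real.rpow_zero, mul_one]),
      stolzBoundaryIntegral_const hβ0 hβ, add_zero]
    have h5 := map_stolzBoundaryIntegral (ContinuousLinearMap.mul ℂ (X →L[ℂ] X) (1 - (r : ℂ) • T))
      (q := 0) (B := B) hβ0 hβ hq (hgc.mono hsub)
      (fun z hz => by rw [Real.rpow_zero, mul_one]; exact hgB z (hsub hz))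
    simp only [ContinuousLinearMap.mul_apply'] at h5
    rw [h5, stolzBoundaryIntegral_resolvent_smul hT hα0 hαβ hβ h0.le h1, mul_smul_comm, mul_one]
  have hlim1 : Tendsto (fun r : ℝ =>
      stolzBoundaryIntegral (fun z => (1 - z) • resolvent ((r : ℂ) • T) z) β) (𝓝[<] 1)
      (𝓝 (stolzBoundaryIntegral (fun z => (1 - z) • resolvent T z) β)) := by
    refine tendsto_stolzBoundaryIntegral (q := 0) (B := max C 1 * (1 + 1 / Real.sin β)) hβ0 hβ
      (by norm_num) ?_ ?_ fun z hz => ?_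
    · filter_upwards [hev] with r hr
      refine ContinuousOn.smul (continuousOn_const.sub continuousOn_id)
        (continuousOn_resolvent fun z hz => ?_)
      exact (resolvent_smul_bound hT hα0 hαβ hβ hr.1.le hr.2.le hz.1 (Or.inl hr.2)).1
    · filter_upwards [hev] with r hr z hz
      have h2 := (resolvent_smul_bound hT hα0 hαβ hβ hr.1.le hr.2.le hz.1 (Or.inl hr.2)).2
      have h3 := mul_sin_le_norm_sub hr.1.le hr.2.le hz.1
      rw [norm_smul] at h2
      have h4 : ‖1 - z‖ ≤ (1 + 1 / Real.sin β) * ‖z - r‖ := by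
        have e1 : ‖1 - z‖ ≤ (1 - r) + ‖z - r‖ := by
          calc ‖1 - z‖ = ‖((1 - r : ℝ) : ℂ) - (z - r)‖ := by congr 1; push_cast; ring
            _ ≤ ‖((1 - r : ℝ) : ℂ)‖ + ‖z - r‖ := norm_sub_le _ _
            _ = _ := by rw [Complex.norm_real, Real.norm_of_nonneg (by linarith [hr.2])]
        have e2 : 1 - r ≤ 1 / Real.sin β * ‖z - r‖ := by
          rw [one_div, ← div_eq_inv_mul, le_div_iff₀ hs]; exact h3
        linarith
      rw [Real.rpow_zero, mul_one, norm_smul]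
      calc ‖1 - z‖ * ‖resolvent ((r : ℂ) • T) z‖
          ≤ (1 + 1 / Real.sin β) * ‖z - r‖ * ‖resolvent ((r : ℂ) • T) z‖ := by gcongr
        _ = (1 + 1 / Real.sin β) * (‖z - r‖ * ‖resolvent ((r : ℂ) • T) z‖) := by ring
        _ ≤ (1 + 1 / Real.sin β) * max C 1 := by gcongr
        _ = _ := mul_comm _ _
    · refine Tendsto.const_smul ?_ _
      have hzT := (resolvent_bound hT hα0 hαβ hβ hz).1
      have h1 : Tendsto (fun r : ℝ => algebraMap ℂ (X →L[ℂ] X) z - (r : ℂ) • T) (𝓝[<] 1)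
          (𝓝 (algebraMap ℂ (X →L[ℂ] X) z - T)) := by
        have : Tendsto (fun r : ℝ => algebraMap ℂ (X →L[ℂ] X) z - (r : ℂ) • T) (𝓝 1)
            (𝓝 (algebraMap ℂ (X →L[ℂ] X) z - ((1 : ℝ) : ℂ) • T)) := Continuous.tendsto (by fun_prop) 1
        rw [Complex.ofReal_one, one_smul] at this
        exact this.mono_left nhdsWithin_le_nhds
      obtain ⟨u, hu⟩ := hzT
      have h2 := NormedRing.inverse_continuousAt u
      rw [hu] at h2
      exact h2.tendsto.comp h1
  have hlim2 : Tendsto (fun r : ℝ => (2 * Real.pi * Complex.I : ℂ) • (1 - (r : ℂ) • T)) (𝓝[<] 1)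
      (𝓝 ((2 * Real.pi * Complex.I : ℂ) • (1 - T))) := by
    have : Tendsto (fun r : ℝ => (2 * Real.pi * Complex.I : ℂ) • (1 - (r : ℂ) • T)) (𝓝 1)
        (𝓝 ((2 * Real.pi * Complex.I : ℂ) • (1 - ((1 : ℝ) : ℂ) • T))) :=
      Continuous.tendsto (by fun_prop) 1
    rw [Complex.ofReal_one, one_smul] at this
    exact this.mono_left nhdsWithin_le_nhds
  have heq := tendsto_nhds_unique hlim1 (hlim2.congr' (by
    filter_upwards [hev] with r hr
    exact (hint r hr.1 hr.2).symm))
  unfold funCalc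
  rw [heq, smul_smul, inv_mul_cancel₀ Complex.two_pi_I_ne_zero, one_smul]

end Resolvent

end Calculus

/-! ### Multiplicativity of the functional calculus -/

section Multiplicativity

theorem HInftyZero.mul_mem {γ M : ℝ} {m φ : ℂ → ℂ} (hφ : φ ∈ HInftyZero γ)
    (hm : DifferentiableOn ℂ m (stolz γ)) (hM : ∀ z ∈ stolz γ, ‖m z‖ ≤ M) :
    (fun z => m z * φ z) ∈ HInftyZero γ := by
  obtain ⟨hd, ⟨B, hB⟩, s, c, hs, hc, hsc⟩ := hφ
  refine ⟨hm.mul hd, ⟨M * B, fun z hz => norm_mul_le_of_le (hM z hz) (hB z hz)⟩,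
    s, (|M| + 1) * c, hs, by positivity, fun z hz => ?_⟩
  have h1 : ‖m z‖ ≤ |M| + 1 := (hM z hz).trans ((le_abs_self M).trans (by linarith))
  rw [mul_assoc]
  exact norm_mul_le_of_le h1 (hsc z hz)

theorem norm_one_sub_le_two_of_mem_stolz {γ : ℝ} {z : ℂ} (hz : z ∈ stolz γ) : ‖1 - z‖ ≤ 2 := by
  have h1 := norm_lt_one_of_mem_stolz hz
  have h2 := norm_sub_le (1 : ℂ) z
  rw [norm_one] at h2
  linarith

theorem one_sub_mem_HInftyZero (γ : ℝ) : (fun z : ℂ => 1 - z) ∈ HInftyZero γ :=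
  ⟨by fun_prop, ⟨2, fun z hz => norm_one_sub_le_two_of_mem_stolz hz⟩, 1, 1, one_pos, one_pos,
    fun z hz => by rw [Real.rpow_one, one_mul]⟩

theorem pow_mul_mem_HInftyZero {γ : ℝ} {φ : ℂ → ℂ} (hφ : φ ∈ HInftyZero γ) (n : ℕ) :
    (fun z => z ^ n * φ z) ∈ HInftyZero γ :=
  HInftyZero.mul_mem hφ (by fun_prop) (M := 1) fun z hz => by
    rw [norm_pow]; exact pow_le_one₀ (norm_nonneg _) (norm_lt_one_of_mem_stolz hz).le

theorem le_supNorm {γ : ℝ} {φ : ℂ → ℂ} (hφ : φ ∈ HInftyZero γ) {z : ℂ} (hz : z ∈ stolz γ) :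
    ‖φ z‖ ≤ supNorm γ φ := by
  obtain ⟨-, ⟨B, hB⟩, -⟩ := hφ
  exact le_csSup ⟨B, by rintro _ ⟨w, hw, rfl⟩; exact hB w hw⟩ ⟨z, hz, rfl⟩

theorem supNorm_nonneg (γ : ℝ) (φ : ℂ → ℂ) : 0 ≤ supNorm γ φ :=
  Real.sSup_nonneg (by rintro _ ⟨w, -, rfl⟩; exact norm_nonneg _)

theorem supNorm_le {γ B : ℝ} (hB0 : 0 ≤ B) {φ : ℂ → ℂ} (hB : ∀ z ∈ stolz γ, ‖φ z‖ ≤ B) :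
    supNorm γ φ ≤ B :=
  Real.sSup_le (by rintro _ ⟨w, hw, rfl⟩; exact hB w hw) hB0

variable {X : Type*} [NormedAddCommGroup X] [NormedSpace ℂ X] {T : X →L[ℂ] X} {α β γ C : ℝ}

theorem HasStolzResolventBound.nonneg (hT : HasStolzResolventBound T α C) (hα0 : 0 < α)
    (hα : α < Real.pi / 2) : 0 ≤ C := by
  have h2 : (2 : ℂ) ∉ closure (stolz α) := by
    intro h
    have hs1 := sin_lt_one hα0 hα
    have := norm_add_mul_le_of_mem (ε := 0) le_rfl (by linarith) h
    norm_num at this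
  exact (norm_nonneg _).trans (hT 2 h2).2

variable [CompleteSpace X]

theorem stolzBdry_diff_subset_stolz (hβ0 : 0 < β) (hβγ : β < γ) (hγ : γ < Real.pi / 2) :
    stolzBdry β \ {1} ⊆ stolz γ := fun _ hz =>
  mem_stolz_of_mem_stolzBdry (sin_pos hβ0 (hβγ.trans hγ)).le (sin_lt_sin hβ0 hβγ hγ) hz.1
    (by simpa using hz.2)

/-- The integrand of the functional calculus is continuous and absolutely integrable. -/
theorem continuousOn_and_bound_of_mem_HInftyZero (hT : HasStolzResolventBound T α C) (hα0 : 0 < α)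
    (hαβ : α < β) (hβγ : β < γ) (hγ : γ < Real.pi / 2) {φ : ℂ → ℂ} (hφ : φ ∈ HInftyZero γ) :
    ContinuousOn (fun z => φ z • resolvent T z) (stolzBdry β \ {1}) ∧
    ∃ s B : ℝ, 0 < s ∧ 0 ≤ B ∧
      (∀ z ∈ stolzBdry β \ {1}, ‖φ z‖ ≤ 2 * B * ‖1 - z‖ ^ (s - 1)) ∧
      ∀ z ∈ stolzBdry β \ {1}, ‖φ z • resolvent T z‖ ≤ C * B * ‖1 - z‖ ^ (s - 1) := by
  have hβ := hβγ.trans hγ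
  have hsub := stolzBdry_diff_subset_stolz (hα0.trans hαβ) hβγ hγ
  obtain ⟨hd, -, s, c, hs, hc, hsc⟩ := hφ
  refine ⟨(hd.continuousOn.mono hsub).smul
    (continuousOn_resolvent fun z hz => (resolvent_bound hT hα0 hαβ hβ hz).1),
    s, c, hs, hc.le, fun z hz => ?_, fun z hz => ?_⟩ <;>
  · have hpos : 0 < ‖1 - z‖ := norm_pos_iff.2 (sub_ne_zero.2 (by simpa [eq_comm] using hz.2))
    have h1 := hsc z (hsub hz)
    have e : ‖1 - z‖ ^ s = ‖1 - z‖ * ‖1 - z‖ ^ (s - 1) := by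
      rw [Real.rpow_sub_one hpos.ne']; field_simp
    first
    | have h2 := norm_one_sub_le_two (hα0.trans hαβ) hβ hz
      refine h1.trans ?_
      rw [e, mul_comm 2 c, mul_assoc]
      gcongr
    | have h2 := (resolvent_bound hT hα0 hαβ hβ hz).2
      rw [norm_smul]
      refine (mul_le_mul h1 h2 (norm_nonneg _) (by positivity)).trans (le_of_eq ?_)
      rw [e]; field_simp

/-- A bounded operator `L` on `B(X)` that acts on the resolvent as multiplication by a function
`m`, up to a constant, acts on the functional calculus as multiplication by `m`, since the
constant term contributes `∫ φ = 0`. -/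
theorem map_funCalc (hT : HasStolzResolventBound T α C) (hα0 : 0 < α)
    (hαβ : α < β) (hβγ : β < γ) (hγ : γ < Real.pi / 2) {φ : ℂ → ℂ} (hφ : φ ∈ HInftyZero γ)
    (L : (X →L[ℂ] X) →L[ℂ] (X →L[ℂ] X)) (m : ℂ → ℂ) (c : ℂ)
    (hL : ∀ z ∈ resolventSet ℂ T, L (resolvent T z) = m z • resolvent T z + c • 1) :
    L (funCalc T β φ) = funCalc T β (fun z => m z * φ z) := by
  have hβ := hβγ.trans hγ
  have hβ0 := hα0.trans hαβ
  have hsub := stolzBdry_diff_subset_stolz hβ0 hβγ hγ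
  obtain ⟨hcont, s, B, hs, hB0, hφB, hB⟩ :=
    continuousOn_and_bound_of_mem_HInftyZero hT hα0 hαβ hβγ hγ hφ
  have hq : -1 < s - 1 := by linarith
  have hcL : ContinuousOn (fun z => L (φ z • resolvent T z)) (stolzBdry β \ {1}) :=
    L.continuous.comp_continuousOn hcont
  have hBL : ∀ z ∈ stolzBdry β \ {1}, ‖L (φ z • resolvent T z)‖ ≤ ‖L‖ * (C * B) * ‖1 - z‖ ^ (s - 1) :=
    fun z hz => by
      rw [mul_assoc ‖L‖]
      exact L.le_opNorm_of_le (hB z hz)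
  have hcφ : ContinuousOn (fun z => (-c * φ z) • (1 : X →L[ℂ] X)) (stolzBdry β \ {1}) :=
    (continuousOn_const.mul (hφ.1.continuousOn.mono hsub)).smul continuousOn_const
  have hBφ : ∀ z ∈ stolzBdry β \ {1}, ‖(-c * φ z) • (1 : X →L[ℂ] X)‖ ≤
      ‖c‖ * (2 * B) * ‖1 - z‖ ^ (s - 1) := fun z hz => by
    have h1 : ‖(1 : X →L[ℂ] X)‖ ≤ 1 := ContinuousLinearMap.norm_id_le
    rw [norm_smul, norm_mul, norm_neg]
    calc ‖c‖ * ‖φ z‖ * ‖(1 : X →L[ℂ] X)‖ ≤ ‖c‖ * (2 * B * ‖1 - z‖ ^ (s - 1)) * 1 := by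
          gcongr
          exact hφB z hz
      _ = _ := by ring
  obtain ⟨M, hM⟩ := hφ.2.1
  have h0 : stolzBoundaryIntegral (fun z => (-c * φ z) • (1 : X →L[ℂ] X)) β = 0 := by
    rw [stolzBoundaryIntegral_smul_const, stolzBoundaryIntegral_eq_zero hβ0 hβ
      (sin_lt_sin hβ0 hβγ hγ) (hφ.1.const_mul (-c)) (M := ‖c‖ * M) (fun z hz => by
        rw [norm_mul, norm_neg]; gcongr; exact hM z hz), zero_smul]
  have hadd := stolzBoundaryIntegral_add hβ0 hβ hq hcL hBL hcφ hBφ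
  rw [h0, add_zero, map_stolzBoundaryIntegral L hβ0 hβ hq hcont hB] at hadd
  unfold funCalc
  rw [map_smul, ← hadd]
  congr 1
  refine stolzBoundaryIntegral_congr hβ0 hβ fun z hz => ?_
  rw [map_smul, hL z (resolvent_bound hT hα0 hαβ hβ hz).1, smul_add, smul_smul, smul_smul,
    add_assoc, ← add_smul, mul_comm (φ z) c, neg_mul, add_neg_cancel, zero_smul, add_zero,
    mul_comm (φ z)]

theorem mul_funCalc (hT : HasStolzResolventBound T α C) (hα0 : 0 < α) (hαβ : α < β) (hβγ : β < γ)
    (hγ : γ < Real.pi / 2) {φ : ℂ → ℂ} (hφ : φ ∈ HInftyZero γ) :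
    T * funCalc T β φ = funCalc T β (fun z => z * φ z) :=
  map_funCalc hT hα0 hαβ hβγ hγ hφ (ContinuousLinearMap.mul ℂ _ T) (fun z => z) (-1) fun z hz => by
    rw [ContinuousLinearMap.mul_apply', mul_resolvent hz, neg_one_smul, sub_eq_add_neg]

theorem funCalc_mul (hT : HasStolzResolventBound T α C) (hα0 : 0 < α) (hαβ : α < β) (hβγ : β < γ)
    (hγ : γ < Real.pi / 2) {φ : ℂ → ℂ} (hφ : φ ∈ HInftyZero γ) :
    funCalc T β φ * T = funCalc T β (fun z => z * φ z) :=
  map_funCalc hT hα0 hαβ hβγ hγ hφ ((ContinuousLinearMap.mul ℂ _).flip T) (fun z => z) (-1)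
    fun z hz => by
      rw [ContinuousLinearMap.flip_apply, ContinuousLinearMap.mul_apply', resolvent_mul hz,
        neg_one_smul, sub_eq_add_neg]

theorem funCalc_mul_one_sub (hT : HasStolzResolventBound T α C) (hα0 : 0 < α) (hαβ : α < β)
    (hβγ : β < γ) (hγ : γ < Real.pi / 2) {φ : ℂ → ℂ} (hφ : φ ∈ HInftyZero γ) :
    funCalc T β φ * (1 - T) = funCalc T β (fun z => (1 - z) * φ z) :=
  map_funCalc hT hα0 hαβ hβγ hγ hφ ((ContinuousLinearMap.mul ℂ _).flip (1 - T)) (fun z => 1 - z) 1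
    fun z hz => by
      rw [ContinuousLinearMap.flip_apply, ContinuousLinearMap.mul_apply', mul_sub, mul_one,
        resolvent_mul hz, one_smul, sub_smul, one_smul, sub_sub_eq_add_sub, add_sub_right_comm]

theorem funCalc_mul_pow (hT : HasStolzResolventBound T α C) (hα0 : 0 < α) (hαβ : α < β)
    (hβγ : β < γ) (hγ : γ < Real.pi / 2) {φ : ℂ → ℂ} (hφ : φ ∈ HInftyZero γ) (n : ℕ) :
    funCalc T β φ * T ^ n = funCalc T β (fun z => z ^ n * φ z) := by
  induction n with
  | zero => simp
  | succ n ih =>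
    rw [pow_succ, ← mul_assoc, ih, funCalc_mul hT hα0 hαβ hβγ hγ (pow_mul_mem_HInftyZero hφ n)]
    simp only [pow_succ', mul_assoc]

/-- The functional calculus is given by the usual substitution on multiples of `1 - z`. -/
theorem funCalc_polynomial (hT : HasStolzResolventBound T α C) (hα0 : 0 < α) (hαβ : α < β)
    (hβ : β < Real.pi / 2) (p : Polynomial ℂ) :
    funCalc T β (fun z => p.eval z * (1 - z)) = Polynomial.aeval T p * (1 - T) := by
  have hγ : (β + Real.pi / 2) / 2 < Real.pi / 2 := by linarith
  have hβγ : β < (β + Real.pi / 2) / 2 := by linarith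
  have hβ0 := hα0.trans hαβ
  have hbdd : ∀ p : Polynomial ℂ, ∃ M : ℝ, ∀ z : ℂ, ‖z‖ ≤ 1 → ‖p.eval z‖ ≤ M := fun p => by
    obtain ⟨M, hM⟩ := (isCompact_closedBall (0 : ℂ) 1).exists_bound_of_continuousOn
      p.continuous.continuousOn
    exact ⟨M, fun z hz => hM z (by simpa using hz)⟩
  have hmem : ∀ p : Polynomial ℂ,
      (fun z => p.eval z * (1 - z)) ∈ HInftyZero ((β + Real.pi / 2) / 2) := fun p => by
    obtain ⟨M, hM⟩ := hbdd p
    exact HInftyZero.mul_mem (one_sub_mem_HInftyZero _) (p.differentiable.differentiableOn)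
      fun z hz => hM z (norm_lt_one_of_mem_stolz hz).le
  have hbd : ∀ p : Polynomial ℂ, ∃ B : ℝ, ∀ z ∈ stolzBdry β \ {1},
      ‖(p.eval z * (1 - z)) • resolvent T z‖ ≤ B * ‖1 - z‖ ^ (0 : ℝ) := fun p => by
    obtain ⟨M, hM⟩ := hbdd p
    refine ⟨M * C, fun z hz => ?_⟩
    have hpos : 0 < ‖1 - z‖ := norm_pos_iff.2 (sub_ne_zero.2 (by simpa [eq_comm] using hz.2))
    have h1 := (resolvent_bound hT hα0 hαβ hβ hz).2
    have h2 := hM z (norm_lt_one_of_mem_bdry hβ0 hβ hz).le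
    have h3 : ‖(1 - z) • resolvent T z‖ ≤ C := by
      rw [norm_smul]
      calc ‖1 - z‖ * ‖resolvent T z‖ ≤ ‖1 - z‖ * (C * ‖1 - z‖⁻¹) := by gcongr
        _ = C := by field_simp
    rw [Real.rpow_zero, mul_one, mul_smul, norm_smul]
    exact mul_le_mul h2 h3 (norm_nonneg _) ((norm_nonneg _).trans h2)
  induction p using Polynomial.induction_on with
  | C a =>
    have h := map_funCalc hT hα0 hαβ hβγ hγ (one_sub_mem_HInftyZero _)
      (a • ContinuousLinearMap.id ℂ (X →L[ℂ] X)) (fun _ => a) 0 (fun z _ => by simp)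
    simp only [Polynomial.eval_C, Polynomial.aeval_C]
    rw [← h, funCalc_one_sub hT hα0 hαβ hβ, ← Algebra.smul_def]
    rfl
  | add p q hp hq =>
    obtain ⟨B, hB⟩ := hbd p
    obtain ⟨B', hB'⟩ := hbd q
    have hadd := stolzBoundaryIntegral_add hβ0 hβ (by norm_num)
      (continuousOn_and_bound_of_mem_HInftyZero hT hα0 hαβ hβγ hγ (hmem p)).1 hB
      (continuousOn_and_bound_of_mem_HInftyZero hT hα0 hαβ hβγ hγ (hmem q)).1 hB'
    rw [map_add, add_mul, ← hp, ← hq]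
    unfold funCalc
    rw [← smul_add, ← hadd]
    simp only [Polynomial.eval_add, add_mul, add_smul]
  | monomial n a ih =>
    have e : Polynomial.C a * Polynomial.X ^ (n + 1) =
        Polynomial.X * (Polynomial.C a * Polynomial.X ^ n) := by ring
    rw [e, map_mul, Polynomial.aeval_X, mul_assoc, ← ih,
      mul_funCalc hT hα0 hαβ hβγ hγ (hmem _)]
    simp only [Polynomial.eval_mul, Polynomial.eval_X, mul_assoc]

end Multiplicativity

/-! ### Square function estimates from the functional calculus -/

section CalculusToSquare

theorem stolz_mono {α β : ℝ} (h : Real.sin α ≤ Real.sin β) : stolz α ⊆ stolz β :=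
  interior_mono (convexHull_mono (Set.insert_subset_insert (Metric.ball_subset_ball h)))

theorem IsRittOfType.exists_hasStolzResolventBound {X : Type*} [NormedAddCommGroup X]
    [NormedSpace ℂ X] {T : X →L[ℂ] X} {α α' : ℝ} (hT : IsRittOfType T α) (hαα' : α < α')
    (hα' : α' < Real.pi / 2) : ∃ C, HasStolzResolventBound T α' C := by
  obtain ⟨⟨hα0, hα⟩, hσ, hC⟩ := hT
  obtain ⟨C, hC⟩ := hC α' hαα' hα'
  refine ⟨C, fun z hz => ⟨?_, hC z hz⟩⟩
  by_contra h
  exact hz (closure_mono (stolz_mono (sin_lt_sin hα0 hαα' hα').le) (hσ h))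

theorem mul_pow_mul_one_sub_le {r : ℝ} (h0 : 0 ≤ r) (h1 : r ≤ 1) (n : ℕ) :
    (n : ℝ) * r ^ n * (1 - r) ≤ 1 - r ^ n := by
  have h : (∑ i ∈ Finset.range n, r ^ i) * (1 - r) = 1 - r ^ n := geom_sum_mul_neg r n
  rw [← h]
  refine mul_le_mul_of_nonneg_right ?_ (by linarith)
  rw [← nsmul_eq_mul, ← Finset.card_range n, ← Finset.sum_const, Finset.card_range]
  exact Finset.sum_le_sum fun i hi => pow_le_pow_of_le_one h0 h1 (Finset.mem_range.1 hi).le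

theorem sum_two_pow_mul_pow_le {r : ℝ} (h0 : 0 ≤ r) (h1 : r ≤ 1) (J : ℕ) :
    (∑ j ∈ Finset.range J, (2 : ℝ) ^ j * r ^ (2 ^ j : ℕ)) * (1 - r) ≤ 2 := by
  have key : (∑ j ∈ Finset.range (J + 1), (2 : ℝ) ^ j * r ^ (2 ^ j : ℕ)) * (1 - r) ≤
      2 * (1 - r ^ (2 ^ J : ℕ)) := by
    induction J with
    | zero => simp; nlinarith
    | succ J ih =>
      rw [Finset.sum_range_succ, add_mul]
      have h2 := mul_pow_mul_one_sub_le h0 h1 (2 ^ J)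
      have h3 : 0 ≤ r ^ (2 ^ J : ℕ) := pow_nonneg h0 _
      have h4 := mul_le_mul_of_nonneg_left h2 h3
      have e : r ^ (2 ^ (J + 1) : ℕ) = r ^ (2 ^ J : ℕ) * r ^ (2 ^ J : ℕ) := by
        rw [← pow_add]; congr 1; ring
      push_cast at h4
      rw [e, pow_succ (2 : ℝ)]
      nlinarith
  have hle : (∑ j ∈ Finset.range J, (2 : ℝ) ^ j * r ^ (2 ^ j : ℕ)) * (1 - r) ≤
      (∑ j ∈ Finset.range (J + 1), (2 : ℝ) ^ j * r ^ (2 ^ j : ℕ)) * (1 - r) := by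
    rw [Finset.sum_range_succ]
    refine mul_le_mul_of_nonneg_right (le_add_of_nonneg_right (by positivity)) (by linarith)
  have : 0 ≤ r ^ (2 ^ J : ℕ) := pow_nonneg h0 _
  linarith

variable {H : Type*} [NormedAddCommGroup H] [InnerProductSpace ℂ H]

/-- In a Hilbert space, some choice of signs does at least as well as the average over all signs,
which is given by the parallelogram identity. -/
theorem exists_signs_sum_sq_le (y : ℕ → H) (J : ℕ) :
    ∃ e : ℕ → ℝ, (∀ j, |e j| = 1) ∧
      ∑ j ∈ Finset.range J, ‖y j‖ ^ 2 ≤ ‖∑ j ∈ Finset.range J, (e j : ℂ) • y j‖ ^ 2 := by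
  induction J with
  | zero => exact ⟨fun _ => 1, fun _ => abs_one, by simp⟩
  | succ J ih =>
    obtain ⟨e, he, hle⟩ := ih
    set u := ∑ j ∈ Finset.range J, (e j : ℂ) • y j with hu
    -- The sign of the new term is that of its inner product with the previous sum.
    obtain ⟨σ, hσ, hσ'⟩ : ∃ σ : ℝ, |σ| = 1 ∧ 0 ≤ σ * (inner ℂ u (y J)).re := by
      rcases le_total 0 (inner ℂ u (y J)).re with h | h
      · exact ⟨1, abs_one, by linarith⟩
      · exact ⟨-1, by simp, by linarith⟩
    refine ⟨Function.update e J σ, fun j => ?_, ?_⟩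
    · rcases eq_or_ne j J with rfl | h
      · rw [Function.update_self]; exact hσ
      · rw [Function.update_of_ne h]; exact he j
    · have e1 : ∑ j ∈ Finset.range J, ((Function.update e J σ j : ℝ) : ℂ) • y j = u :=
        Finset.sum_congr rfl fun j hj => by
          rw [Function.update_of_ne (Finset.mem_range.1 hj).ne]
      rw [Finset.sum_range_succ, Finset.sum_range_succ, e1, Function.update_self,
        @norm_add_sq ℂ, norm_smul, Complex.norm_real, Real.norm_eq_abs, hσ, one_mul,
        inner_smul_right]
      have e2 : RCLike.re ((σ : ℂ) * inner ℂ u (y J)) = σ * (inner ℂ u (y J)).re :=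
        Complex.re_ofReal_mul _ _
      rw [e2]
      linarith

theorem squareBound_of_signs {T : H →L[ℂ] H} {M D : ℝ} (hM : ∀ n : ℕ, ‖T ^ n‖ ≤ M) (hD0 : 0 ≤ D)
    (hD : ∀ (e : ℕ → ℝ) (J : ℕ), (∀ j, |e j| = 1) →
      ‖∑ j ∈ Finset.range J, ((e j * 2 ^ j : ℝ) : ℂ) • (T ^ (2 ^ j : ℕ) * (1 - T))‖ ≤ D) :
    SquareBound T (2 * M + 2 * M * D) := by
  refine squareBound_of_dyadic hM hD0 fun x J => ?_
  obtain ⟨e, he, hle⟩ := exists_signs_sum_sq_le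
    (fun j => ((2 ^ j : ℝ) : ℂ) • (T ^ (2 ^ j : ℕ) * (1 - T) : H →L[ℂ] H) x) J
  have h1 : ∑ j ∈ Finset.range J,
      (e j : ℂ) • ((2 ^ j : ℝ) : ℂ) • (T ^ (2 ^ j : ℕ) * (1 - T) : H →L[ℂ] H) x =
      (∑ j ∈ Finset.range J, ((e j * 2 ^ j : ℝ) : ℂ) • (T ^ (2 ^ j : ℕ) * (1 - T))) x := by
    rw [sum_apply]
    refine Finset.sum_congr rfl fun j _ => ?_
    rw [smul_apply, smul_smul, ← Complex.ofReal_mul]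
  rw [h1] at hle
  have h2 : ∀ j, ‖((2 ^ j : ℝ) : ℂ) • (T ^ (2 ^ j : ℕ) * (1 - T) : H →L[ℂ] H) x‖ =
      (2 : ℝ) ^ j * ‖(T ^ (2 ^ j : ℕ) * (1 - T) : H →L[ℂ] H) x‖ := fun j => by
    rw [norm_smul, Complex.norm_real, Real.norm_of_nonneg (by positivity)]
  simp only [h2] at hle
  refine hle.trans ?_
  rw [← mul_pow]
  exact pow_le_pow_left₀ (norm_nonneg _) (ContinuousLinearMap.le_of_opNorm_le _ (hD e J he) x) 2

theorem exists_pos_add_mul_le {γ : ℝ} (hγ0 : 0 < γ) (hγ : γ < Real.pi / 2) :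
    ∃ ε : ℝ, 0 < ε ∧ Real.sin γ + ε * (1 + Real.sin γ) ≤ 1 := by
  have h1 := sin_lt_one hγ0 hγ
  have h0 := sin_pos hγ0 hγ
  refine ⟨(1 - Real.sin γ) / 2, by linarith, by nlinarith⟩

variable [CompleteSpace H]

/-- The functional calculus bounds the operators `∑ ± 2^j T^{2^j} (I - T)` uniformly, because the
functions `∑ ± 2^j z^{2^j} (1 - z)` are uniformly bounded on a Stolz domain. -/
theorem exists_norm_sum_signs_le {T : H →L[ℂ] H} {γ : ℝ} (hγ : γ < Real.pi / 2)
    (hT : HasBoundedHInftyCalculus T γ) :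
    ∃ D : ℝ, 0 ≤ D ∧ ∀ (e : ℕ → ℝ) (J : ℕ), (∀ j, |e j| = 1) →
      ‖∑ j ∈ Finset.range J, ((e j * 2 ^ j : ℝ) : ℂ) • (T ^ (2 ^ j : ℕ) * (1 - T))‖ ≤ D := by
  obtain ⟨α₀, hαγ, htype, K, hK0, hK⟩ := hT
  have hα₀ := htype.1.1
  -- `α₀ < α < β < γ`: the resolvent bound is uniform outside of `B_α`, and the contour is `∂B_β`.
  set β := (α₀ + γ) / 2 with hβ
  set α := (α₀ + β) / 2 with hα
  obtain ⟨C, hC⟩ := htype.exists_hasStolzResolventBound (α' := α) (by linarith) (by linarith)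
  obtain ⟨ε, hε0, hε⟩ := exists_pos_add_mul_le (hα₀.trans hαγ) hγ
  refine ⟨K * (2 / ε), by positivity, fun e J he => ?_⟩
  set p : Polynomial ℂ := ∑ j ∈ Finset.range J,
    Polynomial.C ((e j * 2 ^ j : ℝ) : ℂ) * Polynomial.X ^ (2 ^ j : ℕ) with hp
  have hbound : ∀ z ∈ stolz γ, ‖p.eval z * (1 - z)‖ ≤ 2 / ε := by
    intro z hz
    have h1 := norm_lt_one_of_mem_stolz hz
    have h2 := norm_add_mul_le_of_mem hε0.le hε (subset_closure hz)
    have h3 : ‖1 - z‖ ≤ (1 - ‖z‖) / ε := by rw [le_div_iff₀ hε0]; linarith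
    have h4 : ‖p.eval z‖ ≤ ∑ j ∈ Finset.range J, (2 : ℝ) ^ j * ‖z‖ ^ (2 ^ j : ℕ) := by
      rw [hp, Polynomial.eval_finsetSum]
      refine norm_sum_le_of_le _ fun j _ => ?_
      rw [Polynomial.eval_mul, Polynomial.eval_C, Polynomial.eval_pow, Polynomial.eval_X, norm_mul,
        norm_pow, Complex.norm_real, Real.norm_eq_abs, abs_mul, he j, one_mul,
        abs_of_nonneg (by positivity)]
    have h5 := sum_two_pow_mul_pow_le (norm_nonneg z) h1.le J
    calc ‖p.eval z * (1 - z)‖ ≤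
        (∑ j ∈ Finset.range J, (2 : ℝ) ^ j * ‖z‖ ^ (2 ^ j : ℕ)) * ((1 - ‖z‖) / ε) :=
          norm_mul_le_of_le h4 h3
      _ = (∑ j ∈ Finset.range J, (2 : ℝ) ^ j * ‖z‖ ^ (2 ^ j : ℕ)) * (1 - ‖z‖) / ε := by ring
      _ ≤ 2 / ε := by gcongr
  have hmem : (fun z => p.eval z * (1 - z)) ∈ HInftyZero γ := by
    obtain ⟨B, hB⟩ := (isCompact_closedBall (0 : ℂ) 1).exists_bound_of_continuousOn
      p.continuous.continuousOn
    exact HInftyZero.mul_mem (one_sub_mem_HInftyZero _) p.differentiable.differentiableOn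
      fun z hz => hB z (by simpa using (norm_lt_one_of_mem_stolz hz).le)
  have h := (hK _ hmem β (by linarith) (by linarith)).trans
    (mul_le_mul_of_nonneg_left (supNorm_le (by positivity) hbound) hK0.le)
  rw [funCalc_polynomial hC (by linarith) (by linarith) (by linarith)] at h
  refine (le_of_eq ?_).trans h
  rw [hp, map_sum, Finset.sum_mul]
  congr 1
  refine Finset.sum_congr rfl fun j _ => ?_
  rw [map_mul, Polynomial.aeval_C, map_pow, Polynomial.aeval_X, ← Algebra.smul_def, smul_mul_assoc]

theorem squareFunctionEstimate_of_calculus {T : H →L[ℂ] H} (hpb : IsPowerBounded T) {γ : ℝ}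
    (hγ : γ < Real.pi / 2) (hT : HasBoundedHInftyCalculus T γ) :
    SquareFunctionEstimate T ∧ SquareFunctionEstimate (ContinuousLinearMap.adjoint T) := by
  obtain ⟨D, hD0, hD⟩ := exists_norm_sum_signs_le hγ hT
  have aux : ∀ S : H →L[ℂ] H, IsPowerBounded S → (∀ (e : ℕ → ℝ) (J : ℕ), (∀ j, |e j| = 1) →
      ‖∑ j ∈ Finset.range J, ((e j * 2 ^ j : ℝ) : ℂ) • (S ^ (2 ^ j : ℕ) * (1 - S))‖ ≤ D) →
      SquareFunctionEstimate S := by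
    rintro S ⟨M, hM⟩ hS
    have hM0 : 0 ≤ M := (norm_nonneg _).trans (hM 0)
    exact (squareFunctionEstimate_iff S).2 ⟨_, by positivity, squareBound_of_signs hM hD0 hS⟩
  refine ⟨aux T hpb hD, aux _ (isPowerBounded_adjoint hpb) fun e J he => ?_⟩
  refine (le_of_eq ?_).trans (hD e J he)
  rw [← LinearIsometryEquiv.norm_map ContinuousLinearMap.adjoint (∑ j ∈ _, _), map_sum]
  congr 1
  refine Finset.sum_congr rfl fun j _ => ?_
  rw [map_smulₛₗ, adjoint_pow_mul_one_sub, Complex.conj_ofReal,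
    ContinuousLinearMap.adjoint_adjoint]

end CalculusToSquare

/-! ### The functional calculus from square function estimates -/

section SquareToCalculus

theorem integral_mul_one_sub_mul_pow (a : ℝ) (k : ℕ) :
    ∫ t in (0 : ℝ)..1, ((k : ℝ) + 1) * (a * (1 - a * t) ^ k) = 1 - (1 - a) ^ (k + 1) := by
  have hderiv : ∀ t : ℝ, HasDerivAt (fun t : ℝ => -(1 - a * t) ^ (k + 1))
      (((k : ℝ) + 1) * (a * (1 - a * t) ^ k)) t := fun t => by
    have h := ((((hasDerivAt_id t).const_mul a).const_sub 1).pow (k + 1)).neg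
    refine h.congr_deriv ?_
    simp only [id, Nat.add_sub_cancel]
    push_cast
    ring
  rw [intervalIntegral.integral_eq_sub_of_hasDerivAt (fun t _ => hderiv t)
    (Continuous.intervalIntegrable (by fun_prop) _ _)]
  ring

/-- A function dominated by `|z| ^ k` has an integral of order `1 / (k + 1)` along the boundary of
a Stolz domain, uniformly with respect to the angle `β < γ`: indeed `|z| ≤ 1 - ε |1 - z|` on the
segments ending at `1`, and `|z| = sin β` on the arc. -/
theorem norm_stolzBoundaryIntegral_le_of_le_pow {E : Type*} [NormedAddCommGroup E]
    [NormedSpace ℂ E] {β γ ε A : ℝ} (hβ0 : 0 < β) (hβγ : β < γ) (hγ : γ < Real.pi / 2)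
    (hε : 0 < ε) (hε1 : Real.sin γ + ε * (1 + Real.sin γ) ≤ 1) (hA : 0 ≤ A) (k : ℕ) {f : ℂ → E}
    (hf : ∀ z ∈ stolzBdry β \ {1}, ‖f z‖ ≤ A * ‖z‖ ^ k) :
    ((k : ℝ) + 1) * ‖stolzBoundaryIntegral f β‖ ≤
      (2 / ε + 2 * Real.pi / (1 - Real.sin γ)) * A := by
  have hβ := hβγ.trans hγ
  have hs0 := sin_pos hβ0 hβ
  have hsβγ := sin_lt_sin hβ0 hβγ hγ
  have hsγ := sin_lt_one (hβ0.trans hβγ) hγ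
  have hc : 0 < Real.cos β := Real.cos_pos_of_mem_Ioo ⟨by linarith, hβ⟩
  have hc1 := Real.cos_le_one β
  have hεle : ε ≤ 1 := by nlinarith
  have hεc : ε * Real.cos β ≤ 1 := by nlinarith
  have hk : (0 : ℝ) < (k : ℝ) + 1 := by positivity
  have hpi := Real.pi_pos
  have hmem : ∀ i, ∀ t ∈ Set.Ioo (bdryLo β i) (bdryHi β i), bdryPath β i t ∈ stolzBdry β \ {1} :=
    fun i t ht => ⟨bdryPath_mem hβ0 hβ i (Set.Ioo_subset_Icc_self ht), bdryPath_ne_one hβ0 hβ i ht⟩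
  have hnorm : ∀ z ∈ stolzBdry β \ {1}, ‖z‖ ≤ 1 - ε * ‖1 - z‖ := fun z hz => by
    have := norm_add_mul_le_of_mem hε.le hε1
      (subset_closure (stolzBdry_diff_subset_stolz hβ0 hβγ hγ hz))
    linarith
  have piece : ∀ i (g : ℝ → ℝ), Continuous g →
      (∀ t ∈ Set.Ioo (bdryLo β i) (bdryHi β i), ‖bdryVel β i t‖ * ‖bdryPath β i t‖ ^ k ≤ g t) →
      ‖∫ t in Set.Ioo (bdryLo β i) (bdryHi β i), bdryVel β i t • f (bdryPath β i t)‖ ≤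
        A * ∫ t in bdryLo β i..bdryHi β i, g t := by
    intro i g hg hle
    rw [intervalIntegral.integral_of_le (bdryLo_le_bdryHi hβ0 i), integral_Ioc_eq_integral_Ioo,
      ← integral_const_mul]
    refine norm_integral_le_of_norm_le (((hg.integrableOn_Icc).mono_set
      Set.Ioo_subset_Icc_self).const_mul A) (ae_restrict_of_forall_mem measurableSet_Ioo
      fun t ht => ?_)
    rw [norm_smul]
    calc ‖bdryVel β i t‖ * ‖f (bdryPath β i t)‖
        ≤ ‖bdryVel β i t‖ * (A * ‖bdryPath β i t‖ ^ k) := by gcongr; exact hf _ (hmem i t ht)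
      _ = A * (‖bdryVel β i t‖ * ‖bdryPath β i t‖ ^ k) := by ring
      _ ≤ A * g t := by gcongr; exact hle t ht
  have hseg : ((k : ℝ) + 1) *
      ∫ t in (0 : ℝ)..1, Real.cos β * (1 - ε * Real.cos β * t) ^ k ≤ 1 / ε := by
    have h := integral_mul_one_sub_mul_pow (ε * Real.cos β) k
    have e : ∀ t : ℝ, ((k : ℝ) + 1) * (ε * Real.cos β * (1 - ε * Real.cos β * t) ^ k) =
        ε * (((k : ℝ) + 1) * (Real.cos β * (1 - ε * Real.cos β * t) ^ k)) := fun t => by ring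
    simp only [e] at h
    rw [intervalIntegral.integral_const_mul, intervalIntegral.integral_const_mul] at h
    rw [le_div_iff₀ hε, mul_comm, h]
    have : 0 ≤ (1 - ε * Real.cos β) ^ (k + 1) := pow_nonneg (by linarith) _
    linarith
  have p0 := piece 0 (fun t => Real.cos β * (1 - ε * Real.cos β * t) ^ k) (by fun_prop)
    fun t ht => by
      have h1 := hnorm _ (hmem 0 t ht)
      simp only [bdryLo, bdryHi, Matrix.cons_val_zero] at ht
      rw [norm_one_sub_bdryPath_zero hc.le ht.1.le] at h1
      have h2 : ‖bdryVel β 0 t‖ = Real.cos β := by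
        change ‖tangencyPt β 1 - 1‖ = _
        rw [norm_sub_rev, norm_one_sub_tangencyPt (Or.inl rfl) hc.le]
      rw [h2]
      gcongr
      linarith
  have p2 := piece 2 (fun t => Real.cos β * (1 - ε * Real.cos β * (1 - t)) ^ k) (by fun_prop)
    fun t ht => by
      have h1 := hnorm _ (hmem 2 t ht)
      simp only [bdryLo, bdryHi, Matrix.cons_val] at ht
      rw [norm_one_sub_bdryPath_two hc.le ht.2.le] at h1
      have h2 : ‖bdryVel β 2 t‖ = Real.cos β := by
        change ‖1 - tangencyPt β (-1)‖ = _
        rw [norm_one_sub_tangencyPt (Or.inr rfl) hc.le]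
      rw [h2]
      gcongr
      linarith
  have p1 := piece 1 (fun _ => Real.sin β ^ k) continuous_const fun t _ => by
    have h2 : ‖bdryVel β 1 t‖ = Real.sin β := by
      change ‖(Real.sin β : ℂ) * Complex.I * Complex.exp (t * Complex.I)‖ = _
      rw [norm_mul, norm_mul, Complex.norm_exp_ofReal_mul_I, Complex.norm_real, Complex.norm_I,
        mul_one, mul_one, Real.norm_of_nonneg hs0.le]
    rw [h2, norm_bdryPath_one hs0.le]
    exact mul_le_of_le_one_left (by positivity) (by linarith)
  have harc : ((k : ℝ) + 1) * ∫ _ in bdryLo β 1..bdryHi β 1, Real.sin β ^ k ≤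
      2 * Real.pi / (1 - Real.sin γ) := by
    have h2 : ((k : ℝ) + 1) * Real.sin β ^ k * (1 - Real.sin β) ≤ 1 := by
      have h3 := geom_sum_mul_neg (Real.sin β) (k + 1)
      have h4 : ((k : ℝ) + 1) * Real.sin β ^ k ≤ ∑ i ∈ Finset.range (k + 1), Real.sin β ^ i := by
        have h5 : ∑ _i ∈ Finset.range (k + 1), Real.sin β ^ k = ((k : ℝ) + 1) * Real.sin β ^ k := by
          rw [Finset.sum_const, Finset.card_range, nsmul_eq_mul]; push_cast; ring
        rw [← h5]
        exact Finset.sum_le_sum fun i hi => pow_le_pow_of_le_one hs0.le (by linarith)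
          (Nat.lt_succ_iff.1 (Finset.mem_range.1 hi))
      have h5 := mul_le_mul_of_nonneg_right h4 (by linarith : 0 ≤ 1 - Real.sin β)
      have h6 : 0 ≤ Real.sin β ^ (k + 1) := by positivity
      linarith
    have hlen : bdryHi β 1 - bdryLo β 1 ≤ 2 * Real.pi := by
      simp only [bdryLo, bdryHi, Matrix.cons_val_one, Matrix.cons_val_zero]
      linarith
    rw [intervalIntegral.integral_const, smul_eq_mul, le_div_iff₀ (by linarith)]
    have h6 : 0 ≤ ((k : ℝ) + 1) * Real.sin β ^ k := by positivity
    calc ((k : ℝ) + 1) * ((bdryHi β 1 - bdryLo β 1) * Real.sin β ^ k) * (1 - Real.sin γ)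
        = (bdryHi β 1 - bdryLo β 1) * (((k : ℝ) + 1) * Real.sin β ^ k * (1 - Real.sin γ)) := by
          ring
      _ ≤ 2 * Real.pi * (((k : ℝ) + 1) * Real.sin β ^ k * (1 - Real.sin β)) := by
          have := bdryLo_le_bdryHi hβ0 1
          gcongr
      _ ≤ 2 * Real.pi * 1 := by gcongr
      _ = 2 * Real.pi := mul_one _
  have hrefl : ∫ t in bdryLo β 2..bdryHi β 2, Real.cos β * (1 - ε * Real.cos β * (1 - t)) ^ k =
      ∫ t in (0 : ℝ)..1, Real.cos β * (1 - ε * Real.cos β * t) ^ k := by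
    have := intervalIntegral.integral_comp_sub_left (a := 0) (b := 1)
      (fun t => Real.cos β * (1 - ε * Real.cos β * t) ^ k) 1
    rw [sub_self, sub_zero] at this
    exact this
  rw [hrefl] at p2
  change _ ≤ A * ∫ t in (0 : ℝ)..1, Real.cos β * (1 - ε * Real.cos β * t) ^ k at p0
  rw [stolzBoundaryIntegral_eq_sum_Ioo f hβ0, Fin.sum_univ_three]
  refine (mul_le_mul_of_nonneg_left ((norm_add₃_le).trans
    (add_le_add (add_le_add p0 p1) p2)) hk.le).trans ?_
  set I := ∫ t in (0 : ℝ)..1, Real.cos β * (1 - ε * Real.cos β * t) ^ k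
  set J := ∫ _ in bdryLo β 1..bdryHi β 1, Real.sin β ^ k
  calc ((k : ℝ) + 1) * (A * I + A * J + A * I)
      = (2 * (((k : ℝ) + 1) * I) + ((k : ℝ) + 1) * J) * A := by ring
    _ ≤ (2 * (1 / ε) + 2 * Real.pi / (1 - Real.sin γ)) * A := by gcongr
    _ = _ := by ring

section Banach

variable {X : Type*} [NormedAddCommGroup X] [NormedSpace ℂ X] [CompleteSpace X]
  {T : X →L[ℂ] X} {α β γ C ε : ℝ} {φ : ℂ → ℂ}

theorem funCalc_mul_pow_mul_one_sub (hT : HasStolzResolventBound T α C) (hα0 : 0 < α) (hαβ : α < β)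
    (hβγ : β < γ) (hγ : γ < Real.pi / 2) (hφ : φ ∈ HInftyZero γ) (k : ℕ) :
    funCalc T β φ * (T ^ k * (1 - T)) = funCalc T β (fun z => (1 - z) * (z ^ k * φ z)) := by
  rw [← mul_assoc, funCalc_mul_pow hT hα0 hαβ hβγ hγ hφ,
    funCalc_mul_one_sub hT hα0 hαβ hβγ hγ (pow_mul_mem_HInftyZero hφ k)]

/-- The operators `(k + 1) φ(T) T ^ k (I - T)` are controlled by the supremum norm of `φ`, because
the factor `1 - z` compensates the singularity of the resolvent at `1`. -/
theorem norm_funCalc_mul_pow_mul_one_sub_le (hT : HasStolzResolventBound T α C) (hα0 : 0 < α)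
    (hαβ : α < β) (hβγ : β < γ) (hγ : γ < Real.pi / 2) (hε : 0 < ε)
    (hε1 : Real.sin γ + ε * (1 + Real.sin γ) ≤ 1) (hφ : φ ∈ HInftyZero γ) (k : ℕ) :
    ((k : ℝ) + 1) * ‖funCalc T β φ * (T ^ k * (1 - T))‖ ≤
      (2 / ε + 2 * Real.pi / (1 - Real.sin γ)) * C * supNorm γ φ := by
  have hβ := hβγ.trans hγ
  have hC0 := hT.nonneg hα0 (hαβ.trans hβ)
  have hsup := supNorm_nonneg γ φ
  rw [funCalc_mul_pow_mul_one_sub hT hα0 hαβ hβγ hγ hφ]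
  have h := norm_stolzBoundaryIntegral_le_of_le_pow (A := supNorm γ φ * C)
    (f := fun z => ((1 - z) * (z ^ k * φ z)) • resolvent T z) (hα0.trans hαβ) hβγ hγ hε hε1
    (by positivity) k fun z hz => by
      have hpos : 0 < ‖1 - z‖ := norm_pos_iff.2 (sub_ne_zero.2 (by simpa [eq_comm] using hz.2))
      have h1 := (resolvent_bound hT hα0 hαβ hβ hz).2
      have h2 := le_supNorm hφ (stolzBdry_diff_subset_stolz (hα0.trans hαβ) hβγ hγ hz)
      rw [norm_smul, norm_mul, norm_mul, norm_pow]
      calc ‖1 - z‖ * (‖z‖ ^ k * ‖φ z‖) * ‖resolvent T z‖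
          ≤ ‖1 - z‖ * (‖z‖ ^ k * supNorm γ φ) * (C * ‖1 - z‖⁻¹) := by gcongr
        _ = supNorm γ φ * C * ‖z‖ ^ k := by field_simp
  have hpi : ‖(2 * (Real.pi : ℂ) * Complex.I)⁻¹‖ ≤ 1 := by
    rw [norm_inv, norm_mul, norm_mul, Complex.norm_I, Complex.norm_real,
      Real.norm_of_nonneg Real.pi_pos.le, mul_one, Complex.norm_ofNat]
    exact inv_le_one_of_one_le₀ (by linarith [Real.pi_gt_three])
  unfold funCalc
  rw [norm_smul]
  calc ((k : ℝ) + 1) * (‖(2 * (Real.pi : ℂ) * Complex.I)⁻¹‖ * ‖stolzBoundaryIntegral _ β‖)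
      ≤ ((k : ℝ) + 1) * (1 * ‖stolzBoundaryIntegral
          (fun z => ((1 - z) * (z ^ k * φ z)) • resolvent T z) β‖) := by gcongr
    _ ≤ (2 / ε + 2 * Real.pi / (1 - Real.sin γ)) * (supNorm γ φ * C) := by rw [one_mul]; exact h
    _ = _ := by ring

theorem tendsto_funCalc_mul_pow (hT : HasStolzResolventBound T α C) (hα0 : 0 < α) (hαβ : α < β)
    (hβγ : β < γ) (hγ : γ < Real.pi / 2) (hφ : φ ∈ HInftyZero γ) :
    Tendsto (fun n => funCalc T β φ * T ^ n) atTop (𝓝 0) := by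
  have hβ := hβγ.trans hγ
  have hβ0 := hα0.trans hαβ
  obtain ⟨hcont, s, B, hs, hB0, -, hB⟩ :=
    continuousOn_and_bound_of_mem_HInftyZero hT hα0 hαβ hβγ hγ hφ
  have h := tendsto_stolzBoundaryIntegral (l := atTop) (q := s - 1) (B := C * B)
    (F := fun (n : ℕ) z => (z ^ n * φ z) • resolvent T z) (f := fun _ => (0 : X →L[ℂ] X)) hβ0 hβ
    (by linarith)
    (Eventually.of_forall fun n => (continuousOn_and_bound_of_mem_HInftyZero hT hα0 hαβ hβγ hγ
      (pow_mul_mem_HInftyZero hφ n)).1)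
    (Eventually.of_forall fun n z hz => by
      rw [mul_smul, norm_smul, norm_pow]
      exact (mul_le_of_le_one_left (norm_nonneg _) (pow_le_one₀ (norm_nonneg _)
        (norm_lt_one_of_mem_bdry hβ0 hβ hz).le)).trans (hB z hz))
    (fun z hz => by
      have h1 := (tendsto_pow_atTop_nhds_zero_of_norm_lt_one
        (norm_lt_one_of_mem_bdry hβ0 hβ hz)).smul_const (φ z • resolvent T z)
      simpa only [zero_smul, mul_smul] using h1)
  rw [stolzBoundaryIntegral_const hβ0 hβ] at h
  simp only [funCalc_mul_pow hT hα0 hαβ hβγ hγ hφ]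
  unfold funCalc
  simpa using h.const_smul (2 * (Real.pi : ℂ) * Complex.I)⁻¹

end Banach

open Polynomial in
/-- A discrete version of `∫₀^∞ t² e^{-ta} a³ dt = 2`. -/
theorem two_nsmul_one_eq_sum_mul_pow_mul_one_sub_cube {R : Type*} [Ring R] (s : R) (n : ℕ) :
    2 • (1 : R) = ∑ k ∈ Finset.range n, ((k + 1) * (k + 2)) • (s ^ k * (1 - s) ^ 3) +
      (2 • s ^ n + (2 * n) • (s ^ n * (1 - s)) + (n * (n + 1)) • (s ^ n * (1 - s) ^ 2)) := by
  have h : 2 • (1 : ℤ[X]) =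
      ∑ k ∈ Finset.range n, ((k + 1) * (k + 2)) • (X ^ k * (1 - X) ^ 3) +
      (2 • X ^ n + (2 * n) • (X ^ n * (1 - X)) + (n * (n + 1)) • (X ^ n * (1 - X) ^ 2)) := by
    simp only [nsmul_eq_mul]
    push_cast
    induction n with
    | zero => simp
    | succ n ih =>
      rw [Finset.sum_range_succ]
      refine ih.trans ?_
      push_cast
      ring
  have h2 := congrArg (aeval s) h
  simp only [map_add, map_sum, map_nsmul, map_mul, map_pow, map_sub, map_one, aeval_X] at h2
  exact h2

end SquareToCalculus

/-! ### Boundedness of the functional calculus -/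

section BoundedCalculus

variable {H : Type*} [NormedAddCommGroup H] [InnerProductSpace ℂ H] [CompleteSpace H]

/-- If `Φ` commutes with `T`, is annihilated by large powers of `T`, and satisfies
`‖Φ T^k (I - T)‖ ≤ K / (k + 1)`, then the square functions of `T` and `T*` bound `Φ` in terms
of `K`. With `S = T ^ 3`, one decomposes `2 Φ = ∑ (k + 1) (k + 2) Φ S ^ k (I - S) ^ 3`, and splits
the operator in the sum into `T ^ k (I - T)` acting from the left, `Φ T ^ k (I - T)`, and
`T ^ k (I - T)` acting on the vector. -/
theorem norm_le_of_squareBound_of_norm_mul_le {T Φ : H →L[ℂ] H} {C D K : ℝ} (hT : IsRitt T)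
    (hC0 : 0 ≤ C) (hC : SquareBound T C) (hD0 : 0 ≤ D)
    (hD : SquareBound (ContinuousLinearMap.adjoint T) D) (hcomm : Commute Φ T)
    (hlim : Tendsto (fun n => Φ * T ^ n) atTop (𝓝 0)) (hK0 : 0 ≤ K)
    (hK : ∀ k : ℕ, ((k : ℝ) + 1) * ‖Φ * (T ^ k * (1 - T))‖ ≤ K) :
    ‖Φ‖ ≤ K * (C * ‖(1 + T + T ^ 2) ^ 3‖ * D) := by
  obtain ⟨⟨M, hM⟩, R, hR⟩ := (isRitt_iff T).1 hT
  have hM0 : 0 ≤ M := (norm_nonneg _).trans (hM 0)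
  set P : H →L[ℂ] H := 1 + T + T ^ 2 with hP
  set A : ℕ → H →L[ℂ] H := fun k => T ^ k * (1 - T) with hA
  have hfac : 1 - T ^ 3 = (1 - T) * P := by rw [hP]; noncomm_ring
  have hTP : Commute T P := ((Commute.one_right T).add_right (Commute.refl T)).add_right
    ((Commute.refl T).pow_right 2)
  have hT1 : Commute T (1 - T) := (Commute.one_right T).sub_right (Commute.refl T)
  have hP1 : Commute (1 - T) P := ((Commute.one_left P).sub_left hTP)
  have hΦA : ∀ k, Commute Φ (A k) := fun k =>
    (hcomm.pow_right k).mul_right ((Commute.one_right Φ).sub_right hcomm)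
  -- The remainder terms of the decomposition tend to zero.
  have hrem : Tendsto (fun n : ℕ => Φ * (2 • (T ^ 3) ^ n + (2 * n) • ((T ^ 3) ^ n * (1 - T ^ 3)) +
      (n * (n + 1)) • ((T ^ 3) ^ n * (1 - T ^ 3) ^ 2))) atTop (𝓝 0) := by
    have hsplit : ∀ n : ℕ, 2 • (T ^ 3) ^ n + (2 * n) • ((T ^ 3) ^ n * (1 - T ^ 3)) +
        (n * (n + 1)) • ((T ^ 3) ^ n * (1 - T ^ 3) ^ 2) =
        T ^ n * (2 • T ^ (2 * n) + (2 * n) • (T ^ n * (A n * P)) +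
          (n * (n + 1)) • (A n * A n * P ^ 2)) := by
      intro n
      have e1 : (1 - T ^ 3) ^ 2 = (1 - T) ^ 2 * P ^ 2 := by rw [hfac, hP1.mul_pow]
      have e2 : A n * A n = T ^ (2 * n) * (1 - T) ^ 2 := by
        rw [hA, pow_two (1 - T), two_mul, pow_add]
        exact (hT1.pow_left n).symm.mul_mul_mul_comm _ _
      have e3 : (T ^ 3) ^ n = T ^ n * T ^ (2 * n) := by
        rw [← pow_mul, ← pow_add]; congr 1; ring
      have e4 : (T ^ 3) ^ n * (1 - T ^ 3) = T ^ n * (T ^ n * (A n * P)) := by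
        rw [e3, hfac, hA, two_mul, pow_add]
        simp only [mul_assoc]
      have e5 : (T ^ 3) ^ n * (1 - T ^ 3) ^ 2 = T ^ n * (A n * A n * P ^ 2) := by
        rw [e3, e1, e2]
        simp only [mul_assoc]
      rw [e4, e5, e3, mul_add (T ^ n), mul_add (T ^ n), mul_smul_comm, mul_smul_comm, mul_smul_comm]
    have hbd : ∀ n : ℕ, ‖2 • T ^ (2 * n) + (2 * n) • (T ^ n * (A n * P)) +
        (n * (n + 1)) • (A n * A n * P ^ 2)‖ ≤
        2 * M + 2 * (M * (R * ‖P‖)) + R * R * ‖P ^ 2‖ := by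
      intro n
      have hn0 : (0 : ℝ) ≤ n := n.cast_nonneg
      have hRn : (n : ℝ) * ‖A n‖ ≤ R := by
        refine le_trans ?_ (hR n)
        gcongr
        linarith
      refine (norm_add₃_le).trans (add_le_add (add_le_add ?_ ?_) ?_)
      · refine (norm_nsmul_le).trans ?_
        push_cast
        gcongr
        exact hM _
      · have h1 : ‖T ^ n * (A n * P)‖ ≤ M * (‖A n‖ * ‖P‖) :=
          norm_mul_le_of_le (hM n) (norm_mul_le _ _)
        refine (norm_nsmul_le).trans ?_
        push_cast
        calc (2 * n : ℝ) * ‖T ^ n * (A n * P)‖ ≤ 2 * n * (M * (‖A n‖ * ‖P‖)) := by gcongr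
          _ = 2 * (M * (n * ‖A n‖ * ‖P‖)) := by ring
          _ ≤ 2 * (M * (R * ‖P‖)) := by gcongr
      · have h1 : ‖A n * A n * P ^ 2‖ ≤ ‖A n‖ * ‖A n‖ * ‖P ^ 2‖ :=
          norm_mul_le_of_le (norm_mul_le _ _) le_rfl
        have hR0 : 0 ≤ R := (by positivity : (0 : ℝ) ≤ n * ‖A n‖).trans hRn
        refine (norm_nsmul_le).trans ?_
        push_cast
        calc (n * (n + 1) : ℝ) * ‖A n * A n * P ^ 2‖
            ≤ n * (n + 1) * (‖A n‖ * ‖A n‖ * ‖P ^ 2‖) := by gcongr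
          _ = n * ‖A n‖ * ((n + 1) * ‖A n‖) * ‖P ^ 2‖ := by ring
          _ ≤ R * R * ‖P ^ 2‖ := by gcongr; exact hR n
    have h0 := (tendsto_zero_iff_norm_tendsto_zero.1 hlim).mul_const
      (2 * M + 2 * (M * (R * ‖P‖)) + R * R * ‖P ^ 2‖)
    rw [zero_mul] at h0
    refine squeeze_zero_norm (fun n => ?_) h0
    rw [hsplit, ← mul_assoc Φ]
    exact norm_mul_le_of_le le_rfl (hbd n)
  have hterm : ∀ k : ℕ, Φ * ((T ^ 3) ^ k * (1 - T ^ 3) ^ 3) = A k * (Φ * A k) * (A k * P ^ 3) := by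
    intro k
    have e1 : (1 - T ^ 3) ^ 3 = (1 - T) ^ 3 * P ^ 3 := by rw [hfac, hP1.mul_pow]
    have e2 : A k * (A k * A k) = (T ^ 3) ^ k * (1 - T) ^ 3 := by
      have : A k ^ 3 = (T ^ 3) ^ k * (1 - T) ^ 3 := by
        rw [hA, (hT1.pow_left k).mul_pow, ← pow_mul, ← pow_mul, mul_comm k]
      rw [← this, pow_succ', pow_two]
    rw [e1, ← mul_assoc ((T ^ 3) ^ k), ← e2, ← mul_assoc (A k) Φ, ← (hΦA k).eq]
    simp only [mul_assoc]
  -- The main terms are controlled by the two square functions.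
  have hmain : ∀ (n : ℕ) (x y : H), ‖inner ℂ y ((Φ * ∑ k ∈ Finset.range n,
      ((k + 1) * (k + 2)) • ((T ^ 3) ^ k * (1 - T ^ 3) ^ 3)) x)‖ ≤
        2 * (K * (C * ‖P ^ 3‖ * D)) * (‖x‖ * ‖y‖) := by
    intro n x y
    set a : ℕ → ℝ := fun k => ‖A k ((P ^ 3) x)‖ with ha
    set b : ℕ → ℝ := fun k =>
      ‖(ContinuousLinearMap.adjoint T ^ k * (1 - ContinuousLinearMap.adjoint T)) y‖ with hb
    have hsum : (Φ * ∑ k ∈ Finset.range n, ((k + 1) * (k + 2)) •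
        ((T ^ 3) ^ k * (1 - T ^ 3) ^ 3)) x =
        ∑ k ∈ Finset.range n, (((k + 1) * (k + 2) : ℕ) : ℂ) •
          (A k * (Φ * A k) * (A k * P ^ 3)) x := by
      rw [Finset.mul_sum, sum_apply]
      refine Finset.sum_congr rfl fun k _ => ?_
      rw [mul_smul_comm, hterm, Nat.cast_smul_eq_nsmul, smul_apply]
    have hin : ∀ k, ‖inner ℂ y ((A k * (Φ * A k) * (A k * P ^ 3)) x)‖ ≤ b k * (‖Φ * A k‖ * a k) := by
      intro k
      have e : (A k * (Φ * A k) * (A k * P ^ 3)) x = A k ((Φ * A k) (A k ((P ^ 3) x))) := rfl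
      rw [e, ← ContinuousLinearMap.adjoint_inner_left, hA, adjoint_pow_mul_one_sub]
      exact (norm_inner_le_norm _ _).trans (mul_le_mul_of_nonneg_left
        (ContinuousLinearMap.le_opNorm _ _) (norm_nonneg _))
    have hcs : ∑ k ∈ Finset.range n, ((k : ℝ) + 1) * (a k * b k) ≤
        (C * (‖P ^ 3‖ * ‖x‖)) * (D * ‖y‖) := by
      refine weighted_cauchy_schwarz _ (fun _ _ => by positivity) (by positivity) (by positivity) ?_ ?_
      · refine (hC ((P ^ 3) x) n).trans ?_
        rw [mul_pow]
        gcongr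
        exact ContinuousLinearMap.le_opNorm _ _
      · rw [mul_pow]
        exact hD y n
    rw [hsum, inner_sum]
    calc ‖∑ k ∈ Finset.range n, inner ℂ y ((((k + 1) * (k + 2) : ℕ) : ℂ) •
          (A k * (Φ * A k) * (A k * P ^ 3)) x)‖
        ≤ ∑ k ∈ Finset.range n, 2 * K * (((k : ℝ) + 1) * (a k * b k)) := by
          refine norm_sum_le_of_le _ fun k _ => ?_
          rw [inner_smul_right, norm_mul, Complex.norm_natCast]
          push_cast
          have hab : 0 ≤ a k * b k := mul_nonneg (norm_nonneg _) (norm_nonneg _)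
          calc ((k : ℝ) + 1) * (k + 2) * ‖inner ℂ y ((A k * (Φ * A k) * (A k * P ^ 3)) x)‖
              ≤ ((k : ℝ) + 1) * (2 * (k + 1)) * (b k * (‖Φ * A k‖ * a k)) := by
                gcongr
                · linarith
                · exact hin k
            _ = 2 * ((k + 1) * ‖Φ * A k‖) * (((k : ℝ) + 1) * (a k * b k)) := by ring
            _ ≤ 2 * K * (((k : ℝ) + 1) * (a k * b k)) := by gcongr; exact hK k
      _ = 2 * K * ∑ k ∈ Finset.range n, ((k : ℝ) + 1) * (a k * b k) := by rw [Finset.mul_sum]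
      _ ≤ 2 * K * ((C * (‖P ^ 3‖ * ‖x‖)) * (D * ‖y‖)) := by gcongr
      _ = _ := by ring
  have hinner : ∀ x y : H, ‖inner ℂ y (Φ x)‖ ≤ K * (C * ‖P ^ 3‖ * D) * (‖x‖ * ‖y‖) := by
    intro x y
    have h1 : ∀ n : ℕ, ‖inner ℂ y ((2 : ℂ) • Φ x)‖ ≤
        2 * (K * (C * ‖P ^ 3‖ * D)) * (‖x‖ * ‖y‖) +
        ‖inner ℂ y ((Φ * (2 • (T ^ 3) ^ n + (2 * n) • ((T ^ 3) ^ n * (1 - T ^ 3)) +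
          (n * (n + 1)) • ((T ^ 3) ^ n * (1 - T ^ 3) ^ 2)) : H →L[ℂ] H) x)‖ := by
      intro n
      have e : (2 : ℂ) • Φ x = (Φ * 2 • (1 : H →L[ℂ] H)) x := by
        rw [mul_smul_comm, mul_one, two_smul, two_smul]; rfl
      rw [e, two_nsmul_one_eq_sum_mul_pow_mul_one_sub_cube (T ^ 3) n, mul_add, add_apply,
        inner_add_right]
      exact norm_add_le_of_le (hmain n x y) le_rfl
    have h2 := (((continuous_const (y := y)).inner (𝕜 := ℂ)
      ((ContinuousLinearMap.apply ℂ H x).continuous)).norm.tendsto (0 : H →L[ℂ] H)).comp hrem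
    simp only [map_zero, inner_zero_right, norm_zero] at h2
    have h3 := ge_of_tendsto' (h2.const_add (2 * (K * (C * ‖P ^ 3‖ * D)) * (‖x‖ * ‖y‖))) h1
    rw [inner_smul_right, norm_mul, Complex.norm_ofNat] at h3
    linarith
  refine ContinuousLinearMap.opNorm_le_bound _ (by positivity) fun x => ?_
  have h := hinner x (Φ x)
  rw [inner_self_eq_norm_sq_to_K, norm_pow, RCLike.norm_ofReal, abs_norm, pow_two,
    ← mul_assoc _ ‖x‖] at h
  rcases (norm_nonneg (Φ x)).eq_or_lt with h0 | h0
  · rw [← h0]; positivity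
  · exact le_of_mul_le_mul_right h h0

theorem exists_calculus_of_squareFunctionEstimate {T : H →L[ℂ] H} (hpb : IsPowerBounded T)
    (h : SquareFunctionEstimate T) (h' : SquareFunctionEstimate (ContinuousLinearMap.adjoint T)) :
    IsRitt T ∧ ∃ γ : ℝ, 0 < γ ∧ γ < Real.pi / 2 ∧ HasBoundedHInftyCalculus T γ := by
  obtain ⟨C, hC0, hC⟩ := (squareFunctionEstimate_iff _).1 h
  obtain ⟨D, hD0, hD⟩ := (squareFunctionEstimate_iff _).1 h'
  have hT := isRitt_of_squareBound hpb hC0 hC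
  obtain ⟨α, R, hα0, hα, hR⟩ := exists_type_of_isRitt hT
  have hR' : HasStolzResolventBound T α R := hR
  set γ := (α + Real.pi / 2) / 2 with hγdef
  have hαγ : α < γ := by linarith
  have hγ : γ < Real.pi / 2 := by linarith
  obtain ⟨ε, hε0, hε⟩ := exists_pos_add_mul_le (hα0.trans hαγ) hγ
  have hs1 := sin_lt_one (hα0.trans hαγ) hγ
  have hpi := Real.pi_pos
  have hR0 := hR'.nonneg hα0 hα
  set W := (2 / ε + 2 * Real.pi / (1 - Real.sin γ)) * R with hW
  have hW0 : 0 ≤ W :=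
    mul_nonneg (add_nonneg (by positivity) (div_nonneg (by positivity) (by linarith))) hR0
  set Q := W * (C * ‖(1 + T + T ^ 2) ^ 3‖ * D) with hQ
  refine ⟨hT, γ, hα0.trans hαγ, hγ, α, hαγ, ⟨⟨hα0, hα⟩, fun z hz => ?_, fun β hαβ hβ =>
    ⟨R, fun z hz => (hR z fun hz' => hz ?_).2⟩⟩, Q + 1, by positivity, fun φ hφ β hαβ hβγ => ?_⟩
  · by_contra hz'
    exact hz (hR z hz').1
  · exact closure_mono (stolz_mono (sin_lt_sin hα0 hαβ hβ).le) hz'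
  · have hsup := supNorm_nonneg γ φ
    have hcomm : Commute (funCalc T β φ) T :=
      (funCalc_mul hR' hα0 hαβ hβγ hγ hφ).trans (mul_funCalc hR' hα0 hαβ hβγ hγ hφ).symm
    have hle := norm_le_of_squareBound_of_norm_mul_le hT hC0 hC hD0 hD hcomm
      (tendsto_funCalc_mul_pow hR' hα0 hαβ hβγ hγ hφ) (mul_nonneg hW0 hsup)
      (norm_funCalc_mul_pow_mul_one_sub_le hR' hα0 hαβ hβγ hγ hε0 hε hφ)
    refine hle.trans ?_
    rw [mul_right_comm, ← hQ]
    gcongr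
    linarith

end BoundedCalculus

end Ritt

end

theorem theorem8p1 {H : Type*} [NormedAddCommGroup H] [InnerProductSpace ℂ H] [CompleteSpace H]
    (T : H →L[ℂ] H) (hT : Ritt.IsPowerBounded T) :
    List.TFAE
      [ Ritt.IsRitt T ∧
          ∃ γ : ℝ, 0 < γ ∧ γ < Real.pi / 2 ∧ Ritt.HasBoundedHInftyCalculus T γ,
        Ritt.SquareFunctionEstimate T ∧
          Ritt.SquareFunctionEstimate (ContinuousLinearMap.adjoint T),
        Ritt.IsRitt T ∧ Ritt.IsSimilarToContraction T ] := by
  tfae_have 1 → 2 := fun ⟨_, γ, _, hγ, h⟩ => Ritt.squareFunctionEstimate_of_calculus hT hγ h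
  tfae_have 2 → 1 := fun ⟨h, h'⟩ => Ritt.exists_calculus_of_squareFunctionEstimate hT h h'
  tfae_have 2 → 3 := fun ⟨h, h'⟩ => by
    obtain ⟨C, hC0, hC⟩ := (Ritt.squareFunctionEstimate_iff _).1 h
    obtain ⟨D, hD0, hD⟩ := (Ritt.squareFunctionEstimate_iff _).1 h'
    exact ⟨Ritt.isRitt_of_squareBound hT hC0 hC,
      Ritt.isSimilarToContraction_of_squareBound hT hC0 hD0 hC hD⟩
  tfae_have 3 → 2 := fun ⟨h, h'⟩ =>
    ⟨Ritt.squareFunctionEstimate_of_isSimilarToContraction h h',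
      Ritt.squareFunctionEstimate_of_isSimilarToContraction (Ritt.isRitt_adjoint h)
        (Ritt.isSimilarToContraction_adjoint h')⟩
  tfae_finish
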